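/- Let $k$ be a non-Archimedean local field of characteristic $\neq 2$, with ring of integers $\mathcal O_k$, uniformizer $\varpi$ and absolute value $|\cdot|_k$ given by the module function. Fix a non-trivial continuous character $\Psi$ of $(k,+)$, let $n(\Psi)\in\mathbb Z$ be the smallest integer such that $\Psi$ is trivial on $\varpi^{n(\Psi)}\mathcal O_k$, and normalize the Haar measure of $(k,+)$ by $\mathrm{Vol}(\mathcal O_k)\,\mathrm{Vol}(\varpi^{n(\Psi)}\mathcal O_k)=1$. Let $d\in\mathbb N$. For $X=(x,\xi)$, $Y=(y,\eta)$ in $k^{2d}=k^d\times k^d$ put $[X,Y]=\langle y,\xi\rangle-\langle x,\eta\rangle$ and $$\mu_0(X)=\max\Big\{1,\ \max_i|2x_i|_k,\ \max_i|2\xi_i\varpi^{-n(\Psi)}|_k\Big\},\qquad (\mathcal Gf)(X)=|2|_k^d\int_{k^{2d}}f(Y)\,\Psi(2[Y,X])\,dY .$$ For $\theta\in\mathcal O_k$ and $n\in\mathbb N$ let $J_\theta^n=\mathcal G\circ I_\theta^n\circ\mathcal G$, where $I_\theta$ is multiplication by $X\mapsto\mu_0(\theta X)$; it acts on locally constant compactly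 supported functions $\varphi$ and, by transposition $\langle J_\theta^nF,\varphi\rangle=\langle F,J_\theta^n\varphi\rangle$, on distributions, in particular on bounded continuous functions on $k^{2d}$ with values in a $C^*$-algebra. Write $J=J_1$. Let $A$ be a (not necessarily unital) $C^*$-algebra with a continuous action $\alpha$ of $k^{2d}$, that is, a homomorphism $X\mapsto\alpha_X$ from $k^{2d}$ to the $*$-automorphisms of $A$ such that $X\mapsto\alpha_X(a)$ is norm continuous for every $a\in A$. Put $\tilde\alpha(a)(X)=\alpha_X(a)$ and $$A_{\rm reg}=\{a\in A:\ J^n\tilde\alpha(a)\in L^\infty(k^{2d},A)\ \text{for all } n\in\mathbb N\},$$ and let $\theta\in\mathcal O_k$. Then $A_{\rm reg}$ is a linear subspace of $A$; for $a\in A_{\rm reg}$ and $n\in\mathbb N$ the distributions $J^n\tilde\alpha(a)$ and $J_\theta^n\tilde\alpha(a)$ are given by unique bounded continuous functions; for $a,b\in A_{\rm reg}$ the integral $$a\star_\theta^\alpha b=|2|_k^{2d}\int_{k^{2d}\times k^{2d}}\overline{\Psi}(2[X,Y])\,\mu_0(X)^{-2d-1}\mu_0(Y)^{-2d-1}\,\big(J_\theta^{2d+1}\tilde\alpha(a)\big)(\theta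 X)\,\big(J^{2d+1}\tilde\alpha(b)\big)(Y)\,dX\,dY$$ converges absolutely and lies in $A_{\rm reg}$; and $(A_{\rm reg},\star_\theta^\alpha)$ is an associative Fréchet algebra for the seminorms $\|a\|_n=\sup_X\|(J^n\tilde\alpha(a))(X)\|_A$, $n\in\mathbb N$: these seminorms define a complete Hausdorff topology, and $\star_\theta^\alpha$ is bilinear, jointly continuous and associative. Moreover every $\alpha_X$ restricts to an automorphism of $(A_{\rm reg},\star_\theta^\alpha)$ that is isometric for each seminorm, and the involution of $A$ preserves $A_{\rm reg}$, is isometric for each seminorm and satisfies $(a\star_\theta^\alpha b)^*=b^*\star_\theta^\alpha a^*$. -/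

import Mathlib

open MeasureTheory Filter Topology
open scoped ENNReal ValuativeRel BoundedContinuousFunction

namespace PadicMoyal

noncomputable section

/-- The normalized absolute value `|x|` of a local field: the module function of `K`, i.e. the
factor `|x|` with `vol (x S) = |x| vol S` for every Haar measure of `(K, +)`, extended by `0`
at `x = 0`. -/
def absK {K : Type*} [Field K] [ValuativeRel K] [TopologicalSpace K]
    [IsNonarchimedeanLocalField K] (x : K) : ℝ :=
  open Classical in
  if hx : x = 0 then 0 else (distribHaarChar K (Units.mk0 x hx) : ℝ)

/-- The phase space `K^{2d}`, with elements `X = (x, ξ)`, `x, ξ ∈ K^d`. -/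
abbrev Phase (K : Type*) (d : ℕ) : Type _ := (Fin d → K) × (Fin d → K)

/-- The exponent `n(Ψ)`: the smallest integer `n` such that `Ψ` is trivial on `ϖ ^ n 𝒪`. For a
continuous nontrivial character such integers exist and are bounded below. -/
def conductorExp {K : Type*} [Field K] [ValuativeRel K] (Ψ : AddChar K Circle) (ϖ : 𝒪[K]) : ℤ :=
  sInf {n : ℤ | ∀ y : 𝒪[K], Ψ ((ϖ : K) ^ n * (y : K)) = 1}

/-- The conductor `ϖ ^ n(Ψ) 𝒪` of `Ψ`, the largest (fractional) ideal on which `Ψ` is trivial. -/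
def conductor {K : Type*} [Field K] [ValuativeRel K] (Ψ : AddChar K Circle) (ϖ : 𝒪[K]) : Set K :=
  {x : K | ∃ y : 𝒪[K], x = (ϖ : K) ^ conductorExp Ψ ϖ * (y : K)}

/-- The symplectic form `[X, Y] = ⟨y, ξ⟩ - ⟨x, η⟩` for `X = (x, ξ)`, `Y = (y, η)`. -/
def symp {K : Type*} [Field K] {d : ℕ} (X Y : Phase K d) : K :=
  ∑ i, Y.1 i * X.2 i - ∑ i, X.1 i * Y.2 i

/-- The Haar measure `dx dξ` of `K^{2d}` attached to the Haar measure `ν` of `K`. -/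
def phaseMeasure {K : Type*} [MeasurableSpace K] (ν : Measure K) (d : ℕ) :
    Measure (Phase K d) :=
  (Measure.pi fun _ : Fin d => ν).prod (Measure.pi fun _ : Fin d => ν)

section

variable {K : Type*} [Field K] [ValuativeRel K] [TopologicalSpace K]
  [IsNonarchimedeanLocalField K] {d : ℕ}

/-- `μ₀(x, ξ) = max {1, |2x|, |2ξ|^∨}`, where `|x| = max_i |x_i|` and
`|ξ|^∨ = max_i |ξ_i ϖ ^ (-n(Ψ))|`. -/
def muZero (Ψ : AddChar K Circle) (ϖ : 𝒪[K]) (X : Phase K d) : ℝ :=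
  max 1 (max (⨆ i, absK (2 * X.1 i))
    (⨆ i, absK (2 * X.2 i * (ϖ : K) ^ (-conductorExp Ψ ϖ))))

variable [MeasurableSpace K]

/-- The symplectic Fourier transform `(𝒢 f)(X) = |2|^d ∫ f(Y) Ψ(2[Y, X]) dY`. -/
def sympFourier (Ψ : AddChar K Circle) (ν : Measure K) (f : Phase K d → ℂ) (X : Phase K d) : ℂ :=
  ((absK (2 : K) : ℝ) : ℂ) ^ d *
    ∫ Y, f Y * (Ψ (2 * symp Y X) : ℂ) ∂(phaseMeasure ν d)

/-- Bruhat's test functions on `K^{2d}`: locally constant and compactly supported. -/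
def IsTestFunction (φ : Phase K d → ℂ) : Prop :=
  IsLocallyConstant φ ∧ HasCompactSupport φ

/-- The operator `J_θ ^ n = 𝒢 ∘ (D_θ μ₀) ^ n ∘ 𝒢` on test functions, with
`(D_θ μ₀)(X) = μ₀(θ X)`. The operator `J ^ n` is the case `θ = 1`. -/
def testJ (Ψ : AddChar K Circle) (ϖ : 𝒪[K]) (ν : Measure K) (θ : K) (n : ℕ)
    (φ : Phase K d → ℂ) : Phase K d → ℂ :=
  sympFourier Ψ ν fun Y => ((muZero Ψ ϖ (θ • Y) : ℝ) : ℂ) ^ n * sympFourier Ψ ν φ Y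

section Values

variable {A : Type*} [NonUnitalCStarAlgebra A]

/-- `J_θ ^ n F = G` as `A`-valued distributions. The operator `J_θ ^ n` acts on distributions by
transposition, `⟨J_θ ^ n F, φ⟩ = ⟨F, J_θ ^ n φ⟩`; here `F` and `G` are bounded functions, so both
sides are tempered distributions and are determined by their values on the test functions of
Bruhat, which are dense in the Schwartz space. -/
def RepresentsJ (Ψ : AddChar K Circle) (ϖ : 𝒪[K]) (ν : Measure K) (θ : K) (n : ℕ)
    (F G : Phase K d → A) : Prop :=
  ∀ φ : Phase K d → ℂ, IsTestFunction φ →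
    ∫ X, φ X • G X ∂(phaseMeasure ν d) = ∫ X, testJ Ψ ϖ ν θ n φ X • F X ∂(phaseMeasure ν d)

/-- The bounded continuous function that represents the distribution `J_θ ^ n F` (and `0` if there
is none). -/
def boundedJ (Ψ : AddChar K Circle) (ϖ : 𝒪[K]) (ν : Measure K) (θ : K) (n : ℕ)
    (F : Phase K d → A) : Phase K d →ᵇ A :=
  open Classical in
  if h : ∃ G : Phase K d →ᵇ A, RepresentsJ Ψ ϖ ν θ n F G then h.choose else 0

end Values

end

/-- A continuous action of a topological group `V` on a `C*`-algebra `A`: a homomorphism from `V`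
to the `*`-automorphisms of `A` all of whose orbit maps are norm continuous. -/
structure ContinuousAction (V A : Type*) [AddCommGroup V] [TopologicalSpace V]
    [NonUnitalCStarAlgebra A] where
  /-- the automorphism attached to an element of the group -/
  aut : V → (A ≃⋆ₐ[ℂ] A)
  aut_add : ∀ X Y a, aut (X + Y) a = aut X (aut Y a)
  continuous_orbit : ∀ a, Continuous fun X => aut X a

/-- The orbit map `α̃(a) : X ↦ α_X(a)`. -/
def ContinuousAction.orbit {V A : Type*} [AddCommGroup V] [TopologicalSpace V]
    [NonUnitalCStarAlgebra A] (α : ContinuousAction V A) (a : A) : V → A :=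
  fun X => α.aut X a

section

variable {K : Type*} [Field K] [ValuativeRel K] [TopologicalSpace K]
  [IsNonarchimedeanLocalField K] [MeasurableSpace K] {d : ℕ}
  {A : Type*} [NonUnitalCStarAlgebra A]

/-- The set `A_reg` of regular elements: those `a` for which every distribution `J ^ n α̃(a)`
belongs to `L^∞(K^{2d}, A)`. -/
def regularSet (Ψ : AddChar K Circle) (ϖ : 𝒪[K]) (ν : Measure K)
    (α : ContinuousAction (Phase K d) A) : Set A :=
  {a : A | ∀ n : ℕ, ∃ G : Phase K d → A, MemLp G ∞ (phaseMeasure ν d) ∧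
    RepresentsJ Ψ ϖ ν 1 n (α.orbit a) G}

/-- The integrand of the deformed product,
`conj Ψ(2[X, Y]) μ₀(X)^{-(2d+1)} μ₀(Y)^{-(2d+1)} (J_θ^{2d+1} α̃(a))(θX) (J^{2d+1} α̃(b))(Y)`. -/
def starIntegrand (Ψ : AddChar K Circle) (ϖ : 𝒪[K]) (ν : Measure K) (θ : K)
    (α : ContinuousAction (Phase K d) A) (a b : A) (P : Phase K d × Phase K d) : A :=
  ((starRingEnd ℂ) (Ψ (2 * symp P.1 P.2) : ℂ)
      * (((muZero Ψ ϖ P.1 ^ (2 * d + 1))⁻¹ * (muZero Ψ ϖ P.2 ^ (2 * d + 1))⁻¹ : ℝ) : ℂ)) •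
    (boundedJ Ψ ϖ ν θ (2 * d + 1) (α.orbit a) (θ • P.1)
      * boundedJ Ψ ϖ ν 1 (2 * d + 1) (α.orbit b) P.2)

/-- The deformed product `a ⋆_θ^α b`, an oscillatory integral. -/
def starProd (Ψ : AddChar K Circle) (ϖ : 𝒪[K]) (ν : Measure K) (θ : K)
    (α : ContinuousAction (Phase K d) A) (a b : A) : A :=
  ((absK (2 : K) ^ (2 * d) : ℝ) : ℂ) •
    ∫ P, starIntegrand Ψ ϖ ν θ α a b P ∂((phaseMeasure ν d).prod (phaseMeasure ν d))

end

/-- The complex vector space `E`, with the topology of the seminorms `p n`, `n ∈ ℕ`, and the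
bilinear product `m`, is an associative Fréchet algebra: the topology is Hausdorff and complete,
and `m` is jointly continuous and associative. -/
structure IsFrechetAlgebra {E : Type*} [AddCommGroup E] [Module ℂ E] (U : UniformSpace E)
    (p : SeminormFamily ℂ E ℕ) (m : E →ₗ[ℂ] E →ₗ[ℂ] E) : Prop where
  isUniformAddGroup : IsUniformAddGroup E
  withSeminorms : WithSeminorms p
  t2Space : T2Space E
  completeSpace : CompleteSpace E
  continuous_mul : Continuous fun q : E × E => m q.1 q.2
  mul_assoc : ∀ a b c, m (m a b) c = m a (m b c)

end

end PadicMoyal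

open PadicMoyal

/-! Write `q = |ϖ|⁻¹`. The weight `μ₀` takes only the values `q ^ m`, and the sets `{μ₀ ≤ q ^ m}`
are compact open subgroups `B m` whose annihilators `D m` under `Ψ(2[X, Y])` shrink to `0`. The
transform `𝒢` is an involution and exchanges, up to a constant, the indicator of `B m` with the
normalized indicator of `D m`. Conjugation by `𝒢` therefore diagonalizes every function of the
weight. If `P m` averages the action over `D m` and `Δ m = P m - P (m - 1)` (with `Δ 0 = P 0`), then
`J ^ n` acts on the block `Δ m a` as the scalar `q ^ (m n)`, and `J_θ ^ n` as `q ^ (j m * n)`, where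
`θ` carries weight `q ^ m` to weight `q ^ (j m)` (`integral_mult_Δ`).

Testing a bounded representative against the kernel of `Δ m` bounds the blocks (`norm_Δ_le_of_rep`);
conversely, fast decay of the blocks lets the scaled blocks be summed (`rep_M`). Thus the regular
elements are those whose blocks decay faster than every power of `q ^ (-m)` (`mem_regular_iff`), and
`J ^ n α̃(a)` is again an orbit map, that of a single element `J n a` of `A`. The seminorms become
`‖J n a‖`, and completeness holds because the sequences `(J n a)_n` are cut out of `A ^ ℕ` by closed
conditions on the blocks (`isClosed_range_J`).

For elements fixed by `D m` the deformed product is a finite twisted sum `fstar` over `B m / D m`;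
associativity and compatibility with the involution are then orthogonality of characters on a finite
group (`fstar_assoc`, `star_fstar`), and the sum does not depend on the level (`fstar_eq_of_le`). In
general the product is summed over pairs of blocks. The trivial bound for `fstar` grows only like a
power of `q ^ m`, so the decay of the blocks wins: `J n (a ⋆ b)` is a bounded bilinear function of
`J N a` and `J N b` (`J_prod`). This gives joint continuity, and since `P i a → a` in every
seminorm, the algebraic identities pass to the limit.

The remaining point is that this product is the stated integral. For the blocks `Δ m a` and `Δ k b`
one inner integral vanishes unless `X` has weight `q ^ k`, and the other unless `Y` has weight `q ^
(j m)`. So amplitudes may be altered off these shells (`osc_congr_of_shell`), and on them the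
factors `μ₀ ^ (-2d-1)` are constants that cancel the powers of `J` and `J_θ` (`osc_eq_prod`). All
this uses only the axioms of `LatticeSystem` and `Dilation`, which `phaseSystem` and
`exists_dilation` verify for the local field. -/

namespace PadicMoyal

noncomputable section

set_option linter.unusedSectionVars false
set_option linter.unusedVariables false

/-! ### Harmonic analysis on a chain of lattices: levels and Fourier inversion. -/

section

/-- A self-dual locally compact group with an exhausting chain of compact open subgroups `B m`,
their annihilators `D m`, and a weight that grows geometrically along the chain. -/
structure LatticeSystem (V : Type*) [AddCommGroup V] [TopologicalSpace V] [MeasurableSpace V] where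
  /-- the Haar measure -/
  μ : Measure V
  haar : μ.IsAddHaarMeasure
  /-- the duality -/
  β : V → V → Circle
  β_add_left : ∀ X Y Z, β (X + Y) Z = β X Z * β Y Z
  β_swap : ∀ X Y, β Y X = (β X Y)⁻¹
  β_cont : Continuous fun p : V × V => β p.1 p.2
  /-- the normalization of the Fourier transform -/
  c : ℝ
  /-- the increasing chain of lattices -/
  B : ℕ → AddSubgroup V
  /-- the dual lattices -/
  D : ℕ → AddSubgroup V
  D_open : ∀ m, IsOpen (D m : Set V)
  B_compact : ∀ m, IsCompact (B m : Set V)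
  mem_D : ∀ m X, X ∈ D m ↔ ∀ Y ∈ B m, β X Y = 1
  mem_B : ∀ m X, X ∈ B m ↔ ∀ Y ∈ D m, β X Y = 1
  B_mono : Monotone B
  D_le_B_zero : D 0 ≤ B 0
  exhaust : ∀ X, ∃ m, X ∈ B m
  basis : ∀ U ∈ 𝓝 (0 : V), ∃ m, (D m : Set V) ⊆ U
  vol : ∀ m, c ^ 2 * μ.real (B m) * μ.real (D m) = 1
  /-- the ratio of the chain -/
  q : ℝ
  one_lt_q : 1 < q
  /-- the weight -/
  w : V → ℝ
  w_shell : ∀ m X, X ∈ B m → (∀ j < m, X ∉ B j) → w X = q ^ m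
  /-- the growth exponent of the volumes -/
  s : ℕ
  growth : ∀ m, μ.real (B m) = q ^ (s * m) * μ.real (B 0)

namespace LatticeSystem

variable {V : Type*} [AddCommGroup V] [TopologicalSpace V] [MeasurableSpace V]
  (L : LatticeSystem V)

instance : L.μ.IsAddHaarMeasure := L.haar

lemma β_add_right (X Y Z : V) : L.β X (Y + Z) = L.β X Y * L.β X Z := by
  rw [L.β_swap, L.β_add_left, L.β_swap X Y, L.β_swap X Z, mul_inv]
  simp

lemma β_zero_left (X : V) : L.β 0 X = 1 := by
  have := L.β_add_left 0 0 X
  simpa using this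

lemma β_neg_left (X Y : V) : L.β (-X) Y = (L.β X Y)⁻¹ := by
  have := L.β_add_left (-X) X Y
  rw [neg_add_cancel, L.β_zero_left] at this
  exact eq_inv_of_mul_eq_one_left this.symm

lemma β_neg_right (X Y : V) : L.β X (-Y) = (L.β X Y)⁻¹ := by
  rw [L.β_swap, L.β_neg_left, inv_inv, L.β_swap]

lemma β_sub_left (X Y Z : V) : L.β (X - Y) Z = L.β X Z * (L.β Y Z)⁻¹ := by
  rw [sub_eq_add_neg, L.β_add_left, L.β_neg_left]

lemma β_sub_right (X Y Z : V) : L.β X (Y - Z) = L.β X Y * (L.β X Z)⁻¹ := by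
  rw [sub_eq_add_neg, L.β_add_right, L.β_neg_right]

lemma conj_β (X Y : V) : (starRingEnd ℂ) (L.β X Y : ℂ) = L.β Y X := by
  rw [← Circle.coe_inv_eq_conj, ← L.β_swap]

lemma mem_B_iff (m : ℕ) (X : V) : X ∈ L.B m ↔ ∀ Y ∈ L.D m, L.β Y X = 1 := by
  rw [L.mem_B]
  refine forall₂_congr fun Y _ => ?_
  rw [L.β_swap, inv_eq_one]

lemma mem_D_iff (m : ℕ) (X : V) : X ∈ L.D m ↔ ∀ Y ∈ L.B m, L.β Y X = 1 := by
  rw [L.mem_D]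
  refine forall₂_congr fun Y _ => ?_
  rw [L.β_swap, inv_eq_one]

lemma β_D_B {m : ℕ} {X Y : V} (hX : X ∈ L.D m) (hY : Y ∈ L.B m) : L.β X Y = 1 :=
  (L.mem_D m X).1 hX Y hY

lemma β_B_D {m : ℕ} {X Y : V} (hX : X ∈ L.B m) (hY : Y ∈ L.D m) : L.β X Y = 1 :=
  (L.mem_B m X).1 hX Y hY

lemma D_anti : Antitone L.D := fun m n h X hX =>
  (L.mem_D m X).2 fun Y hY => L.β_D_B hX (L.B_mono h hY)

lemma D_le_B_zero' (m : ℕ) : L.D m ≤ L.B 0 := (L.D_anti (Nat.zero_le m)).trans L.D_le_B_zero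

lemma D_le_B (m n : ℕ) : L.D m ≤ L.B n := (L.D_le_B_zero' m).trans (L.B_mono (Nat.zero_le n))

/-- The points first reached by the `m`-th lattice. -/
def shell (m : ℕ) : Set V := {X | X ∈ L.B m ∧ ∀ j < m, X ∉ L.B j}

lemma exists_mem_shell (X : V) : ∃ m, X ∈ L.shell m := by
  classical
  exact ⟨Nat.find (L.exhaust X), Nat.find_spec (L.exhaust X),
    fun j hj => Nat.find_min (L.exhaust X) hj⟩

lemma shell_subset_B {m n : ℕ} (h : m ≤ n) {X : V} (hX : X ∈ L.shell m) : X ∈ L.B n :=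
  L.B_mono h hX.1

lemma shell_zero : L.shell 0 = L.B 0 := by ext; simp [shell]

lemma shell_succ (m : ℕ) : L.shell (m + 1) = (L.B (m + 1) : Set V) \ L.B m := by
  ext X
  refine ⟨fun h => ⟨h.1, h.2 m m.lt_succ_self⟩, fun h => ⟨h.1, fun j hj hX => h.2 ?_⟩⟩
  exact L.B_mono (Nat.lt_succ_iff.1 hj) hX

lemma shell_add {m : ℕ} {X W : V} (hX : X ∈ L.shell m) (hW : W ∈ L.B 0) : X + W ∈ L.shell m := by
  refine ⟨(L.B m).add_mem hX.1 (L.B_mono (Nat.zero_le m) hW), fun j hj h => hX.2 j hj ?_⟩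
  exact ((L.B j).add_mem_cancel_right (L.B_mono (Nat.zero_le j) hW)).1 h

lemma q_pos : 0 < L.q := one_pos.trans L.one_lt_q

lemma w_eq {m : ℕ} {X : V} (hX : X ∈ L.shell m) : L.w X = L.q ^ m := L.w_shell m X hX.1 hX.2

lemma w_add (X : V) {W : V} (hW : W ∈ L.B 0) : L.w (X + W) = L.w X := by
  obtain ⟨m, hm⟩ := L.exists_mem_shell X
  rw [L.w_eq hm, L.w_eq (L.shell_add hm hW)]

variable [IsTopologicalAddGroup V]

lemma B_open (m : ℕ) : IsOpen (L.B m : Set V) :=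
  AddSubgroup.isOpen_mono (L.D_le_B m m) (L.D_open m)

lemma D_isClosed (m : ℕ) : IsClosed (L.D m : Set V) :=
  AddSubgroup.isClosed_of_isOpen _ (L.D_open m)

lemma D_compact (m : ℕ) : IsCompact (L.D m : Set V) :=
  (L.B_compact m).of_isClosed_subset (L.D_isClosed m) (L.D_le_B m m)

/-- A function on `V` is of level `m` if it is supported in `B m` and invariant under `D m`. -/
def Level {E : Type*} [Zero E] (m : ℕ) (f : V → E) : Prop :=
  (∀ X, X ∉ L.B m → f X = 0) ∧ ∀ X, ∀ W ∈ L.D m, f (X + W) = f X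

lemma locConst_of_inv {E : Type*} {m : ℕ} {f : V → E} (hf : ∀ X, ∀ W ∈ L.D m, f (X + W) = f X) :
    IsLocallyConstant f := by
  rw [IsLocallyConstant.iff_exists_open]
  intro X
  refine ⟨(fun Y => Y - X) ⁻¹' (L.D m), (L.D_open m).preimage (by fun_prop), by simp, ?_⟩
  intro Y hY
  have := hf X (Y - X) hY
  rwa [add_sub_cancel] at this

lemma Level.isLocallyConstant {E : Type*} [Zero E] {m : ℕ} {f : V → E} (hf : L.Level m f) :
    IsLocallyConstant f := L.locConst_of_inv hf.2

lemma Level.hasCompactSupport {E : Type*} [Zero E] {m : ℕ} {f : V → E} (hf : L.Level m f) :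
    HasCompactSupport f := HasCompactSupport.intro (L.B_compact m) hf.1

lemma Level.continuous {E : Type*} [Zero E] [TopologicalSpace E] {m : ℕ} {f : V → E}
    (hf : L.Level m f) : Continuous f := (hf.isLocallyConstant L).continuous

lemma Level.integrable [BorelSpace V] {E : Type*} [NormedAddCommGroup E] {m : ℕ} {f : V → E}
    (hf : L.Level m f) : Integrable f L.μ :=
  (hf.continuous L).integrable_of_hasCompactSupport (hf.hasCompactSupport L)

/-- Two compactness arguments: the support lies in one `B m₀` because these are open and increasing,
and finitely many cosets on which `f` is constant cover `B m₀`. Off `B m₀` invariance is free, since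
every `D k` lies in `B m₀`. -/
lemma exists_level {E : Type*} [Zero E] {f : V → E} (hf : IsLocallyConstant f)
    (hc : HasCompactSupport f) : ∃ m, L.Level m f := by
  obtain ⟨m₀, hm₀⟩ : ∃ m, tsupport f ⊆ L.B m := by
    have := hc.isCompact.elim_directed_cover (fun m => (L.B m : Set V)) L.B_open
      (fun X _ => Set.mem_iUnion.2 (L.exhaust X))
      (fun i j => ⟨max i j, L.B_mono (le_max_left i j), L.B_mono (le_max_right i j)⟩)
    exact this
  have key : ∀ X : V, ∃ k, ∀ W ∈ L.D k, f (X + W) = f X := by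
    intro X
    obtain ⟨U, hU, hXU, hfU⟩ := (IsLocallyConstant.iff_exists_open f).1 hf X
    obtain ⟨k, hk⟩ := L.basis ((fun W => X + W) ⁻¹' U)
      ((hU.preimage (by fun_prop)).mem_nhds (by simpa using hXU))
    exact ⟨k, fun W hW => hfU _ (hk hW)⟩
  choose k hk using key
  obtain ⟨t, ht⟩ := (L.B_compact m₀).elim_nhds_subcover (fun X => (fun Y => Y - X) ⁻¹' (L.D (k X)))
    (fun X _ => ((L.D_open (k X)).preimage (by fun_prop)).mem_nhds (by simp))
  refine ⟨max m₀ (t.sup k), fun X hX => ?_, fun X W hW => ?_⟩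
  · by_contra h
    exact hX (L.B_mono (le_max_left _ _) (hm₀ (subset_tsupport f h)))
  · by_cases hX : X ∈ L.B m₀
    · obtain ⟨Z, hZ, hXZ⟩ := Set.mem_iUnion₂.1 (ht.2 hX)
      have hXZ : X - Z ∈ L.D (k Z) := hXZ
      have hW' : W ∈ L.D (k Z) :=
        L.D_anti ((Finset.le_sup hZ).trans (le_max_right _ _)) hW
      have h1 := hk Z _ hXZ
      have h2 := hk Z _ ((L.D (k Z)).add_mem hXZ hW')
      rw [add_sub_cancel] at h1
      rw [show Z + (X - Z + W) = X + W by abel] at h2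
      rw [h1, h2]
    · have hXW : X + W ∉ L.B m₀ := fun h =>
        hX (((L.B m₀).add_mem_cancel_right (L.D_le_B _ _ hW)).1 h)
      have e1 : f X = 0 := by
        by_contra h
        exact hX (hm₀ (subset_tsupport f h))
      have e2 : f (X + W) = 0 := by
        by_contra h
        exact hXW (hm₀ (subset_tsupport f h))
      rw [e1, e2]

lemma μD_pos (m : ℕ) : 0 < L.μ.real (L.D m) :=
  ENNReal.toReal_pos ((L.D_open m).measure_pos L.μ ⟨0, (L.D m).zero_mem⟩).ne'
    (L.D_compact m).measure_lt_top.ne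

/-- The indicator function of `B m`. -/
def oneB (m : ℕ) : V → ℂ := (L.B m : Set V).indicator 1

/-- The normalized indicator function of `D m`. -/
def e (m : ℕ) : V → ℂ := (L.D m : Set V).indicator fun _ => ((L.μ.real (L.D m) : ℝ) : ℂ)⁻¹

lemma oneB_of_mem {m : ℕ} {X : V} (h : X ∈ L.B m) : L.oneB m X = 1 := by
  rw [oneB, Set.indicator_of_mem (by exact h), Pi.one_apply]

lemma oneB_of_notMem {m : ℕ} {X : V} (h : X ∉ L.B m) : L.oneB m X = 0 :=
  Set.indicator_of_notMem (by exact h) _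

lemma e_of_mem {m : ℕ} {X : V} (h : X ∈ L.D m) : L.e m X = ((L.μ.real (L.D m) : ℝ) : ℂ)⁻¹ :=
  Set.indicator_of_mem (by exact h) _

lemma e_of_notMem {m : ℕ} {X : V} (h : X ∉ L.D m) : L.e m X = 0 :=
  Set.indicator_of_notMem (by exact h) _

lemma e_add {m k : ℕ} (hk : m ≤ k) (X : V) {W : V} (hW : W ∈ L.D k) : L.e m (X + W) = L.e m X := by
  have hW' := L.D_anti hk hW
  by_cases h : X ∈ L.D m
  · rw [L.e_of_mem h, L.e_of_mem ((L.D m).add_mem h hW')]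
  · rw [L.e_of_notMem h, L.e_of_notMem (fun h' => h (((L.D m).add_mem_cancel_right hW').1 h'))]

lemma level_e {m k : ℕ} (hk : m ≤ k) : L.Level k (L.e m) :=
  ⟨fun _ hX => L.e_of_notMem fun h => hX (L.D_le_B m k h), fun X _ hW => L.e_add hk X hW⟩

lemma oneB_add (m : ℕ) (X : V) {W : V} (hW : W ∈ L.B 0) : L.oneB m (X + W) = L.oneB m X := by
  have hW' := L.B_mono (Nat.zero_le m) hW
  by_cases h : X ∈ L.B m
  · rw [L.oneB_of_mem h, L.oneB_of_mem ((L.B m).add_mem h hW')]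
  · rw [L.oneB_of_notMem h,
      L.oneB_of_notMem (fun h' => h (((L.B m).add_mem_cancel_right hW').1 h'))]

lemma level_oneB {m k : ℕ} (hk : m ≤ k) : L.Level k (L.oneB m) :=
  ⟨fun _ hX => L.oneB_of_notMem fun h => hX (L.B_mono hk h),
    fun X _ hW => L.oneB_add m X (L.D_le_B_zero' k hW)⟩

variable [BorelSpace V]

/-- By translation invariance the integral equals `z` times itself. Every vanishing statement about
oscillating integrals below comes from this. -/
lemma integral_char {E : Type*} [NormedAddCommGroup E] [NormedSpace ℂ E] {f : V → E} {W : V} {z : ℂ}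
    (hz : z ≠ 1) (hf : ∀ X, f (X + W) = z • f X) : ∫ X, f X ∂L.μ = 0 := by
  have h : ∫ X, f X ∂L.μ = z • ∫ X, f X ∂L.μ := by
    rw [← integral_smul, ← integral_add_right_eq_self f W]
    simp_rw [hf]
  have : (1 - z) • ∫ X, f X ∂L.μ = 0 := by rw [sub_smul, one_smul, ← h, sub_self]
  exact (smul_eq_zero.1 this).resolve_left (sub_ne_zero.2 hz.symm)

lemma integral_e (m : ℕ) : ∫ X, L.e m X ∂L.μ = 1 := by
  rw [e, integral_indicator (L.D_open m).measurableSet, setIntegral_const, Complex.real_smul,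
    mul_inv_cancel₀]
  exact_mod_cast (L.μD_pos m).ne'

lemma integral_oneB (m : ℕ) : ∫ X, L.oneB m X ∂L.μ = (L.μ.real (L.B m) : ℝ) := by
  rw [oneB, integral_indicator (L.B_open m).measurableSet]
  simp [Measure.real]

lemma integral_e_mul_β (m : ℕ) (U : V) : ∫ Y, L.e m Y * (L.β Y U : ℂ) ∂L.μ = L.oneB m U := by
  by_cases h : U ∈ L.B m
  · rw [L.oneB_of_mem h, ← L.integral_e m]
    refine integral_congr_ae (.of_forall fun Y => ?_)
    by_cases hY : Y ∈ L.D m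
    · simp [L.β_D_B hY h]
    · simp [L.e_of_notMem hY]
  · rw [L.oneB_of_notMem h]
    rw [L.mem_B_iff] at h
    push Not at h
    obtain ⟨W, hW, h⟩ := h
    refine L.integral_char (W := W) (z := L.β W U) (mt Circle.coe_eq_one.1 h) fun X => ?_
    rw [L.e_add le_rfl X hW, L.β_add_left, Circle.coe_mul, smul_eq_mul]
    ring

lemma integral_oneB_mul_β (m : ℕ) (U : V) :
    ∫ Y, L.oneB m Y * (L.β Y U : ℂ) ∂L.μ =
      (L.μ.real (L.B m) : ℂ) * (L.μ.real (L.D m) : ℂ) * L.e m U := by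
  by_cases h : U ∈ L.D m
  · rw [L.e_of_mem h, mul_inv_cancel_right₀ (by exact_mod_cast (L.μD_pos m).ne'),
      ← L.integral_oneB m]
    refine integral_congr_ae (.of_forall fun Y => ?_)
    by_cases hY : Y ∈ L.B m
    · simp [L.β_B_D hY h]
    · simp [L.oneB_of_notMem hY]
  · rw [L.e_of_notMem h, mul_zero]
    rw [L.mem_D_iff] at h
    push Not at h
    obtain ⟨W, hW, h⟩ := h
    refine L.integral_char (W := W) (z := L.β W U) (mt Circle.coe_eq_one.1 h) fun X => ?_
    rw [L.β_add_left, Circle.coe_mul, smul_eq_mul]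
    by_cases hX : X ∈ L.B m
    · rw [L.oneB_of_mem hX, L.oneB_of_mem ((L.B m).add_mem hX hW)]; ring
    · rw [L.oneB_of_notMem hX,
        L.oneB_of_notMem (fun h' => hX (((L.B m).add_mem_cancel_right hW).1 h'))]; ring

/-- The Fourier transform. -/
def fourier (f : V → ℂ) (X : V) : ℂ := (L.c : ℂ) * ∫ Y, f Y * (L.β Y X : ℂ) ∂L.μ

/-- The two halves of the level condition are exchanged: invariance under `D m` kills the transform
off its annihilator `B m`, and support in `B m` makes the transform invariant under `D m`. -/
lemma level_fourier {m : ℕ} {f : V → ℂ} (hf : L.Level m f) : L.Level m (L.fourier f) := by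
  refine ⟨fun X hX => ?_, fun X W hW => ?_⟩
  · rw [L.mem_B_iff] at hX
    push Not at hX
    obtain ⟨W, hW, h⟩ := hX
    rw [fourier, L.integral_char (W := W) (z := L.β W X) (mt Circle.coe_eq_one.1 h), mul_zero]
    intro Y
    rw [hf.2 Y W hW, L.β_add_left, Circle.coe_mul, smul_eq_mul]
    ring
  · unfold fourier
    congr 2
    ext Y
    by_cases hY : Y ∈ L.B m
    · rw [L.β_add_right, L.β_B_D hY hW, mul_one]
    · rw [hf.1 Y hY, zero_mul, zero_mul]

lemma fourier_smul (z : ℂ) (f : V → ℂ) : L.fourier (z • f) = z • L.fourier f := by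
  ext X
  simp only [fourier, Pi.smul_apply, smul_eq_mul, mul_assoc, integral_const_mul]
  ring

lemma continuous_β_left (X : V) : Continuous fun Y => (L.β Y X : ℂ) :=
  continuous_subtype_val.comp (L.β_cont.comp (by fun_prop : Continuous fun Y => (Y, X)))

lemma continuous_β : Continuous fun p : V × V => (L.β p.1 p.2 : ℂ) :=
  continuous_subtype_val.comp L.β_cont

lemma Level.integrable_mul_β {m : ℕ} {f : V → ℂ} (hf : L.Level m f) (X : V) :
    Integrable (fun Y => f Y * (L.β Y X : ℂ)) L.μ :=
  ((hf.continuous L).mul (L.continuous_β_left X)).integrable_of_hasCompactSupport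
    ((hf.hasCompactSupport L).mul_right)

lemma fourier_sub {m k : ℕ} {f g : V → ℂ} (hf : L.Level m f) (hg : L.Level k g) :
    L.fourier (f - g) = L.fourier f - L.fourier g := by
  ext X
  simp only [fourier, Pi.sub_apply, sub_mul]
  rw [integral_sub (hf.integrable_mul_β L X) (hg.integrable_mul_β L X), mul_sub]

lemma hasCompactSupport_mul_prod {E : Type*} [NormedAddCommGroup E] [NormedSpace ℂ E] {m k : ℕ}
    {f g : V → ℂ} (hf : L.Level m f) (hg : L.Level k g) (h : V × V → E) :
    HasCompactSupport fun p : V × V => (f p.1 * g p.2) • h p := by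
  refine HasCompactSupport.intro ((L.B_compact m).prod (L.B_compact k)) fun p hp => ?_
  rw [Set.mem_prod, not_and_or] at hp
  rcases hp with hp | hp
  · rw [hf.1 _ hp, zero_mul, zero_smul]
  · rw [hg.1 _ hp, mul_zero, zero_smul]

/-- Fubini for continuous functions cut off by functions of some level. -/
lemma integral_swap {E : Type*} [NormedAddCommGroup E] [NormedSpace ℂ E] {m k : ℕ}
    {f g : V → ℂ} (hf : L.Level m f) (hg : L.Level k g) {h : V × V → E} (hh : Continuous h) :
    ∫ X, ∫ Y, (f X * g Y) • h (X, Y) ∂L.μ ∂L.μ = ∫ Y, ∫ X, (f X * g Y) • h (X, Y) ∂L.μ ∂L.μ := by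
  refine integral_integral_swap_of_hasCompactSupport (f := fun X Y => (f X * g Y) • h (X, Y)) ?_
    (L.hasCompactSupport_mul_prod hf hg h)
  have := hf.continuous L
  have := hg.continuous L
  change Continuous fun p : V × V => (f p.1 * g p.2) • h (p.1, p.2)
  fun_prop

lemma e_neg (m : ℕ) (X : V) : L.e m (-X) = L.e m X := by
  by_cases h : X ∈ L.D m
  · rw [L.e_of_mem h, L.e_of_mem ((L.D m).neg_mem h)]
  · rw [L.e_of_notMem h, L.e_of_notMem (fun h' => h (by simpa using (L.D m).neg_mem h'))]

/-- No reflection appears, because `β` is antisymmetric: the two phases combine to `β U (X - Y)`.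
Since the transform is supported in `B m`, the cut-off `oneB m` can be inserted in `U`; integrating
over `U` then produces a multiple of `e m (Y - X)`, and averaging `f` over `X + D m` returns `f X`.
The constant is `vol`. -/
lemma fourier_fourier {m : ℕ} {f : V → ℂ} (hf : L.Level m f) :
    L.fourier (L.fourier f) = f := by
  ext X
  have hF := L.level_fourier hf
  have e1 : ∫ U, L.fourier f U * (L.β U X : ℂ) ∂L.μ =
      (L.c : ℂ) * ∫ U, ∫ Y, (L.oneB m U * f Y) • ((L.β U (X - Y) : ℂ)) ∂L.μ ∂L.μ := by
    rw [← integral_const_mul]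
    refine integral_congr_ae (.of_forall fun U => ?_)
    change L.fourier f U * _ = _
    by_cases hU : U ∈ L.B m
    · simp only [L.oneB_of_mem hU, one_mul]
      rw [fourier, mul_assoc, ← integral_mul_const]
      congr 2
      ext Y
      rw [L.β_sub_right, L.β_swap U Y, Circle.coe_mul, smul_eq_mul]
      ring
    · simp only [L.oneB_of_notMem hU, hF.1 U hU, zero_mul, zero_smul, integral_zero, mul_zero]
  have hc : Continuous fun p : V × V => (L.β p.1 (X - p.2) : ℂ) :=
    L.continuous_β.comp (by fun_prop : Continuous fun p : V × V => (p.1, X - p.2))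
  rw [fourier, e1, L.integral_swap (L.level_oneB le_rfl) hf hc]
  have e2 : ∀ Y, ∫ U, (L.oneB m U * f Y) • (L.β U (X - Y) : ℂ) ∂L.μ =
      ((L.μ.real (L.B m) : ℂ) * (L.μ.real (L.D m) : ℂ) * f X) * L.e m (Y - X) := by
    intro Y
    have : ∀ U, (L.oneB m U * f Y) • (L.β U (X - Y) : ℂ) =
        f Y * (L.oneB m U * (L.β U (X - Y) : ℂ)) := fun U => by rw [smul_eq_mul]; ring
    simp_rw [this, integral_const_mul, L.integral_oneB_mul_β]
    rw [← L.e_neg, neg_sub]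
    by_cases hY : Y - X ∈ L.D m
    · have := hf.2 X (Y - X) hY
      rw [add_sub_cancel] at this
      rw [this]; ring
    · rw [L.e_of_notMem hY]; ring
  simp_rw [e2, integral_const_mul]
  rw [integral_sub_right_eq_self (fun Y => L.e m Y) X, L.integral_e]
  have := L.vol m
  have h : (L.c : ℂ) ^ 2 * (L.μ.real (L.B m) : ℂ) * (L.μ.real (L.D m) : ℂ) = 1 := by
    exact_mod_cast congrArg (fun x : ℝ => (x : ℂ)) this
  linear_combination f X * h

lemma fourier_e (m : ℕ) : L.fourier (L.e m) = (L.c : ℂ) • L.oneB m := by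
  ext X
  rw [fourier, L.integral_e_mul_β]; rfl

end LatticeSystem

end

/-! ### Averages of the action over the lattices, and dyadic blocks. -/

section

namespace ContinuousAction

variable {V A : Type*} [AddCommGroup V] [TopologicalSpace V] [NonUnitalCStarAlgebra A]
  (α : ContinuousAction V A)

lemma norm_aut (X : V) (a : A) : ‖α.aut X a‖ = ‖a‖ := StarAlgEquiv.norm_map _ a

lemma aut_zero (a : A) : α.aut 0 a = a := by
  apply (α.aut 0).injective
  change α.aut 0 (α.aut 0 a) = α.aut 0 a
  rw [← α.aut_add, add_zero]

lemma aut_comm (X Y : V) (a : A) : α.aut X (α.aut Y a) = α.aut Y (α.aut X a) := by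
  rw [← α.aut_add, ← α.aut_add, add_comm]

lemma aut_neg_aut (X : V) (a : A) : α.aut (-X) (α.aut X a) = a := by
  rw [← α.aut_add, neg_add_cancel, α.aut_zero]

/-- The automorphism `α_X` as a bounded operator. -/
def autL (X : V) : A →L[ℂ] A :=
  LinearMap.mkContinuous
    { toFun := α.aut X, map_add' := map_add _, map_smul' := map_smul _ } 1
    (fun a => by rw [one_mul]; exact (α.norm_aut X a).le)

@[simp] lemma autL_apply (X : V) (a : A) : α.autL X a = α.aut X a := rfl

end ContinuousAction

namespace LatticeSystem

variable {V : Type*} [AddCommGroup V] [TopologicalSpace V] [MeasurableSpace V]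
  (L : LatticeSystem V) [IsTopologicalAddGroup V] [BorelSpace V] [SecondCountableTopology V]
  {A : Type*} [NonUnitalCStarAlgebra A] (α : ContinuousAction V A)

lemma integrable_smear {θ : V → V} (hθ : Continuous θ) {k : V → ℂ} (hk : Integrable k L.μ) (a : A) :
    Integrable (fun X => k X • α.aut (θ X) a) L.μ := by
  refine (hk.norm.mul_const ‖a‖).mono'
    (hk.1.smul ((α.continuous_orbit a).comp hθ).aestronglyMeasurable) (.of_forall fun X => ?_)
  rw [norm_smul]
  exact (congrArg _ (α.norm_aut _ a)).le

/-- The bounded operator `∫ k(X) α_{θ X} dX`. -/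
def smear {θ : V → V} (hθ : Continuous θ) {k : V → ℂ} (hk : Integrable k L.μ) : A →L[ℂ] A :=
  LinearMap.mkContinuous
    { toFun := fun a => ∫ X, k X • α.aut (θ X) a ∂L.μ
      map_add' := fun a b => by
        simp only [map_add, smul_add]
        exact integral_add (L.integrable_smear α hθ hk a) (L.integrable_smear α hθ hk b)
      map_smul' := fun z a => by
        simp only [map_smul, RingHom.id_apply]
        rw [← integral_smul]
        simp only [smul_comm z] } (∫ X, ‖k X‖ ∂L.μ)
    (fun a => by
      rw [← integral_mul_const]
      refine norm_integral_le_of_norm_le (hk.norm.mul_const _) (.of_forall fun X => ?_)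
      rw [norm_smul, α.norm_aut])

lemma smear_apply {θ : V → V} (hθ : Continuous θ) {k : V → ℂ} (hk : Integrable k L.μ) (a : A) :
    L.smear α hθ hk a = ∫ X, k X • α.aut (θ X) a ∂L.μ := rfl

lemma norm_smear_le {θ : V → V} (hθ : Continuous θ) {k : V → ℂ} (hk : Integrable k L.μ) (a : A) :
    ‖L.smear α hθ hk a‖ ≤ (∫ X, ‖k X‖ ∂L.μ) * ‖a‖ := by
  rw [smear_apply, ← integral_mul_const]
  refine norm_integral_le_of_norm_le (hk.norm.mul_const _) (.of_forall fun X => ?_)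
  rw [norm_smul, α.norm_aut]

lemma integrable_e (m : ℕ) : Integrable (L.e m) L.μ := (L.level_e (le_refl m)).integrable L

lemma integral_norm_e (m : ℕ) : ∫ X, ‖L.e m X‖ ∂L.μ = 1 := by
  have h : ∀ X, ((‖L.e m X‖ : ℝ) : ℂ) = L.e m X := fun X => by
    by_cases hX : X ∈ L.D m
    · rw [L.e_of_mem hX, norm_inv, Complex.norm_real, Real.norm_of_nonneg (L.μD_pos m).le]
      push_cast; rfl
    · simp [L.e_of_notMem hX]
  have := (integral_congr_ae (.of_forall h)).trans (L.integral_e m)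
  rw [integral_complex_ofReal] at this
  exact_mod_cast this

/-- The averaging operator over `D m`. -/
def P (m : ℕ) : A →L[ℂ] A := L.smear α continuous_id (L.integrable_e m)

lemma P_apply (m : ℕ) (a : A) : L.P α m a = ∫ X, L.e m X • α.aut X a ∂L.μ := rfl

lemma norm_P_le (m : ℕ) (a : A) : ‖L.P α m a‖ ≤ ‖a‖ := by
  have := L.norm_smear_le α continuous_id (L.integrable_e m) a
  rwa [L.integral_norm_e, one_mul] at this

lemma integrable_e_smul (m : ℕ) (a : A) : Integrable (fun X => L.e m X • α.aut X a) L.μ :=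
  L.integrable_smear α continuous_id (L.integrable_e m) a

/-- The average has total mass one and `T` does not see translations by `D m`. The projection
identities for `P`, and later the vanishing of twisted integrals on blocks, follow from this. -/
lemma map_P {m : ℕ} (T : A →L[ℂ] A) (a : A) (hT : ∀ W ∈ L.D m, T (α.aut W a) = T a) :
    T (L.P α m a) = T a := by
  rw [P_apply, ← T.integral_comp_comm (L.integrable_e_smul α m a)]
  have : ∀ X, T (L.e m X • α.aut X a) = L.e m X • T a := fun X => by
    by_cases hX : X ∈ L.D m
    · rw [map_smul, hT X hX]
    · rw [L.e_of_notMem hX, zero_smul, zero_smul, map_zero]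
  simp_rw [this]
  rw [integral_smul_const, L.integral_e, one_smul]

lemma P_of_fixed {m : ℕ} {a : A} (h : ∀ W ∈ L.D m, α.aut W a = a) : L.P α m a = a :=
  L.map_P α (ContinuousLinearMap.id ℂ A) a h

lemma aut_P (m : ℕ) (W : V) (a : A) : α.aut W (L.P α m a) = L.P α m (α.aut W a) := by
  rw [P_apply, P_apply, ← α.autL_apply, ← (α.autL W).integral_comp_comm
    (L.integrable_e_smul α m a)]
  simp only [map_smul, α.autL_apply, α.aut_comm W]

lemma aut_P_of_mem {m : ℕ} {W : V} (hW : W ∈ L.D m) (a : A) :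
    α.aut W (L.P α m a) = L.P α m a := by
  rw [L.aut_P, P_apply, P_apply, ← integral_add_right_eq_self (fun X => L.e m X • α.aut X a) W]
  simp only [L.e_add le_rfl _ hW, α.aut_add]

lemma P_P_of_le {m k : ℕ} (h : m ≤ k) (a : A) : L.P α m (L.P α k a) = L.P α m a := by
  refine L.map_P α (L.P α m) a fun W hW => ?_
  rw [← L.aut_P, L.aut_P_of_mem α (L.D_anti h hW)]

lemma P_P_of_ge {m k : ℕ} (h : m ≤ k) (a : A) : L.P α k (L.P α m a) = L.P α m a :=
  L.P_of_fixed α fun _ hW => L.aut_P_of_mem α (L.D_anti h hW) a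

lemma star_P (m : ℕ) (a : A) : star (L.P α m a) = L.P α m (star a) := by
  rw [P_apply, P_apply]
  have h := ((starL' ℝ : A ≃L[ℝ] A) : A →L[ℝ] A).integral_comp_comm
    (L.integrable_e_smul α m a)
  refine Eq.trans (Eq.symm h) (integral_congr_ae (.of_forall fun X => ?_))
  change star (L.e m X • α.aut X a) = L.e m X • α.aut X (star a)
  rw [star_smul, map_star]
  congr 1
  by_cases hX : X ∈ L.D m
  · simp [L.e_of_mem hX]
  · simp [L.e_of_notMem hX]

/-- The `e m` form an approximate identity: they have mass one and, by `basis`, their supports `D m`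
shrink to `0`. -/
lemma tendsto_integral_e {E : Type*} [NormedAddCommGroup E] [NormedSpace ℂ E] [CompleteSpace E]
    {F : V → E} (hF : Continuous F) :
    Tendsto (fun m => ∫ X, L.e m X • F X ∂L.μ) atTop (𝓝 (F 0)) := by
  rw [Metric.tendsto_atTop]
  intro ε hε
  obtain ⟨m₀, hm₀⟩ := L.basis {X | ‖F X - F 0‖ < ε / 2} (by
    have : IsOpen {X | ‖F X - F 0‖ < ε / 2} := isOpen_lt (by fun_prop) continuous_const
    exact this.mem_nhds (by simpa using hε))
  refine ⟨m₀, fun m hm => ?_⟩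
  have hi : Integrable (fun X => L.e m X • F X) L.μ :=
    (((L.level_e le_rfl).continuous L).smul hF).integrable_of_hasCompactSupport
      ((L.level_e le_rfl).hasCompactSupport L).smul_right
  have hi0 : Integrable (fun X => L.e m X • F 0) L.μ := (L.integrable_e m).smul_const _
  have h0 : F 0 = ∫ X, L.e m X • F 0 ∂L.μ := by
    rw [integral_smul_const, L.integral_e, one_smul]
  rw [dist_eq_norm, h0, ← integral_sub hi hi0]
  have : ‖∫ X, (L.e m X • F X - L.e m X • F 0) ∂L.μ‖ ≤ ∫ X, ‖L.e m X‖ * (ε / 2) ∂L.μ := by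
    refine norm_integral_le_of_norm_le ((L.integrable_e m).norm.mul_const _)
      (.of_forall fun X => ?_)
    rw [← smul_sub, norm_smul]
    by_cases hX : X ∈ L.D m
    · exact mul_le_mul_of_nonneg_left (hm₀ (L.D_anti hm hX)).le (norm_nonneg _)
    · simp [L.e_of_notMem hX]
  rw [integral_mul_const, L.integral_norm_e] at this
  linarith

lemma tendsto_P (a : A) : Tendsto (fun m => L.P α m a) atTop (𝓝 a) := by
  have := L.tendsto_integral_e (α.continuous_orbit a)
  rwa [α.aut_zero] at this

/-- The dyadic block of index `m`. -/
def Δ : ℕ → A →L[ℂ] A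
  | 0 => L.P α 0
  | m + 1 => L.P α (m + 1) - L.P α m

lemma Δ_zero : L.Δ α 0 = L.P α 0 := rfl

lemma Δ_succ (m : ℕ) (a : A) : L.Δ α (m + 1) a = L.P α (m + 1) a - L.P α m a := rfl

lemma sum_Δ (m : ℕ) (a : A) : ∑ j ∈ Finset.range (m + 1), L.Δ α j a = L.P α m a := by
  induction m with
  | zero => simp [Δ_zero]
  | succ m ih => rw [Finset.sum_range_succ, ih, Δ_succ, add_sub_cancel]

lemma norm_Δ_le (m : ℕ) (a : A) : ‖L.Δ α m a‖ ≤ 2 * ‖a‖ := by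
  cases m with
  | zero => rw [Δ_zero]; linarith [L.norm_P_le α 0 a, norm_nonneg a]
  | succ m =>
    rw [Δ_succ]
    linarith [L.norm_P_le α (m + 1) a, L.norm_P_le α m a,
      norm_sub_le (L.P α (m + 1) a) (L.P α m a)]

lemma P_Δ_of_le {m k : ℕ} (h : k ≤ m) (a : A) : L.P α m (L.Δ α k a) = L.Δ α k a := by
  cases k with
  | zero => rw [Δ_zero, L.P_P_of_ge α h]
  | succ k => rw [Δ_succ, map_sub, L.P_P_of_ge α h, L.P_P_of_ge α (k.le_succ.trans h)]

lemma P_Δ_of_lt {m k : ℕ} (h : m < k) (a : A) : L.P α m (L.Δ α k a) = 0 := by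
  cases k with
  | zero => omega
  | succ k => rw [Δ_succ, map_sub, L.P_P_of_le α h.le, L.P_P_of_le α (by omega), sub_self]

lemma Δ_P_of_lt {m k : ℕ} (h : m < k) (a : A) : L.Δ α k (L.P α m a) = 0 := by
  cases k with
  | zero => omega
  | succ k => rw [Δ_succ, L.P_P_of_ge α h.le, L.P_P_of_ge α (by omega), sub_self]

lemma Δ_Δ_self (m : ℕ) (a : A) : L.Δ α m (L.Δ α m a) = L.Δ α m a := by
  cases m with
  | zero => rw [Δ_zero, L.P_P_of_ge α le_rfl]
  | succ m =>
    rw [L.Δ_succ α m (L.Δ α (m + 1) a), L.P_Δ_of_le α le_rfl, L.P_Δ_of_lt α (by omega), sub_zero]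

lemma Δ_Δ_of_ne {j m : ℕ} (h : j ≠ m) (a : A) : L.Δ α j (L.Δ α m a) = 0 := by
  cases j with
  | zero => rw [Δ_zero, L.P_Δ_of_lt α (by omega)]
  | succ j =>
    rw [Δ_succ]
    rcases lt_or_gt_of_ne h with h | h
    · rw [L.P_Δ_of_lt α h, L.P_Δ_of_lt α (by omega), sub_self]
    · rw [L.P_Δ_of_le α (by omega), L.P_Δ_of_le α (by omega), sub_self]

lemma P_P_comm (m k : ℕ) (a : A) : L.P α m (L.P α k a) = L.P α k (L.P α m a) := by
  rcases le_total m k with h | h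
  · rw [L.P_P_of_le α h, L.P_P_of_ge α h]
  · rw [L.P_P_of_ge α h, L.P_P_of_le α h]

lemma Δ_P_comm (m k : ℕ) (a : A) : L.Δ α m (L.P α k a) = L.P α k (L.Δ α m a) := by
  cases m with
  | zero => rw [Δ_zero, L.P_P_comm]
  | succ m => rw [Δ_succ, Δ_succ, map_sub, L.P_P_comm α _ k, L.P_P_comm α _ k]

lemma aut_Δ (m : ℕ) (W : V) (a : A) : α.aut W (L.Δ α m a) = L.Δ α m (α.aut W a) := by
  cases m with
  | zero => exact L.aut_P α 0 W a
  | succ m => rw [Δ_succ, Δ_succ, map_sub, L.aut_P, L.aut_P]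

lemma aut_Δ_of_mem {m : ℕ} {W : V} (hW : W ∈ L.D m) (a : A) :
    α.aut W (L.Δ α m a) = L.Δ α m a := by
  rw [← L.P_Δ_of_le α (le_refl m), L.aut_P_of_mem α hW]

lemma star_Δ (m : ℕ) (a : A) : star (L.Δ α m a) = L.Δ α m (star a) := by
  cases m with
  | zero => exact L.star_P α 0 a
  | succ m => rw [Δ_succ, Δ_succ, star_sub, L.star_P, L.star_P]

lemma hasSum_Δ {a : A} (h : Summable fun m => L.Δ α m a) : HasSum (fun m => L.Δ α m a) a := by
  have h1 := (h.hasSum.tendsto_sum_nat).comp (tendsto_add_atTop_nat 1)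
  simp only [Function.comp_def, L.sum_Δ] at h1
  rw [tendsto_nhds_unique (L.tendsto_P α a) h1]
  simpa only [← tendsto_nhds_unique (L.tendsto_P α a) h1] using h.hasSum

/-- The partial sums of the blocks are the averages `P m`, which converge to the identity.
Identities between weight operators can therefore be checked block by block. -/
lemma eq_of_Δ_eq {a b : A} (h : ∀ m, L.Δ α m a = L.Δ α m b) : a = b := by
  refine tendsto_nhds_unique (L.tendsto_P α a) ?_
  have : ∀ m, L.P α m a = L.P α m b := fun m => by simp only [← L.sum_Δ, h]
  simpa only [this] using L.tendsto_P α b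

end LatticeSystem

end

/-! ### Radial multipliers, blocks and the regular elements. -/

section

namespace LatticeSystem

variable {V : Type*} [AddCommGroup V] [TopologicalSpace V] [MeasurableSpace V]
  (L : LatticeSystem V) [IsTopologicalAddGroup V] [BorelSpace V] [SecondCountableTopology V]
  {A : Type*} [NonUnitalCStarAlgebra A] (α : ContinuousAction V A)

/-- The indicator function of the `m`-th shell. -/
def oneS : ℕ → V → ℂ
  | 0 => L.oneB 0
  | m + 1 => L.oneB (m + 1) - L.oneB m

lemma oneS_of_mem {m : ℕ} {X : V} (h : X ∈ L.shell m) : L.oneS m X = 1 := by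
  cases m with
  | zero => exact L.oneB_of_mem h.1
  | succ m =>
    rw [oneS, Pi.sub_apply, L.oneB_of_mem h.1, L.oneB_of_notMem (h.2 m m.lt_succ_self), sub_zero]

lemma oneS_of_notMem {m : ℕ} {X : V} (h : X ∉ L.shell m) : L.oneS m X = 0 := by
  cases m with
  | zero =>
    rw [L.shell_zero] at h
    exact L.oneB_of_notMem h
  | succ m =>
    rw [L.shell_succ, Set.mem_sdiff, not_and_or, not_not] at h
    rw [oneS, Pi.sub_apply]
    by_cases h' : X ∈ L.B m
    · rw [L.oneB_of_mem h', L.oneB_of_mem (L.B_mono m.le_succ h'), sub_self]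
    · have : X ∉ L.B (m + 1) := h.resolve_right h'
      rw [L.oneB_of_notMem h', L.oneB_of_notMem this, sub_self]

/-- A function on `V` that takes the value `r m` on the `m`-th shell. -/
def Radial (u : V → ℂ) (r : ℕ → ℂ) : Prop := ∀ m, ∀ X ∈ L.shell m, u X = r m

variable {L} in
lemma Radial.add_eq {u : V → ℂ} {r : ℕ → ℂ} (hu : L.Radial u r) (X : V) {W : V} (hW : W ∈ L.B 0) :
    u (X + W) = u X := by
  obtain ⟨m, hm⟩ := L.exists_mem_shell X
  rw [hu m X hm, hu m _ (L.shell_add hm hW)]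

lemma Level.invariant_mul {M : ℕ} {u f : V → ℂ} (hf : L.Level M f)
    (hu : ∀ X, ∀ W ∈ L.B 0, u (X + W) = u X) : L.Level M fun X => u X * f X :=
  ⟨fun X hX => by simp only [hf.1 X hX, mul_zero],
    fun X W hW => by simp only [hf.2 X W hW, hu X W (L.D_le_B_zero' M hW)]⟩

/-- The Fourier multiplier with symbol `u`. -/
def mult (u φ : V → ℂ) : V → ℂ := L.fourier fun Y => u Y * L.fourier φ Y

/-- The multiplier with symbol `u`, acting on distributions by transposition, maps `F` to `G`. -/
def Rep (u : V → ℂ) (F G : V → A) : Prop :=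
  ∀ φ : V → ℂ, IsLocallyConstant φ ∧ HasCompactSupport φ →
    ∫ X, φ X • G X ∂L.μ = ∫ X, L.mult u φ X • F X ∂L.μ

/-- Convolution with `e m` is multiplication by `oneB m` on the Fourier side. -/
lemma integral_e_mul_fourier {M : ℕ} {f : V → ℂ} (hf : L.Level M f) (m : ℕ) (X : V) :
    ∫ Y, L.e m Y * L.fourier f (X - Y) ∂L.μ = L.fourier (fun U => L.oneB m U * f U) X := by
  have hc : Continuous fun p : V × V => (L.β p.2 (X - p.1) : ℂ) :=
    L.continuous_β.comp (by fun_prop : Continuous fun p : V × V => (p.2, X - p.1))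
  have e1 : ∀ Y, L.e m Y * L.fourier f (X - Y) =
      (L.c : ℂ) * ∫ U, (L.e m Y * f U) • (L.β U (X - Y) : ℂ) ∂L.μ := fun Y => by
    rw [fourier, mul_left_comm, ← integral_const_mul]
    simp only [smul_eq_mul, mul_assoc]
  simp_rw [e1]
  rw [integral_const_mul, L.integral_swap (L.level_e le_rfl) hf hc, fourier]
  congr 2
  ext U
  have e2 : ∀ Y, (L.e m Y * f U) • (L.β U (X - Y) : ℂ) =
      (f U * (L.β U X : ℂ)) * (L.e m Y * (L.β Y U : ℂ)) := fun Y => by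
    rw [L.β_sub_right, ← L.β_swap, Circle.coe_mul, smul_eq_mul]; ring
  simp_rw [e2]
  rw [integral_const_mul, L.integral_e_mul_β]; ring

/-- Averaging the orbit over `D m` restricts frequencies to `B m`: the average is moved onto the
test function by Fubini, where it is a convolution with `e m`. -/
lemma integral_fourier_P {M : ℕ} {f : V → ℂ} (hf : L.Level M f) (m : ℕ) (a : A) :
    ∫ X, L.fourier f X • α.aut X (L.P α m a) ∂L.μ =
      ∫ X, L.fourier (fun U => L.oneB m U * f U) X • α.aut X a ∂L.μ := by
  have hF := L.level_fourier hf
  have hFc := hF.continuous L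
  have hα := α.continuous_orbit a
  have e1 : ∀ X, L.fourier f X • α.aut X (L.P α m a) =
      ∫ Y, (L.fourier f X * L.e m Y) • α.aut (X + Y) a ∂L.μ := fun X => by
    rw [L.aut_P, P_apply, ← integral_smul]
    refine integral_congr_ae (.of_forall fun Y => ?_)
    simp only [smul_smul, add_comm X Y, α.aut_add]
  simp_rw [e1]
  rw [L.integral_swap hF (L.level_e le_rfl) (h := fun p => α.aut (p.1 + p.2) a)
    (hα.comp (by fun_prop))]
  -- The factor `oneB M X` changes nothing, since `Y ∈ D m ⊆ B M` and `L.fourier f` lives on `B M`;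
  -- it supplies the compact support in `X` needed to exchange the integrals back.
  have e2 : ∀ Y, ∫ X, (L.fourier f X * L.e m Y) • α.aut (X + Y) a ∂L.μ =
      ∫ X, (L.oneB M X * L.e m Y) • (L.fourier f (X - Y) • α.aut X a) ∂L.μ := fun Y => by
    rw [← integral_sub_right_eq_self _ Y]
    refine integral_congr_ae (.of_forall fun X => ?_)
    simp only [sub_add_cancel, smul_smul]
    congr 1
    by_cases hY : Y ∈ L.D m
    · by_cases hX : X ∈ L.B M
      · rw [L.oneB_of_mem hX]; ring
      · have : X - Y ∉ L.B M := fun h =>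
          hX (by simpa using (L.B M).add_mem h (L.D_le_B m M hY))
        rw [hF.1 _ this]; ring
    · rw [L.e_of_notMem hY]; ring
  simp_rw [e2]
  rw [← L.integral_swap (L.level_oneB le_rfl) (L.level_e le_rfl)
    (h := fun p => L.fourier f (p.1 - p.2) • α.aut p.1 a)
    ((hFc.comp (by fun_prop)).smul (hα.comp continuous_fst))]
  refine integral_congr_ae (.of_forall fun X => ?_)
  have e3 : ∀ Y, (L.oneB M X * L.e m Y) • (L.fourier f (X - Y) • α.aut X a) =
      (L.oneB M X * (L.e m Y * L.fourier f (X - Y))) • α.aut X a := fun Y => by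
    rw [smul_smul, mul_assoc]
  simp only [e3]
  rw [integral_smul_const, integral_const_mul, L.integral_e_mul_fourier hf]
  congr 1
  by_cases hX : X ∈ L.B M
  · rw [L.oneB_of_mem hX, one_mul]
  · have := L.level_fourier (Level.invariant_mul L hf (fun X W hW => L.oneB_add m X hW))
    rw [this.1 X hX, mul_zero]

lemma integrable_level_smul {M : ℕ} {f : V → ℂ} (hf : L.Level M f) (a : A) :
    Integrable (fun X => f X • α.aut X a) L.μ :=
  L.integrable_smear α continuous_id (hf.integrable L) a

lemma integral_fourier_Δ {M : ℕ} {f : V → ℂ} (hf : L.Level M f) (m : ℕ) (a : A) :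
    ∫ X, L.fourier f X • α.aut X (L.Δ α m a) ∂L.μ =
      ∫ X, L.fourier (fun U => L.oneS m U * f U) X • α.aut X a ∂L.μ := by
  cases m with
  | zero => exact L.integral_fourier_P α hf 0 a
  | succ m =>
    have hB : ∀ k, L.Level M fun U => L.oneB k U * f U := fun k =>
      Level.invariant_mul L hf (fun X W hW => L.oneB_add k X hW)
    have e1 : (fun U => L.oneS (m + 1) U * f U) =
        (fun U => L.oneB (m + 1) U * f U) - fun U => L.oneB m U * f U := by
      ext U; simp [oneS, sub_mul]
    simp only [Δ_succ, map_sub, smul_sub]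
    rw [integral_sub (L.integrable_level_smul α (L.level_fourier hf) _)
      (L.integrable_level_smul α (L.level_fourier hf) _), L.integral_fourier_P α hf,
      L.integral_fourier_P α hf, e1, L.fourier_sub (hB _) (hB _)]
    simp only [Pi.sub_apply, sub_smul]
    rw [integral_sub (L.integrable_level_smul α (L.level_fourier (hB _)) _)
      (L.integrable_level_smul α (L.level_fourier (hB _)) _)]

lemma level_radial_mul_fourier {M : ℕ} {u φ : V → ℂ} {r : ℕ → ℂ} (hu : L.Radial u r)
    (hφ : L.Level M φ) : L.Level M fun Y => u Y * L.fourier φ Y :=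
  Level.invariant_mul L (L.level_fourier hφ) fun X W hW => hu.add_eq X hW

/-- The block `Δ m` only sees frequencies in the `m`-th shell, where a radial symbol is the constant
`r m`. -/
lemma integral_mult_Δ {M : ℕ} {u φ : V → ℂ} {r : ℕ → ℂ} (hu : L.Radial u r) (hφ : L.Level M φ)
    (m : ℕ) (a : A) : ∫ X, L.mult u φ X • α.aut X (L.Δ α m a) ∂L.μ =
      r m • ∫ X, φ X • α.aut X (L.Δ α m a) ∂L.μ := by
  have h := L.integral_fourier_Δ α (L.level_fourier hφ) m a
  rw [L.fourier_fourier hφ] at h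
  rw [mult, L.integral_fourier_Δ α (L.level_radial_mul_fourier hu hφ), h, ← integral_smul]
  have : (fun U => L.oneS m U * (u U * L.fourier φ U)) =
      r m • fun U => L.oneS m U * L.fourier φ U := by
    ext U
    rw [Pi.smul_apply, smul_eq_mul]
    by_cases hU : U ∈ L.shell m
    · rw [hu m U hU]; ring
    · rw [L.oneS_of_notMem hU]; ring
  rw [this, L.fourier_smul]
  simp only [Pi.smul_apply, smul_assoc]

/-- The operator that multiplies the `m`-th dyadic block by `r m`. -/
def M (r : ℕ → ℂ) (a : A) : A := ∑' m, r m • L.Δ α m a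

lemma Δ_M {r : ℕ → ℂ} {a : A} (h : Summable fun m => r m • L.Δ α m a) (j : ℕ) :
    L.Δ α j (L.M α r a) = r j • L.Δ α j a := by
  rw [M, (L.Δ α j).map_tsum h, tsum_eq_single j]
  · rw [map_smul, L.Δ_Δ_self]
  · intro m hm
    rw [map_smul, L.Δ_Δ_of_ne α hm.symm, smul_zero]

/-- Pairing an orbit with a test function is a bounded operator in the element, so both sides may be
summed over blocks and compared by `integral_mult_Δ`. -/
lemma rep_M {u : V → ℂ} {r : ℕ → ℂ} (hu : L.Radial u r) {a : A}
    (ha : Summable fun m => L.Δ α m a) (h : Summable fun m => r m • L.Δ α m a) :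
    L.Rep u (α.orbit a) (α.orbit (L.M α r a)) := by
  rintro φ ⟨hφ, hc⟩
  obtain ⟨M, hM⟩ := L.exists_level hφ hc
  have hi := hM.integrable L
  have hi' := (L.level_fourier (L.level_radial_mul_fourier hu hM)).integrable L
  have e1 : ∫ X, φ X • α.orbit (L.M α r a) X ∂L.μ =
      L.smear α continuous_id hi (L.M α r a) := rfl
  have e2 : ∫ X, L.mult u φ X • α.orbit a X ∂L.μ = L.smear α continuous_id hi' a := rfl
  rw [e1, e2, LatticeSystem.M, ContinuousLinearMap.map_tsum _ h]
  nth_rewrite 2 [← (L.hasSum_Δ α ha).tsum_eq]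
  rw [ContinuousLinearMap.map_tsum _ ha]
  refine tsum_congr fun m => ?_
  rw [map_smul, smear_apply, smear_apply]
  exact (L.integral_mult_Δ α hu hM m a).symm

/-- The normalized indicator function of `D m`, minus that of `D (m - 1)`. -/
def d : ℕ → V → ℂ
  | 0 => L.e 0
  | m + 1 => L.e (m + 1) - L.e m

lemma level_d (m : ℕ) : L.Level m (L.d m) := by
  cases m with
  | zero => exact L.level_e le_rfl
  | succ m =>
    have h1 := L.level_e (le_refl (m + 1))
    have h2 := L.level_e m.le_succ
    exact ⟨fun X hX => by simp only [d, Pi.sub_apply, h1.1 X hX, h2.1 X hX, sub_zero],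
      fun X W hW => by simp only [d, Pi.sub_apply, h1.2 X W hW, h2.2 X W hW]⟩

lemma fourier_d (m : ℕ) : L.fourier (L.d m) = (L.c : ℂ) • L.oneS m := by
  cases m with
  | zero => exact L.fourier_e 0
  | succ m =>
    rw [d, L.fourier_sub (L.level_e le_rfl) (L.level_e le_rfl), L.fourier_e, L.fourier_e, oneS,
      smul_sub]

lemma integral_d_smul (m : ℕ) (a : A) : ∫ X, L.d m X • α.aut X a ∂L.μ = L.Δ α m a := by
  cases m with
  | zero => rfl
  | succ m =>
    simp only [d, Pi.sub_apply, sub_smul]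
    rw [integral_sub (L.integrable_e_smul α _ a) (L.integrable_e_smul α _ a)]; rfl

lemma integral_norm_d (m : ℕ) : ∫ X, ‖L.d m X‖ ∂L.μ ≤ 2 := by
  cases m with
  | zero =>
    have := L.integral_norm_e 0
    rw [d]; linarith
  | succ m =>
    calc ∫ X, ‖L.d (m + 1) X‖ ∂L.μ ≤ ∫ X, (‖L.e (m + 1) X‖ + ‖L.e m X‖) ∂L.μ :=
          integral_mono ((L.level_d (m + 1)).integrable L).norm
            ((L.integrable_e _).norm.add (L.integrable_e _).norm) fun X => norm_sub_le _ _
      _ = 2 := by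
        rw [integral_add (L.integrable_e _).norm (L.integrable_e _).norm, L.integral_norm_e,
          L.integral_norm_e]; norm_num

/-- The transform of `d m` is a multiple of the indicator of one shell, so `d m` is an eigenvector
of every radial multiplier. -/
lemma mult_d {u : V → ℂ} {r : ℕ → ℂ} (hu : L.Radial u r) (m : ℕ) :
    L.mult u (L.d m) = r m • L.d m := by
  have : (fun Y => u Y * L.fourier (L.d m) Y) = r m • L.fourier (L.d m) := by
    ext Y
    simp only [L.fourier_d, Pi.smul_apply, smul_eq_mul]
    by_cases hY : Y ∈ L.shell m
    · rw [hu m Y hY]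
    · rw [L.oneS_of_notMem hY]; ring
  rw [mult, this, L.fourier_smul, L.fourier_fourier (L.level_d m)]

/-- The kernel `d m` of `Δ m` is itself a test function and an eigenvector. Testing with it turns
the distributional identity into a formula for `r m • Δ m a`, and its `L¹` norm is at most `2`. -/
lemma norm_Δ_le_of_rep {u : V → ℂ} {r : ℕ → ℂ} (hu : L.Radial u r) {a : A} {G : V → A}
    (hG : L.Rep u (α.orbit a) G) {C : ℝ} (hC : ∀ᵐ X ∂L.μ, ‖G X‖ ≤ C) (m : ℕ) :
    ‖r m • L.Δ α m a‖ ≤ 2 * C := by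
  have hd := L.level_d m
  have h := hG (L.d m) ⟨hd.isLocallyConstant L, hd.hasCompactSupport L⟩
  rw [L.mult_d hu] at h
  have e : ∫ X, (r m • L.d m) X • α.orbit a X ∂L.μ = r m • L.Δ α m a := by
    rw [← L.integral_d_smul, ← integral_smul]
    simp only [Pi.smul_apply, smul_assoc]; rfl
  rw [← e, ← h]
  have hC0 : 0 ≤ C := by
    obtain ⟨X, hX⟩ := hC.exists
    exact (norm_nonneg _).trans hX
  calc ‖∫ X, L.d m X • G X ∂L.μ‖ ≤ ∫ X, ‖L.d m X‖ * C ∂L.μ := by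
        refine norm_integral_le_of_norm_le ((hd.integrable L).norm.mul_const _) ?_
        filter_upwards [hC] with X hX
        rw [norm_smul]
        exact mul_le_mul_of_nonneg_left hX (norm_nonneg _)
    _ ≤ 2 * C := by
        rw [integral_mul_const]
        exact mul_le_mul_of_nonneg_right (L.integral_norm_d m) hC0

/-- Translates of the approximate identity `e m` are test functions and recover the values of a
continuous function. -/
lemma rep_unique {u : V → ℂ} {F G G' : V → A} (hG : L.Rep u F G) (hG' : L.Rep u F G')
    (hc : Continuous G) (hc' : Continuous G') : G = G' := by
  have key : ∀ H : V → A, Continuous H → ∀ X,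
      Tendsto (fun m => ∫ Y, L.e m (Y - X) • H Y ∂L.μ) atTop (𝓝 (H X)) := fun H hH X => by
    have := L.tendsto_integral_e (F := fun Y => H (Y + X)) (by fun_prop)
    rw [zero_add] at this
    refine this.congr fun m => ?_
    rw [← integral_sub_right_eq_self _ X]
    simp only [sub_add_cancel]
  ext X
  refine tendsto_nhds_unique (key G hc X) ((key G' hc' X).congr fun m => ?_)
  have hlc : IsLocallyConstant fun Y => L.e m (Y - X) :=
    ((L.level_e le_rfl).isLocallyConstant L).comp_continuous (by fun_prop)
  have hcs : HasCompactSupport fun Y => L.e m (Y - X) := by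
    have := ((L.level_e (le_refl m)).hasCompactSupport L).comp_homeomorph
      (Homeomorph.addRight (-X))
    simpa only [Function.comp_def, Homeomorph.coe_addRight, ← sub_eq_add_neg] using this
  rw [hG _ ⟨hlc, hcs⟩, hG' _ ⟨hlc, hcs⟩]

/-- The space of regular elements. -/
def regular : Submodule ℂ A where
  -- Stated without distributions: `b` plays the role of the value of `J ^ n α̃(a)` at the origin.
  -- In this form linearity is immediate and the condition is closed under limits.
  carrier := {a | ∀ n : ℕ, ∃ b, ∀ m, L.Δ α m b = (L.q : ℂ) ^ (m * n) • L.Δ α m a}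
  add_mem' := fun {a b} ha hb n => by
    obtain ⟨x, hx⟩ := ha n
    obtain ⟨y, hy⟩ := hb n
    exact ⟨x + y, fun m => by rw [map_add, map_add, hx, hy, smul_add]⟩
  zero_mem' := fun n => ⟨0, fun m => by simp⟩
  smul_mem' := fun z a ha n => by
    obtain ⟨x, hx⟩ := ha n
    exact ⟨z • x, fun m => by rw [map_smul, map_smul, hx, smul_comm]⟩

lemma norm_q_pow (k : ℕ) : ‖(L.q : ℂ) ^ k‖ = L.q ^ k := by
  rw [norm_pow, Complex.norm_real, Real.norm_of_nonneg L.q_pos.le]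

lemma q_ne_zero : (L.q : ℂ) ≠ 0 := by exact_mod_cast L.q_pos.ne'

lemma summable_q : Summable fun m : ℕ => (L.q⁻¹) ^ m :=
  summable_geometric_of_lt_one (inv_nonneg.2 L.q_pos.le) (inv_lt_one_of_one_lt₀ L.one_lt_q)

/-- One power of `q ^ m` more than the growth of `r` is spent on a geometric series. -/
lemma summable_of_bound {a : A} {n : ℕ} {C : ℝ}
    (h : ∀ m, L.q ^ (m * (n + 1)) * ‖L.Δ α m a‖ ≤ C) {r : ℕ → ℂ}
    (hr : ∀ m, ‖r m‖ ≤ L.q ^ (m * n)) : Summable fun m => r m • L.Δ α m a := by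
  refine Summable.of_norm_bounded (L.summable_q.mul_left C) fun m => ?_
  rw [norm_smul, inv_pow, ← div_eq_mul_inv, le_div_iff₀ (pow_pos L.q_pos m)]
  calc ‖r m‖ * ‖L.Δ α m a‖ * L.q ^ m ≤ L.q ^ (m * n) * ‖L.Δ α m a‖ * L.q ^ m :=
        mul_le_mul_of_nonneg_right (mul_le_mul_of_nonneg_right (hr m) (norm_nonneg _))
          (pow_pos L.q_pos m).le
    _ = L.q ^ (m * (n + 1)) * ‖L.Δ α m a‖ := by ring
    _ ≤ C := h m

lemma mem_regular_of_bound {a : A} (h : ∀ n, ∃ C, ∀ m, L.q ^ (m * n) * ‖L.Δ α m a‖ ≤ C) :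
    a ∈ L.regular α := fun n => by
  obtain ⟨C, hC⟩ := h (n + 1)
  exact ⟨L.M α (fun m => (L.q : ℂ) ^ (m * n)) a,
    L.Δ_M α (L.summable_of_bound α hC fun m => (L.norm_q_pow _).le)⟩

/-- Together with `mem_regular_of_bound` this identifies regularity with rapid decay of the blocks,
so that boundedness already forces representability by continuous functions. -/
lemma bound_of_mem_regular {a : A} (ha : a ∈ L.regular α) (n : ℕ) :
    ∃ C, ∀ m, L.q ^ (m * n) * ‖L.Δ α m a‖ ≤ C := by
  obtain ⟨b, hb⟩ := ha n
  refine ⟨2 * ‖b‖, fun m => ?_⟩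
  rw [← L.norm_q_pow, ← norm_smul, ← hb]
  exact L.norm_Δ_le α m b

lemma summable_of_mem {a : A} (ha : a ∈ L.regular α) {n : ℕ} {r : ℕ → ℂ}
    (hr : ∀ m, ‖r m‖ ≤ L.q ^ (m * n)) : Summable fun m => r m • L.Δ α m a := by
  obtain ⟨C, hC⟩ := L.bound_of_mem_regular α ha (n + 1)
  exact L.summable_of_bound α hC hr

lemma summable_Δ {a : A} (ha : a ∈ L.regular α) : Summable fun m => L.Δ α m a := by
  simpa using L.summable_of_mem α ha (n := 0) (r := fun _ => 1) (by simp)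

/-- The orbit map of an element, as a bounded continuous function. -/
def orbitBCF (a : A) : V →ᵇ A :=
  BoundedContinuousFunction.ofNormedAddCommGroup (α.orbit a) (α.continuous_orbit a) ‖a‖
    fun X => (α.norm_aut X a).le

@[simp] lemma orbitBCF_apply (a : A) (X : V) : orbitBCF α a X = α.aut X a := rfl

lemma norm_orbitBCF (a : A) : ‖orbitBCF α a‖ = ‖a‖ := by
  refine le_antisymm (BoundedContinuousFunction.norm_ofNormedAddCommGroup_le _ (norm_nonneg a) _) ?_
  have := (orbitBCF α a).norm_coe_le_norm 0
  rwa [orbitBCF_apply, α.aut_zero] at this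

lemma rep_M_of_mem {u : V → ℂ} {r : ℕ → ℂ} (hu : L.Radial u r) {n : ℕ}
    (hr : ∀ m, ‖r m‖ ≤ L.q ^ (m * n)) {a : A} (ha : a ∈ L.regular α) :
    L.Rep u (α.orbit a) (orbitBCF α (L.M α r a)) :=
  L.rep_M α hu (L.summable_Δ α ha) (L.summable_of_mem α ha hr)

lemma existsUnique_rep {u : V → ℂ} {r : ℕ → ℂ} (hu : L.Radial u r) {n : ℕ}
    (hr : ∀ m, ‖r m‖ ≤ L.q ^ (m * n)) {a : A} (ha : a ∈ L.regular α) :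
    ∃! G : V →ᵇ A, L.Rep u (α.orbit a) G :=
  ⟨orbitBCF α (L.M α r a), L.rep_M_of_mem α hu hr ha, fun G hG =>
    DFunLike.coe_injective (L.rep_unique hG (L.rep_M_of_mem α hu hr ha) G.continuous
      (orbitBCF α (L.M α r a)).continuous)⟩

/-- The elements whose orbit maps are mapped into `L^∞` by all powers of the weight are the
regular ones. -/
lemma mem_regular_iff {u : ℕ → V → ℂ} (hu : ∀ n, L.Radial (u n) fun m => (L.q : ℂ) ^ (m * n))
    (a : A) : a ∈ L.regular α ↔
      ∀ n, ∃ G : V → A, MemLp G ∞ L.μ ∧ L.Rep (u n) (α.orbit a) G := by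
  refine ⟨fun ha n => ?_, fun h => L.mem_regular_of_bound α fun n => ?_⟩
  · have hr : ∀ m, ‖(L.q : ℂ) ^ (m * n)‖ ≤ L.q ^ (m * n) := fun m => (L.norm_q_pow _).le
    refine ⟨_, ?_, L.rep_M_of_mem α (hu n) hr ha⟩
    exact memLp_top_of_bound (orbitBCF α _).continuous.aestronglyMeasurable _
      (.of_forall (orbitBCF α _).norm_coe_le_norm)
  · obtain ⟨G, hG, hR⟩ := h n
    -- The bound at order `n` comes from the essential supremum of the representative of order `n`.
    refine ⟨2 * (eLpNorm G ∞ L.μ).toReal, fun m => ?_⟩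
    have := L.norm_Δ_le_of_rep α (hu n) hR (C := (eLpNorm G ∞ L.μ).toReal) ?_ m
    · rwa [norm_smul, L.norm_q_pow] at this
    · filter_upwards [ae_le_eLpNormEssSup (f := G) (μ := L.μ)] with X hX
      rw [eLpNorm_exponent_top]
      have hfin : eLpNormEssSup G L.μ ≠ ∞ := by
        have := hG.2.ne
        rwa [eLpNorm_exponent_top] at this
      rw [← ENNReal.ofReal_le_iff_le_toReal hfin, ofReal_norm]
      exact hX

end LatticeSystem

end

/-! ### Dilations and the finite deformed product on `B m / D m`. -/

section

/-- An endomorphism of the phase space that acts on the lattices like multiplication by an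
integral scalar. -/
structure LatticeSystem.Dilation {V : Type*} [AddCommGroup V] [TopologicalSpace V]
    [MeasurableSpace V] (L : LatticeSystem V) where
  /-- the underlying endomorphism -/
  θ : V →+ V
  cont : Continuous θ
  β_map : ∀ X Y, L.β (θ X) Y = L.β X (θ Y)
  β_self : ∀ X, L.β (θ X) X = 1
  map_D : ∀ m, ∀ X ∈ L.D m, θ X ∈ L.D m
  map_B : ∀ m, ∀ X ∈ L.B m, θ X ∈ L.B m
  /-- the index of the image of a shell -/
  j : ℕ → ℕ
  j_le : ∀ m, j m ≤ m
  w_map : ∀ m, ∀ X ∈ L.shell m, L.w (θ X) = L.q ^ j m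
  -- This field and `surj` say that `θ` maps `D (j m)` into `D m`, while the image of `D (j m - 1)`
  -- contains `D (m - 1)` when `j m > 0`. They force the frequencies of `X ↦ α_{θX}(Δ m a)` into the
  -- shell `j m`, from outside and from inside respectively.
  map_D_j : ∀ m, ∀ X ∈ L.D (j m), θ X ∈ L.D m
  surj : ∀ m k, j m = k + 1 → ∀ X ∈ L.D (m - 1), ∃ W ∈ L.D k, θ W = X

namespace LatticeSystem

variable {V : Type*} [AddCommGroup V] [TopologicalSpace V] [MeasurableSpace V]
  (L : LatticeSystem V) [IsTopologicalAddGroup V] [BorelSpace V] [SecondCountableTopology V]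
  {A : Type*} [NonUnitalCStarAlgebra A] (α : ContinuousAction V A) (T : L.Dilation)

/-- The quotient is finite because `B m` is compact and `D m` is open. -/
lemma exists_reps (m : ℕ) : ∃ R : Finset V, (∀ r ∈ R, r ∈ L.B m) ∧
    ∀ X ∈ L.B m, ∃! r, r ∈ R ∧ X - r ∈ L.D m := by
  classical
  have : CompactSpace (L.B m) := isCompact_iff_compactSpace.1 (L.B_compact m)
  have ho : IsOpen (((L.D m).addSubgroupOf (L.B m) : AddSubgroup (L.B m)) : Set (L.B m)) :=
    (L.D_open m).preimage continuous_subtype_val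
  have : Finite (L.B m ⧸ (L.D m).addSubgroupOf (L.B m)) :=
    AddSubgroup.quotient_finite_of_isOpen _ ho
  have := Fintype.ofFinite (L.B m ⧸ (L.D m).addSubgroupOf (L.B m))
  refine ⟨Finset.univ.image fun x : L.B m ⧸ (L.D m).addSubgroupOf (L.B m) => (x.out : V),
    fun r hr => ?_, fun X hX => ?_⟩
  · obtain ⟨x, -, rfl⟩ := Finset.mem_image.1 hr
    exact x.out.2
  · have key : ∀ x : L.B m ⧸ (L.D m).addSubgroupOf (L.B m),
        X - (x.out : V) ∈ L.D m ↔ x = QuotientAddGroup.mk ⟨X, hX⟩ := fun x => by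
      conv_rhs => rw [← QuotientAddGroup.out_eq' x, QuotientAddGroup.eq]
      rw [AddSubgroup.mem_addSubgroupOf]
      simp [sub_eq_neg_add]
    refine ⟨((QuotientAddGroup.mk ⟨X, hX⟩ : L.B m ⧸ (L.D m).addSubgroupOf (L.B m)).out : V),
      ⟨Finset.mem_image_of_mem _ (Finset.mem_univ _), (key _).2 rfl⟩, ?_⟩
    rintro r ⟨hr, hXr⟩
    obtain ⟨x, -, rfl⟩ := Finset.mem_image.1 hr
    rw [(key x).1 hXr]

/-- Representatives of the cosets of `D m` in `B m`. -/
def reps (m : ℕ) : Finset V := (L.exists_reps m).choose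

lemma mem_B_of_reps {m : ℕ} {X : V} (h : X ∈ L.reps m) : X ∈ L.B m :=
  (L.exists_reps m).choose_spec.1 X h

lemma exists_rep {m : ℕ} {X : V} (h : X ∈ L.B m) : ∃ r ∈ L.reps m, X - r ∈ L.D m := by
  obtain ⟨r, hr, -⟩ := (L.exists_reps m).choose_spec.2 X h
  exact ⟨r, hr.1, hr.2⟩

lemma rep_inj {m : ℕ} {r r' : V} (hr : r ∈ L.reps m) (hr' : r' ∈ L.reps m)
    (h : r - r' ∈ L.D m) : r = r' := by
  obtain ⟨x, -, hx⟩ := (L.exists_reps m).choose_spec.2 r (L.mem_B_of_reps hr)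
  exact (hx r ⟨hr, by simp⟩).trans (hx r' ⟨hr', h⟩).symm

/-- A function whose restriction to `B m` is invariant under `D m`. -/
def Inv {E : Type*} (m : ℕ) (f : V → E) : Prop := ∀ X ∈ L.B m, ∀ W ∈ L.D m, f (X + W) = f X

variable {L} in
lemma Inv.eq_of_sub_mem {E : Type*} {m : ℕ} {f : V → E} (hf : L.Inv m f) {X Y : V}
    (hY : Y ∈ L.B m) (h : X - Y ∈ L.D m) : f X = f Y := by
  have := hf Y hY _ h
  rwa [add_sub_cancel] at this

/-- Translation by `Y` permutes the cosets, and `f` depends only on the coset. This is the change of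
variables for the finite sums. -/
lemma sum_reps_add {E : Type*} [AddCommMonoid E] {m : ℕ} {f : V → E} (hf : L.Inv m f) {Y : V}
    (hY : Y ∈ L.B m) : ∑ x ∈ L.reps m, f (x + Y) = ∑ x ∈ L.reps m, f x := by
  classical
  have key : ∀ X ∈ L.reps m, ∃ r ∈ L.reps m, X + Y - r ∈ L.D m := fun X hX =>
    L.exists_rep ((L.B m).add_mem (L.mem_B_of_reps hX) hY)
  choose! i hi hi' using key
  refine Finset.sum_bij (fun x _ => i x) hi (fun x hx y hy h => ?_) ?_ fun x hx => ?_
  · refine L.rep_inj hx hy ?_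
    have := (L.D m).sub_mem (hi' x hx) (hi' y hy)
    rw [h] at this
    simpa using this
  · intro z hz
    obtain ⟨x, hx, hxz⟩ := L.exists_rep ((L.B m).sub_mem (L.mem_B_of_reps hz) hY)
    refine ⟨x, hx, (L.rep_inj hz (hi x hx) ?_).symm⟩
    have := (L.D m).add_mem hxz (hi' x hx)
    rwa [show z - Y - x + (x + Y - i x) = z - i x by abel] at this
  · exact hf.eq_of_sub_mem (L.mem_B_of_reps (hi x hx)) (hi' x hx)

lemma sum_reps_sub {E : Type*} [AddCommMonoid E] {m : ℕ} {f : V → E} (hf : L.Inv m f) {Y : V}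
    (hY : Y ∈ L.B m) : ∑ x ∈ L.reps m, f x = ∑ x ∈ L.reps m, f (x - Y) := by
  rw [← L.sum_reps_add hf ((L.B m).neg_mem hY)]
  simp only [sub_eq_add_neg]

lemma inv_β (m : ℕ) {Y : V} (hY : Y ∈ L.B m) : L.Inv m fun X => (L.β X Y : ℂ) :=
  fun X _ W hW => by simp only [L.β_add_left, L.β_D_B hW hY, mul_one]

lemma sum_β {m : ℕ} {W : V} (hW : W ∈ L.B m) (hWD : W ∉ L.D m) :
    ∑ x ∈ L.reps m, (L.β x W : ℂ) = 0 := by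
  rw [L.mem_D_iff] at hWD
  push Not at hWD
  obtain ⟨Y, hY, h⟩ := hWD
  have e := L.sum_reps_add (L.inv_β m hW) hY
  simp only [L.β_add_left, Circle.coe_mul] at e
  rw [← Finset.sum_mul] at e
  have hne : (L.β Y W : ℂ) - 1 ≠ 0 := sub_ne_zero.2 (mt Circle.coe_eq_one.1 h)
  have : (∑ x ∈ L.reps m, (L.β x W : ℂ)) * ((L.β Y W : ℂ) - 1) = 0 := by
    rw [mul_sub, mul_one, e, sub_self]
  exact (mul_eq_zero.1 this).resolve_right hne

/-- Fourier inversion on the finite group `B m / D m`: the sum over `x` vanishes unless `y` lies in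
the coset of `W`. -/
lemma sum_sum_β_smul {m : ℕ} {f : V → A} (hf : L.Inv m f) {W : V} (hW : W ∈ L.B m) :
    ∑ x ∈ L.reps m, ∑ y ∈ L.reps m, (L.β x (y - W) : ℂ) • f y =
      ((L.reps m).card : ℂ) • f W := by
  obtain ⟨r, hr, hWr⟩ := L.exists_rep hW
  rw [Finset.sum_comm]
  simp_rw [← Finset.sum_smul]
  rw [Finset.sum_eq_single r]
  · have hrW : r - W ∈ L.D m := by simpa using (L.D m).neg_mem hWr
    rw [hf.eq_of_sub_mem hW hrW]
    congr 1
    rw [Finset.sum_congr rfl fun x hx => by rw [L.β_B_D (L.mem_B_of_reps hx) hrW]]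
    simp
  · intro y hy hyr
    rw [L.sum_β ((L.B m).sub_mem (L.mem_B_of_reps hy) hW), zero_smul]
    intro h
    refine hyr (L.rep_inj hy hr ?_)
    have := (L.D m).add_mem h hWr
    rwa [sub_add_sub_cancel] at this
  · exact fun h => absurd hr h

lemma sum_sum_β_smul' {m : ℕ} {f : V → A} (hf : L.Inv m f) {W : V} (hW : W ∈ L.B m) :
    ∑ x ∈ L.reps m, ∑ y ∈ L.reps m, (L.β (y - W) x : ℂ) • f y =
      ((L.reps m).card : ℂ) • f W := by
  have hneg : ∀ y ∈ L.reps m, L.Inv m fun x => (L.β (y - W) x : ℂ) • f y := fun y hy X hX D hD => by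
    simp only [L.β_add_right, L.β_B_D ((L.B m).sub_mem (L.mem_B_of_reps hy) hW) hD, mul_one]
  rw [← L.sum_sum_β_smul hf hW, Finset.sum_comm, Finset.sum_comm (s := L.reps m) (t := L.reps m)
    (f := fun x y => (L.β x (y - W) : ℂ) • f y)]
  refine Finset.sum_congr rfl fun y hy => ?_
  rw [← Finset.sum_smul, ← Finset.sum_smul]
  congr 1
  have hyW := (L.B m).sub_mem (L.mem_B_of_reps hy) hW
  by_cases h : y - W ∈ L.D m
  · refine Finset.sum_congr rfl fun x hx => ?_
    rw [L.β_B_D (L.mem_B_of_reps hx) h, L.β_D_B h (L.mem_B_of_reps hx)]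
  · rw [L.sum_β hyW h]
    have : ∀ x, (L.β (y - W) x : ℂ) = (starRingEnd ℂ) (L.β x (y - W) : ℂ) := fun x =>
      (L.conj_β _ _).symm
    simp_rw [this]
    rw [← map_sum, L.sum_β hyW h, map_zero]

lemma card_reps_pos (m : ℕ) : 0 < (L.reps m).card := by
  obtain ⟨r, hr, -⟩ := L.exists_rep (L.B m).zero_mem
  exact Finset.card_pos.2 ⟨r, hr⟩

/-- The elements fixed by the automorphisms attached to `D m`. -/
def Fix (m : ℕ) (a : A) : Prop := ∀ W ∈ L.D m, α.aut W a = a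

variable {L α} in
lemma Fix.mono {m k : ℕ} (h : m ≤ k) {a : A} (ha : L.Fix α m a) : L.Fix α k a :=
  fun W hW => ha W (L.D_anti h hW)

lemma fix_P {m k : ℕ} (h : m ≤ k) (a : A) : L.Fix α k (L.P α m a) :=
  fun _ hW => L.aut_P_of_mem α (L.D_anti h hW) a

lemma fix_Δ {m k : ℕ} (h : m ≤ k) (a : A) : L.Fix α k (L.Δ α m a) :=
  fun _ hW => L.aut_Δ_of_mem α (L.D_anti h hW) a

variable {L α} in
lemma Fix.star {m : ℕ} {a : A} (ha : L.Fix α m a) : L.Fix α m (star a) :=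
  fun W hW => by rw [map_star, ha W hW]

variable {L α} in
lemma Fix.aut {m : ℕ} {a : A} (ha : L.Fix α m a) (X : V) : L.Fix α m (α.aut X a) :=
  fun W hW => by rw [α.aut_comm, ha W hW]

variable {L α} in
lemma Fix.aut_add {m : ℕ} {a : A} (ha : L.Fix α m a) (X : V) {W : V} (hW : W ∈ L.D m) :
    α.aut (X + W) a = α.aut X a := by rw [α.aut_add, ha W hW]

variable {L} in
lemma Dilation.aut_map_add {T : L.Dilation} {α : ContinuousAction V A} {m : ℕ} {a : A}
    (ha : L.Fix α m a) (X : V) {W : V} (hW : W ∈ L.D m) :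
    α.aut (T.θ (X + W)) a = α.aut (T.θ X) a := by
  rw [map_add, ha.aut_add _ (T.map_D m W hW)]

/-- The deformed product of elements fixed by `D m`, as a finite sum. -/
def fstar (m : ℕ) (a b : A) : A :=
  ((L.reps m).card : ℂ)⁻¹ • ∑ x ∈ L.reps m, ∑ y ∈ L.reps m,
    (L.β y x : ℂ) • (α.aut (T.θ x) a * α.aut y b)

lemma aut_fstar (m : ℕ) (X : V) (a b : A) :
    α.aut X (L.fstar α T m a b) = L.fstar α T m (α.aut X a) (α.aut X b) := by
  simp only [fstar, map_smul, map_sum, map_mul, α.aut_comm X]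

lemma fix_fstar {m : ℕ} {a b : A} (ha : L.Fix α m a) (hb : L.Fix α m b) :
    L.Fix α m (L.fstar α T m a b) := fun W hW => by rw [L.aut_fstar, ha W hW, hb W hW]

/-- The triple product. -/
def fstar₃ (m : ℕ) (a b c : A) : A :=
  ((L.reps m).card : ℂ)⁻¹ • ∑ x ∈ L.reps m, ∑ y ∈ L.reps m,
    (L.β y x : ℂ) • (α.aut (T.θ x) a * α.aut y b * α.aut (y - T.θ x) c)

lemma sum_comm₄ {ι E : Type*} [AddCommMonoid E] (R : Finset ι) (f : ι → ι → ι → ι → E) :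
    ∑ x ∈ R, ∑ y ∈ R, ∑ u ∈ R, ∑ v ∈ R, f x y u v =
      ∑ u ∈ R, ∑ v ∈ R, ∑ x ∈ R, ∑ y ∈ R, f x y u v := by
  simp only [← Finset.sum_product' R R]
  exact Finset.sum_comm

lemma sum_sum_smul {ι : Type*} (R : Finset ι) (z : ℂ) (f : ι → ι → A) :
    ∑ x ∈ R, ∑ y ∈ R, z • f x y = z • ∑ x ∈ R, ∑ y ∈ R, f x y := by
  simp only [← Finset.smul_sum]

/-- In the inner product, with variables `u` and `v`, shift `u` by `x` and `v` by `θ x`. As `β (θ x)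
x = 1` and `θ` is self-adjoint for `β`, the outer variable `x` then enters only through `β (y - (v -
θ u)) x`, so the sum over `x` and `y` sets `y = v - θ u`. -/
lemma fstar_fstar_left {m : ℕ} {a b c : A} (ha : L.Fix α m a) (hb : L.Fix α m b)
    (hc : L.Fix α m c) : L.fstar α T m (L.fstar α T m a b) c = L.fstar₃ α T m a b c := by
  have hn : ((L.reps m).card : ℂ) ≠ 0 := by exact_mod_cast (L.card_reps_pos m).ne'
  have e1 : ∀ x ∈ L.reps m, ∀ y ∈ L.reps m,
      (L.β y x : ℂ) • (α.aut (T.θ x) (L.fstar α T m a b) * α.aut y c) =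
      ((L.reps m).card : ℂ)⁻¹ • ∑ u ∈ L.reps m, ∑ v ∈ L.reps m,
        (L.β (y - (v - T.θ u)) x : ℂ) •
          ((L.β v u : ℂ) • (α.aut (T.θ u) a * α.aut v b * α.aut y c)) := by
    intro x hx y hy
    have hxB := L.mem_B_of_reps hx
    rw [L.aut_fstar, fstar, smul_mul_assoc, smul_comm]
    congr 1
    simp only [Finset.sum_mul, Finset.smul_sum]
    rw [L.sum_reps_sub (Y := x) _ hxB]
    · refine Finset.sum_congr rfl fun u hu => ?_
      have huB := (L.B m).sub_mem (L.mem_B_of_reps hu) hxB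
      rw [L.sum_reps_sub (Y := T.θ x) _ (T.map_B m x hxB)]
      · refine Finset.sum_congr rfl fun v hv => ?_
        rw [← α.aut_add, ← α.aut_add, ← map_add, sub_add_cancel, sub_add_cancel, smul_mul_assoc,
          smul_smul, smul_smul]
        congr 1
        have h1 : L.β (T.θ x) u = (L.β (T.θ u) x)⁻¹ := by rw [T.β_map, L.β_swap]
        simp only [L.β_sub_left, L.β_sub_right, T.β_self, h1, ← Circle.coe_mul, mul_inv, inv_inv,
          mul_one]
        congr 1
        ac_rfl
      · intro X hX W hW
        simp only [L.β_add_left, L.β_D_B hW huB, mul_one, (hb.aut _).aut_add X hW]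
    · intro X hX W hW
      refine Finset.sum_congr rfl fun v hv => ?_
      simp only [L.β_add_right, L.β_B_D (L.mem_B_of_reps hv) hW, mul_one,
        Dilation.aut_map_add (ha.aut _) X hW]
  rw [fstar, Finset.sum_congr rfl fun x hx => Finset.sum_congr rfl (e1 x hx), fstar₃]
  simp only [← Finset.smul_sum]
  congr 1
  rw [sum_comm₄, inv_smul_eq_iff₀ hn, Finset.smul_sum]
  refine Finset.sum_congr rfl fun u hu => ?_
  rw [Finset.smul_sum]
  refine Finset.sum_congr rfl fun v hv => ?_
  refine L.sum_sum_β_smul' (f := fun y =>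
    (L.β v u : ℂ) • (α.aut (T.θ u) a * α.aut v b * α.aut y c)) ?_
    ((L.B m).sub_mem (L.mem_B_of_reps hv) (T.map_B m u (L.mem_B_of_reps hu)))
  intro X hX W hW
  simp only [hc.aut_add X hW]

/-- Here the shifts are `v` by `y` and then `y` by `θ u`; the inner variable `u` is left only in `β
(v - (y - θ x)) u`, and summing over `u` and `v` sets `v = y - θ x`, which gives the same triple
product. -/
lemma fstar_fstar_right {m : ℕ} {a b c : A} (ha : L.Fix α m a) (hb : L.Fix α m b)
    (hc : L.Fix α m c) : L.fstar α T m a (L.fstar α T m b c) = L.fstar₃ α T m a b c := by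
  have hn : ((L.reps m).card : ℂ) ≠ 0 := by exact_mod_cast (L.card_reps_pos m).ne'
  have e1 : ∀ x ∈ L.reps m, ∀ y ∈ L.reps m,
      (L.β y x : ℂ) • (α.aut (T.θ x) a * α.aut y (L.fstar α T m b c)) =
      ((L.reps m).card : ℂ)⁻¹ • ∑ u ∈ L.reps m, ∑ v ∈ L.reps m,
        ((L.β y (x - u) : ℂ) * (L.β v u : ℂ)) •
          (α.aut (T.θ x) a * α.aut (y + T.θ u) b * α.aut v c) := by
    intro x hx y hy
    have hyB := L.mem_B_of_reps hy
    rw [L.aut_fstar, fstar, mul_smul_comm, smul_comm]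
    congr 1
    simp only [Finset.mul_sum, Finset.smul_sum]
    refine Finset.sum_congr rfl fun u hu => ?_
    have huB := L.mem_B_of_reps hu
    rw [L.sum_reps_sub (Y := y) _ hyB]
    · refine Finset.sum_congr rfl fun v hv => ?_
      rw [← α.aut_add, ← α.aut_add, sub_add_cancel, mul_smul_comm, smul_smul, ← mul_assoc,
        add_comm (T.θ u) y]
      congr 1
      simp only [L.β_sub_left, L.β_sub_right, ← Circle.coe_mul]
      congr 1
      ac_rfl
    · intro X hX W hW
      simp only [L.β_add_left, L.β_D_B hW huB, mul_one, (hc.aut _).aut_add X hW]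
  have e2 : ∀ x ∈ L.reps m, ∑ y ∈ L.reps m, ∑ u ∈ L.reps m, ∑ v ∈ L.reps m,
        ((L.β y (x - u) : ℂ) * (L.β v u : ℂ)) •
          (α.aut (T.θ x) a * α.aut (y + T.θ u) b * α.aut v c) =
      ∑ y ∈ L.reps m, ∑ u ∈ L.reps m, ∑ v ∈ L.reps m, (L.β (v - (y - T.θ x)) u : ℂ) •
        ((L.β y x : ℂ) • (α.aut (T.θ x) a * α.aut y b * α.aut v c)) := by
    intro x hx
    have hxB := L.mem_B_of_reps hx
    rw [Finset.sum_comm, Finset.sum_comm (f := fun y u => ∑ v ∈ L.reps m,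
      (L.β (v - (y - T.θ x)) u : ℂ) • _)]
    refine Finset.sum_congr rfl fun u hu => ?_
    have huB := L.mem_B_of_reps hu
    rw [L.sum_reps_sub (Y := T.θ u) _ (T.map_B m u huB)]
    · refine Finset.sum_congr rfl fun y hy => Finset.sum_congr rfl fun v hv => ?_
      rw [sub_add_cancel, smul_smul]
      congr 1
      have h1 : L.β (T.θ u) x = (L.β (T.θ x) u)⁻¹ := by rw [T.β_map, L.β_swap]
      simp only [L.β_sub_left, L.β_sub_right, T.β_self, h1, ← Circle.coe_mul, mul_inv, inv_inv,
        inv_one, mul_one]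
      congr 1
      ac_rfl
    · intro X hX W hW
      refine Finset.sum_congr rfl fun v hv => ?_
      have : X + W + T.θ u = X + T.θ u + W := by abel
      simp only [L.β_add_left, L.β_D_B hW ((L.B m).sub_mem hxB huB), mul_one, this,
        hb.aut_add _ hW]
  rw [fstar, Finset.sum_congr rfl fun x hx => Finset.sum_congr rfl (e1 x hx), fstar₃]
  simp only [← Finset.smul_sum]
  congr 1
  rw [Finset.sum_congr rfl e2, inv_smul_eq_iff₀ hn, Finset.smul_sum]
  refine Finset.sum_congr rfl fun x hx => ?_
  rw [Finset.smul_sum]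
  refine Finset.sum_congr rfl fun y hy => ?_
  refine L.sum_sum_β_smul' (f := fun v =>
    (L.β y x : ℂ) • (α.aut (T.θ x) a * α.aut y b * α.aut v c)) ?_
    ((L.B m).sub_mem (L.mem_B_of_reps hy) (T.map_B m x (L.mem_B_of_reps hx)))
  intro X hX W hW
  simp only [hc.aut_add X hW]

lemma fstar_assoc {m : ℕ} {a b c : A} (ha : L.Fix α m a) (hb : L.Fix α m b)
    (hc : L.Fix α m c) : L.fstar α T m (L.fstar α T m a b) c =
      L.fstar α T m a (L.fstar α T m b c) := by
  rw [L.fstar_fstar_left α T ha hb hc, L.fstar_fstar_right α T ha hb hc]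

/-- The involution reverses the factors but leaves `θ` on the wrong one. Expanding `α_{θx}(a*)` by
finite Fourier inversion and using `β (θ X) Y = β X (θ Y)` turns the phase into `β x (y - θ u) * β v
u`; the sum over `x` and `y` then replaces `y` by `θ u`. -/
lemma star_fstar {m : ℕ} {a b : A} (ha : L.Fix α m a) (hb : L.Fix α m b) :
    star (L.fstar α T m a b) = L.fstar α T m (star b) (star a) := by
  have hn : ((L.reps m).card : ℂ) ≠ 0 := by exact_mod_cast (L.card_reps_pos m).ne'
  have e0 : star (L.fstar α T m a b) = ((L.reps m).card : ℂ)⁻¹ • ∑ x ∈ L.reps m, ∑ y ∈ L.reps m,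
      (L.β x y : ℂ) • (α.aut y (star b) * α.aut (T.θ x) (star a)) := by
    simp only [fstar, star_smul, star_sum, star_mul, map_star, star_inv₀, star_natCast]
    congr 1
    refine Finset.sum_congr rfl fun x _ => Finset.sum_congr rfl fun y _ => ?_
    rw [← L.conj_β y x]; rfl
  have e1 : ∀ x ∈ L.reps m, ∀ y ∈ L.reps m,
      (L.β x y : ℂ) • (α.aut y (star b) * α.aut (T.θ x) (star a)) =
      ((L.reps m).card : ℂ)⁻¹ • ∑ u ∈ L.reps m, ∑ v ∈ L.reps m, (L.β x (y - T.θ u) : ℂ) •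
        ((L.β v u : ℂ) • (α.aut y (star b) * α.aut v (star a))) := by
    intro x hx y hy
    rw [eq_inv_smul_iff₀ hn, smul_comm, ← mul_smul_comm, ← L.sum_sum_β_smul'
      (f := fun v => α.aut v (star a)) (fun X hX W hW => ha.star.aut_add X hW)
      (T.map_B m x (L.mem_B_of_reps hx))]
    simp only [Finset.mul_sum, Finset.smul_sum]
    refine Finset.sum_congr rfl fun u hu => Finset.sum_congr rfl fun v hv => ?_
    rw [mul_smul_comm, smul_smul, smul_smul]
    congr 1
    simp only [L.β_sub_left, L.β_sub_right, T.β_map, ← Circle.coe_mul]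
    congr 1
    ac_rfl
  rw [e0, Finset.sum_congr rfl fun x hx => Finset.sum_congr rfl (e1 x hx), fstar, sum_sum_smul]
  congr 1
  rw [sum_comm₄, inv_smul_eq_iff₀ hn, Finset.smul_sum]
  refine Finset.sum_congr rfl fun u hu => ?_
  rw [Finset.smul_sum]
  refine Finset.sum_congr rfl fun v hv => ?_
  refine L.sum_sum_β_smul (f := fun y =>
    (L.β v u : ℂ) • (α.aut y (star b) * α.aut v (star a))) ?_
    (T.map_B m u (L.mem_B_of_reps hu))
  intro X hX W hW
  simp only [hb.star.aut_add X hW]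

/-- There is no cancellation in this bound: the growth of the number of cosets will be absorbed by
the decay of the blocks. -/
lemma norm_fstar_le (m : ℕ) (a b : A) :
    ‖L.fstar α T m a b‖ ≤ (L.reps m).card * (‖a‖ * ‖b‖) := by
  have hn : (0 : ℝ) < (L.reps m).card := by exact_mod_cast L.card_reps_pos m
  rw [fstar, norm_smul, norm_inv, Complex.norm_natCast, inv_mul_le_iff₀ hn]
  refine (norm_sum_le_of_le _ fun x _ => norm_sum_le_of_le (f := fun y =>
    (L.β y x : ℂ) • (α.aut (T.θ x) a * α.aut y b)) (n := fun _ => ‖a‖ * ‖b‖) _ fun y _ => ?_).trans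
    (by simp)
  rw [norm_smul, Circle.norm_coe, one_mul]
  exact (norm_mul_le _ _).trans_eq (by rw [α.norm_aut, α.norm_aut])

/-- The finite deformed product as a bounded bilinear map. -/
def fstarL (m : ℕ) : A →L[ℂ] A →L[ℂ] A :=
  LinearMap.mkContinuous₂
    (LinearMap.mk₂ ℂ (L.fstar α T m)
      (fun a a' b => by
        simp only [fstar, map_add, add_mul, smul_add, Finset.sum_add_distrib])
      (fun z a b => by
        simp only [fstar, map_smul, smul_mul_assoc, smul_comm _ z, ← Finset.smul_sum])
      (fun a b b' => by
        simp only [fstar, map_add, mul_add, smul_add, Finset.sum_add_distrib])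
      (fun z a b => by
        simp only [fstar, map_smul, mul_smul_comm, smul_comm _ z, ← Finset.smul_sum]))
    (L.reps m).card (fun a b => by rw [mul_assoc]; exact L.norm_fstar_le α T m a b)

@[simp] lemma fstarL_apply (m : ℕ) (a b : A) : L.fstarL α T m a b = L.fstar α T m a b := rfl

end LatticeSystem

end

/-! ### Oscillatory integrals: localization in shells and comparison with finite sums. -/

section

namespace LatticeSystem

variable {V : Type*} [AddCommGroup V] [TopologicalSpace V] [MeasurableSpace V]
  (L : LatticeSystem V) [IsTopologicalAddGroup V] [BorelSpace V] [SecondCountableTopology V]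
  {A : Type*} [NonUnitalCStarAlgebra A] (α : ContinuousAction V A) (T : L.Dilation)

instance : SigmaFinite L.μ := by
  have : SigmaCompactSpace V := ⟨⟨fun m => (L.B m : Set V), L.B_compact,
    Set.eq_univ_of_forall fun X => Set.mem_iUnion.2 (L.exhaust X)⟩⟩
  infer_instance

/-- The integrable amplitudes that are invariant under `B 0`. -/
def Amp (g : V → ℂ) : Prop := Integrable g L.μ ∧ ∀ X, ∀ W ∈ L.B 0, g (X + W) = g X

lemma amp_oneB (m : ℕ) : L.Amp (L.oneB m) :=
  ⟨(L.level_oneB le_rfl).integrable L, fun X _ hW => L.oneB_add m X hW⟩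

variable {L} in
lemma Amp.const_mul {g : V → ℂ} (hg : L.Amp g) (z : ℂ) : L.Amp fun X => z * g X :=
  ⟨hg.1.const_mul z, fun X W hW => by simp only [hg.2 X W hW]⟩

variable {L} in
lemma Amp.integrable_mul_β {g : V → ℂ} (hg : L.Amp g) (Z : V) :
    Integrable (fun X => g X * (L.β X Z : ℂ)) L.μ := by
  refine hg.1.norm.mono' (hg.1.1.mul (L.continuous_β_left Z).aestronglyMeasurable)
    (.of_forall fun X => ?_)
  rw [norm_mul, Circle.norm_coe, mul_one]

/-- The twisted orbital integral `∫ g(X) β(X, Z) α_{θ X}(a) dX`. -/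
def twist (θ : V →+ V) (g : V → ℂ) (Z : V) (a : A) : A :=
  ∫ X, (g X * (L.β X Z : ℂ)) • α.aut (θ X) a ∂L.μ

/-- Translation by some `W ∈ D k` with `β W Z ≠ 1` fixes the amplitude and the orbit, and multiplies
the integrand by that phase. -/
lemma twist_eq_zero_of_notMem {θ : V →+ V} {g : V → ℂ} (hg : L.Amp g) {k : ℕ} {Z : V} {a : A}
    (ha : ∀ W ∈ L.D k, α.aut (θ W) a = a) (hZ : Z ∉ L.B k) : L.twist α θ g Z a = 0 := by
  rw [L.mem_B_iff] at hZ
  push Not at hZ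
  obtain ⟨W, hW, h⟩ := hZ
  refine L.integral_char (W := W) (z := L.β W Z) (mt Circle.coe_eq_one.1 h) fun X => ?_
  rw [hg.2 X W (L.D_le_B_zero' k hW), L.β_add_left, Circle.coe_mul, smul_smul, map_add, α.aut_add,
    ha W hW]
  congr 1
  ring

/-- For `Z ∈ B k` the phase is invariant under `D k`, so the integral is unchanged when `a` is moved
by `θ (D k)`, which contains `D m`. By `map_P` it depends only on `P m a`. -/
lemma twist_eq_zero_of_mem {θ : V →+ V} (hθ : Continuous θ) {g : V → ℂ} (hg : L.Amp g) {k m : ℕ}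
    {Z : V} {a : A} (hθD : ∀ X ∈ L.D m, ∃ W ∈ L.D k, θ W = X) (ha : L.P α m a = 0)
    (hZ : Z ∈ L.B k) : L.twist α θ g Z a = 0 := by
  have h : L.twist α θ g Z a = L.smear α hθ (hg.integrable_mul_β Z) a := rfl
  rw [h, ← L.map_P α (m := m) _ a, ha, map_zero]
  intro W' hW'
  obtain ⟨W, hW, rfl⟩ := hθD W' hW'
  rw [smear_apply, smear_apply, ← integral_add_right_eq_self (fun X => _ • α.aut (θ X) a) W]
  simp only [hg.2 _ W (L.D_le_B_zero' k hW), L.β_add_left, L.β_D_B hW hZ, mul_one, map_add,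
    α.aut_add]

/-- The oscillatory integral with amplitudes `g` and `h`. -/
def osc (g h : V → ℂ) (a b : A) : A :=
  ∫ p, (g p.1 * h p.2 * (L.β p.2 p.1 : ℂ)) • (α.aut (T.θ p.1) a * α.aut p.2 b) ∂(L.μ.prod L.μ)

lemma norm_osc_integrand_le (g h : V → ℂ) (a b : A) (p : V × V) :
    ‖(g p.1 * h p.2 * (L.β p.2 p.1 : ℂ)) • (α.aut (T.θ p.1) a * α.aut p.2 b)‖ ≤
      ‖g p.1 * h p.2‖ * (‖a‖ * ‖b‖) := by
  rw [norm_smul, norm_mul _ (L.β p.2 p.1 : ℂ), Circle.norm_coe, mul_one]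
  refine mul_le_mul_of_nonneg_left ((norm_mul_le _ _).trans_eq ?_) (norm_nonneg _)
  rw [α.norm_aut, α.norm_aut]

lemma aestronglyMeasurable_osc {g h : V → ℂ} (hg : Integrable g L.μ) (hh : Integrable h L.μ)
    (a b : A) : AEStronglyMeasurable (fun p : V × V => (g p.1 * h p.2 * (L.β p.2 p.1 : ℂ)) •
      (α.aut (T.θ p.1) a * α.aut p.2 b)) (L.μ.prod L.μ) := by
  have h1 : Continuous fun p : V × V => (L.β p.2 p.1 : ℂ) :=
    L.continuous_β.comp (by fun_prop : Continuous fun p : V × V => (p.2, p.1))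
  have h2 : Continuous fun p : V × V => α.aut (T.θ p.1) a * α.aut p.2 b :=
    ((α.continuous_orbit a).comp (T.cont.comp continuous_fst)).mul
      ((α.continuous_orbit b).comp continuous_snd)
  exact ((hg.mul_prod hh).1.mul h1.aestronglyMeasurable).smul h2.aestronglyMeasurable

lemma integrable_osc {g h : V → ℂ} (hg : Integrable g L.μ) (hh : Integrable h L.μ) (a b : A) :
    Integrable (fun p : V × V => (g p.1 * h p.2 * (L.β p.2 p.1 : ℂ)) •
      (α.aut (T.θ p.1) a * α.aut p.2 b)) (L.μ.prod L.μ) :=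
  ((hg.mul_prod hh).norm.mul_const (‖a‖ * ‖b‖)).mono' (L.aestronglyMeasurable_osc α T hg hh a b)
    (.of_forall fun p => L.norm_osc_integrand_le α T g h a b p)

lemma osc_eq_left {g h : V → ℂ} (hg : L.Amp g) (hh : L.Amp h) (a b : A) :
    L.osc α T g h a b =
      ∫ X, g X • (α.aut (T.θ X) a * L.twist α (AddMonoidHom.id V) h X b) ∂L.μ := by
  rw [osc, integral_prod _ (L.integrable_osc α T hg.1 hh.1 a b)]
  refine integral_congr_ae (.of_forall fun X => ?_)
  have hi : Integrable (fun Y => (h Y * (L.β Y X : ℂ)) • α.aut Y b) L.μ :=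
    L.integrable_smear α continuous_id (hh.integrable_mul_β X) b
  have := (ContinuousLinearMap.mul ℂ A (α.aut (T.θ X) a)).integral_comp_comm hi
  simp only [ContinuousLinearMap.mul_apply'] at this
  simp only [twist, AddMonoidHom.id_apply]
  rw [← this, ← integral_smul]
  refine integral_congr_ae (.of_forall fun Y => ?_)
  simp only [mul_smul_comm, smul_smul, mul_assoc]

/-- Fubini in the other order. The sign in `-Y` comes from writing `β Y X` as `β X (-Y)`. -/
lemma osc_eq_right {g h : V → ℂ} (hg : L.Amp g) (hh : L.Amp h) (a b : A) :
    L.osc α T g h a b = ∫ Y, h Y • (L.twist α T.θ g (-Y) a * α.aut Y b) ∂L.μ := by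
  rw [osc, integral_prod_symm _ (L.integrable_osc α T hg.1 hh.1 a b)]
  refine integral_congr_ae (.of_forall fun Y => ?_)
  have hi : Integrable (fun X => (g X * (L.β X (-Y) : ℂ)) • α.aut (T.θ X) a) L.μ :=
    L.integrable_smear α T.cont (hg.integrable_mul_β (-Y)) a
  have := ((ContinuousLinearMap.mul ℂ A).flip (α.aut Y b)).integral_comp_comm hi
  simp only [ContinuousLinearMap.flip_apply, ContinuousLinearMap.mul_apply'] at this
  simp only [twist]
  rw [← this, ← integral_smul]
  refine integral_congr_ae (.of_forall fun X => ?_)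
  simp only [smul_mul_assoc, smul_smul, L.β_neg_right, ← L.β_swap]
  congr 1
  ring

lemma osc_congr_left {g g' h : V → ℂ} (hg : L.Amp g) (hg' : L.Amp g') (hh : L.Amp h) {a b : A}
    (H : ∀ X, g X = g' X ∨ L.twist α (AddMonoidHom.id V) h X b = 0) :
    L.osc α T g h a b = L.osc α T g' h a b := by
  rw [L.osc_eq_left α T hg hh, L.osc_eq_left α T hg' hh]
  refine integral_congr_ae (.of_forall fun X => ?_)
  rcases H X with h | h
  · simp only [h]
  · simp only [h, mul_zero, smul_zero]

lemma osc_congr_right {g h h' : V → ℂ} (hg : L.Amp g) (hh : L.Amp h) (hh' : L.Amp h') {a b : A}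
    (H : ∀ Y, h Y = h' Y ∨ L.twist α T.θ g (-Y) a = 0) :
    L.osc α T g h a b = L.osc α T g h' a b := by
  rw [L.osc_eq_right α T hg hh, L.osc_eq_right α T hg hh']
  refine integral_congr_ae (.of_forall fun X => ?_)
  rcases H X with h | h
  · simp only [h]
  · simp only [h, zero_mul, smul_zero]

lemma osc_congr_of_fix {g g' h h' : V → ℂ} (hg : L.Amp g) (hg' : L.Amp g') (hh : L.Amp h)
    (hh' : L.Amp h') {m : ℕ} (hgg : ∀ X ∈ L.B m, g X = g' X) (hhh : ∀ X ∈ L.B m, h X = h' X)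
    {a b : A} (ha : L.Fix α m a) (hb : L.Fix α m b) :
    L.osc α T g h a b = L.osc α T g' h' a b := by
  rw [L.osc_congr_left α T hg hg' hh fun X => ?_, L.osc_congr_right α T hg' hh hh' fun X => ?_]
  · by_cases hX : X ∈ L.B m
    · exact .inl (hhh X hX)
    · refine .inr (L.twist_eq_zero_of_notMem α hg' (k := m) (fun W hW => ha _ (T.map_D m W hW)) ?_)
      exact fun h => hX (by simpa using (L.B m).neg_mem h)
  · by_cases hX : X ∈ L.B m
    · exact .inl (hgg X hX)
    · exact .inr (L.twist_eq_zero_of_notMem α hh (k := m) (fun W hW => hb W hW) hX)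

/-- The block is fixed by `D k`, which excludes frequencies outside `B k`, and killed by `P (k -
1)`, which excludes those in `B (k - 1)`. -/
lemma twist_id_Δ {h : V → ℂ} (hh : L.Amp h) {k : ℕ} {X : V} (hX : X ∉ L.shell k) (b : A) :
    L.twist α (AddMonoidHom.id V) h X (L.Δ α k b) = 0 := by
  by_cases hB : X ∈ L.B k
  · cases k with
    | zero => exact absurd (by rw [L.shell_zero]; exact hB) hX
    | succ k =>
      have hk : X ∈ L.B k := by
        by_contra h
        exact hX (by rw [L.shell_succ]; exact ⟨hB, h⟩)
      exact L.twist_eq_zero_of_mem α continuous_id hh (k := k) (m := k)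
        (fun W hW => ⟨W, hW, rfl⟩) (L.P_Δ_of_lt α k.lt_succ_self b) hk
  · exact L.twist_eq_zero_of_notMem α hh (fun W hW => L.aut_Δ_of_mem α hW b) hB

lemma twist_θ_Δ {g : V → ℂ} (hg : L.Amp g) {m : ℕ} {X : V} (hX : X ∉ L.shell (T.j m)) (a : A) :
    L.twist α T.θ g X (L.Δ α m a) = 0 := by
  by_cases hB : X ∈ L.B (T.j m)
  · obtain h0 | ⟨k, hk⟩ : T.j m = 0 ∨ ∃ k, T.j m = k + 1 := by
      cases T.j m <;> simp
    · exact absurd (by rw [h0, L.shell_zero]; rw [h0] at hB; exact hB) hX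
    · rw [hk] at hB hX
      have hB' : X ∈ L.B k := by
        by_contra h
        exact hX (by rw [L.shell_succ]; exact ⟨hB, h⟩)
      -- The truncated subtraction is genuine: `k + 1 = j m ≤ m`.
      have hm : m - 1 < m := by have := T.j_le m; omega
      exact L.twist_eq_zero_of_mem α T.cont hg (k := k) (m := m - 1) (T.surj m k hk)
        (L.P_Δ_of_lt α hm a) hB'
  · exact L.twist_eq_zero_of_notMem α hg
      (fun W hW => L.aut_Δ_of_mem α (T.map_D_j m W hW) a) hB

lemma neg_mem_shell {m : ℕ} {X : V} : -X ∈ L.shell m ↔ X ∈ L.shell m := by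
  simp [shell]

/-- The indices cross over: the block of `b` localizes `X`, and the block of `a`, through `θ`,
localizes `Y`. -/
lemma osc_congr_of_shell {g g' h h' : V → ℂ} (hg : L.Amp g) (hg' : L.Amp g') (hh : L.Amp h)
    (hh' : L.Amp h') {m k : ℕ} (hgg : ∀ X ∈ L.shell k, g X = g' X)
    (hhh : ∀ X ∈ L.shell (T.j m), h X = h' X) (a b : A) :
    L.osc α T g h (L.Δ α m a) (L.Δ α k b) = L.osc α T g' h' (L.Δ α m a) (L.Δ α k b) := by
  rw [L.osc_congr_left α T hg hg' hh fun X => ?_, L.osc_congr_right α T hg' hh hh' fun X => ?_]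
  · by_cases hX : X ∈ L.shell (T.j m)
    · exact .inl (hhh X hX)
    · exact .inr (L.twist_θ_Δ α T hg' (mt L.neg_mem_shell.1 hX) a)
  · by_cases hX : X ∈ L.shell k
    · exact .inl (hgg X hX)
    · exact .inr (L.twist_id_Δ α hh hX b)

lemma integral_oneB_smul {E : Type*} [NormedAddCommGroup E] [NormedSpace ℂ E] [CompleteSpace E]
    {m : ℕ} {f : V → E} (hf : L.Inv m f) :
    ∫ X, L.oneB m X • f X ∂L.μ = (L.μ.real (L.D m) : ℂ) • ∑ x ∈ L.reps m, f x := by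
  have hD : (L.μ.real (L.D m) : ℂ) ≠ 0 := by exact_mod_cast (L.μD_pos m).ne'
  have e1 : ∀ X, L.oneB m X • f X =
      ∑ r ∈ L.reps m, ((L.μ.real (L.D m) : ℂ) * L.e m (X - r)) • f r := fun X => by
    by_cases hX : X ∈ L.B m
    · obtain ⟨r, hr, hXr⟩ := L.exists_rep hX
      rw [Finset.sum_eq_single r, L.e_of_mem hXr, mul_inv_cancel₀ hD, L.oneB_of_mem hX,
        hf.eq_of_sub_mem (L.mem_B_of_reps hr) hXr]
      · intro s hs hsr
        rw [L.e_of_notMem, mul_zero, zero_smul]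
        intro h
        refine hsr (L.rep_inj hs hr ?_)
        have := (L.D m).sub_mem hXr h
        rwa [sub_sub_sub_cancel_left] at this
      · exact fun h => absurd hr h
    · rw [L.oneB_of_notMem hX, zero_smul]
      refine (Finset.sum_eq_zero fun r hr => ?_).symm
      rw [L.e_of_notMem, mul_zero, zero_smul]
      intro h
      exact hX (by simpa using (L.B m).add_mem (L.D_le_B m m h) (L.mem_B_of_reps hr))
  have hi : ∀ r, Integrable (fun X => L.e m (X - r)) L.μ := fun r =>
    (L.integrable_e m).comp_sub_right r
  simp_rw [e1]
  rw [integral_finsetSum _ fun r _ => ((hi r).const_mul _).smul_const _, Finset.smul_sum]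
  refine Finset.sum_congr rfl fun r _ => ?_
  rw [integral_smul_const, integral_const_mul, integral_sub_right_eq_self (L.e m) r, L.integral_e,
    mul_one]

lemma card_reps (m : ℕ) : ((L.reps m).card : ℝ) = L.c ^ 2 * L.μ.real (L.B m) ^ 2 := by
  have h := L.integral_oneB_smul (m := m) (f := fun _ => (1 : ℂ)) (fun _ _ _ _ => rfl)
  simp only [smul_eq_mul, mul_one, L.integral_oneB, Finset.sum_const, nsmul_eq_mul] at h
  have h' : L.μ.real (L.B m) = L.μ.real (L.D m) * (L.reps m).card := by exact_mod_cast h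
  have hv := L.vol m
  have hD := (L.μD_pos m).ne'
  have : (L.c ^ 2 * L.μ.real (L.B m) ^ 2 - (L.reps m).card) * L.μ.real (L.D m) = 0 := by
    linear_combination (L.μ.real (L.B m)) * hv + h'
  exact (sub_eq_zero.1 ((mul_eq_zero.1 this).resolve_right hD)).symm

/-- On `B m` the phase and both orbits are invariant under `D m`, so the double integral is a sum
over cosets with weight `vol(D m) ^ 2`. By `vol` and `card_reps`, `c ^ 2 * vol(D m) ^ 2` is the
inverse of the number of cosets. -/
lemma fstar_eq_osc {m : ℕ} {a b : A} (ha : L.Fix α m a) (hb : L.Fix α m b) :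
    L.fstar α T m a b = ((L.c : ℂ) ^ 2) • L.osc α T (L.oneB m) (L.oneB m) a b := by
  have hn : ((L.reps m).card : ℂ) ≠ 0 := by exact_mod_cast (L.card_reps_pos m).ne'
  have e1 : ∀ X, L.oneB m X • (α.aut (T.θ X) a * L.twist α (AddMonoidHom.id V) (L.oneB m) X b) =
      L.oneB m X • ((L.μ.real (L.D m) : ℂ) • ∑ y ∈ L.reps m,
        (L.β y X : ℂ) • (α.aut (T.θ X) a * α.aut y b)) := fun X => by
    by_cases hX : X ∈ L.B m
    · simp only [L.oneB_of_mem hX, one_smul, twist, AddMonoidHom.id_apply, mul_smul]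
      rw [L.integral_oneB_smul (f := fun Y => (L.β Y X : ℂ) • α.aut Y b), mul_smul_comm,
        Finset.mul_sum]
      · simp only [mul_smul_comm]
      · intro Y hY W hW
        simp only [L.β_add_left, L.β_D_B hW hX, mul_one, hb.aut_add _ hW]
    · simp only [L.oneB_of_notMem hX, zero_smul]
  rw [L.osc_eq_left α T (L.amp_oneB m) (L.amp_oneB m)]
  simp_rw [e1]
  rw [L.integral_oneB_smul, fstar]
  · rw [← Finset.smul_sum, smul_smul, smul_smul]
    congr 1
    rw [inv_eq_iff_eq_inv]
    refine eq_inv_of_mul_eq_one_left ?_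
    have h1 := L.card_reps m
    have h2 : (((L.reps m).card : ℝ) : ℂ) = (L.c : ℂ) ^ 2 * (L.μ.real (L.B m) : ℂ) ^ 2 := by
      exact_mod_cast congrArg (fun x : ℝ => (x : ℂ)) h1
    have hv : (L.c : ℂ) ^ 2 * (L.μ.real (L.B m) : ℂ) * (L.μ.real (L.D m) : ℂ) = 1 := by
      exact_mod_cast congrArg (fun x : ℝ => (x : ℂ)) (L.vol m)
    rw [Complex.ofReal_natCast] at h2
    rw [h2]
    linear_combination ((L.c : ℂ) ^ 2 * (L.μ.real (L.B m) : ℂ) * (L.μ.real (L.D m) : ℂ) + 1) * hv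
  · intro X hX W hW
    simp only [Dilation.aut_map_add ha X hW, L.β_add_right]
    congr 1
    refine Finset.sum_congr rfl fun y hy => ?_
    rw [L.β_B_D (L.mem_B_of_reps hy) hW, mul_one]

/-- Passing to integrals makes the independence of the level visible: for elements fixed by `D m`
only the amplitudes on `B m` matter. -/
lemma fstar_eq_of_le {m k : ℕ} (h : m ≤ k) {a b : A} (ha : L.Fix α m a) (hb : L.Fix α m b) :
    L.fstar α T k a b = L.fstar α T m a b := by
  rw [L.fstar_eq_osc α T (ha.mono h) (hb.mono h), L.fstar_eq_osc α T ha hb]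
  congr 1
  have : ∀ X ∈ L.B m, L.oneB k X = L.oneB m X := fun X hX => by
    rw [L.oneB_of_mem hX, L.oneB_of_mem (L.B_mono h hX)]
  exact L.osc_congr_of_fix α T (L.amp_oneB k) (L.amp_oneB m) (L.amp_oneB k) (L.amp_oneB m)
    this this ha hb

end LatticeSystem

end

/-! ### The Fréchet topology and the product on the regular elements. -/

section

section Frechet

variable {E A : Type*} [AddCommGroup E] [Module ℂ E] [NormedAddCommGroup A] [NormedSpace ℂ A]
  (J : ℕ → E →ₗ[ℂ] A)

lemma tendsto_bilinear {ι : Type*} {l : Filter ι} (Φ : A →L[ℂ] A →L[ℂ] A) {f g : ι → A} {x y : A}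
    (hf : Tendsto f l (𝓝 x)) (hg : Tendsto g l (𝓝 y)) :
    Tendsto (fun i => Φ (f i) (g i)) l (𝓝 (Φ x y)) := by
  have h : Continuous fun q : A × A => Φ q.1 q.2 := by fun_prop
  exact (h.tendsto (x, y)).comp (hf.prodMk_nhds hg)

/-- The uniformity on `E` induced by a sequence of linear maps into `A`. -/
@[reducible] def inducedUnif : UniformSpace E := UniformSpace.comap (LinearMap.pi J) inferInstance

lemma tendsto_inducedUnif_iff {ι : Type*} {l : Filter ι} {f : ι → E} {a : E} :
    Tendsto f l (@nhds _ (inducedUnif J).toTopologicalSpace a) ↔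
      ∀ n, Tendsto (fun i => J n (f i)) l (𝓝 (J n a)) := by
  have : @nhds _ (inducedUnif J).toTopologicalSpace a =
      comap (LinearMap.pi J) (𝓝 (LinearMap.pi J a)) := nhds_induced _ _
  rw [this, tendsto_comap_iff, tendsto_pi_nhds]
  rfl

lemma continuous_inducedUnif (n : ℕ) :
    @Continuous _ _ (inducedUnif J).toTopologicalSpace _ (J n) :=
  letI := inducedUnif J
  continuous_iff_continuousAt.2 fun _ => (tendsto_inducedUnif_iff J).1 tendsto_id n

lemma continuous_of_bilinear {m : E →ₗ[ℂ] E →ₗ[ℂ] E} {Φ : ℕ → A →L[ℂ] A →L[ℂ] A} {k : ℕ → ℕ}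
    (hm : ∀ n a b, J n (m a b) = Φ n (J (k n) a) (J (k n) b)) :
    letI := inducedUnif J
    Continuous fun q : E × E => m q.1 q.2 := by
  let _ := inducedUnif J
  refine continuous_iff_continuousAt.2 fun q => (tendsto_inducedUnif_iff J).2 fun n => ?_
  simp only [hm]
  have h : Continuous fun q : E × E => Φ n (J (k n) q.1) (J (k n) q.2) :=
    ((Φ n).continuous.comp ((continuous_inducedUnif J _).comp continuous_fst)).clm_apply
      ((continuous_inducedUnif J _).comp continuous_snd)
  exact h.tendsto q

lemma withSeminorms_inducedUnif :
    letI := inducedUnif J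
    WithSeminorms (fun n => (normSeminorm ℂ A).comp (J n) : SeminormFamily ℂ E ℕ) := by
  let _ := inducedUnif J
  have : IsUniformAddGroup E := IsUniformAddGroup.comap (LinearMap.pi J)
  rw [SeminormFamily.withSeminorms_iff_nhds_eq_iInf]
  have h : 𝓝 (0 : E) = comap (LinearMap.pi J) (𝓝 (LinearMap.pi J 0)) := nhds_induced _ _
  rw [h, nhds_pi, Filter.pi, comap_iInf]
  refine iInf_congr fun n => ?_
  rw [comap_comap, map_zero, Pi.zero_apply, ← comap_norm_nhds_zero, comap_comap]
  rfl

/-- `E` is embedded in `ℕ → A`: closed range gives completeness, injectivity of `J 0` gives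
separation. Associativity is assumed only on the approximations `Q i` and extends by joint
continuity. -/
lemma isFrechetAlgebra_inducedUnif [CompleteSpace A] (hJ : Function.Injective (J 0))
    (hc : IsClosed (Set.range (LinearMap.pi J))) {m : E →ₗ[ℂ] E →ₗ[ℂ] E}
    {Φ : ℕ → A →L[ℂ] A →L[ℂ] A} {k : ℕ → ℕ}
    (hm : ∀ n a b, J n (m a b) = Φ n (J (k n) a) (J (k n) b)) {Q : ℕ → E → E}
    (hQ : ∀ n a, Tendsto (fun i => J n (Q i a)) atTop (𝓝 (J n a)))
    (hQm : ∀ i a b c, m (m (Q i a) (Q i b)) (Q i c) = m (Q i a) (m (Q i b) (Q i c))) :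
    IsFrechetAlgebra (inducedUnif J) (fun n => (normSeminorm ℂ A).comp (J n)) m := by
  let _ := inducedUnif J
  have hcont := continuous_of_bilinear J hm
  have hT : T2Space E := T2Space.of_injective_continuous hJ (continuous_inducedUnif J 0)
  have hQ' : ∀ a, Tendsto (fun i => Q i a) atTop (𝓝 a) := fun a =>
    (tendsto_inducedUnif_iff J).2 fun n => hQ n a
  have hmul : ∀ {f g : ℕ → E} {a b : E}, Tendsto f atTop (𝓝 a) → Tendsto g atTop (𝓝 b) →
      Tendsto (fun i => m (f i) (g i)) atTop (𝓝 (m a b)) := fun {f g a b} hf hg =>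
    (hcont.tendsto (a, b)).comp (hf.prodMk_nhds hg)
  refine ⟨IsUniformAddGroup.comap (LinearMap.pi J), withSeminorms_inducedUnif J, hT,
    IsUniformInducing.completeSpace (f := LinearMap.pi J) ⟨rfl⟩ hc.isComplete, hcont,
    fun a b c => ?_⟩
  refine tendsto_nhds_unique (hmul (hmul (hQ' a) (hQ' b)) (hQ' c)) ?_
  simp only [hQm]
  exact hmul (hQ' a) (hmul (hQ' b) (hQ' c))

end Frechet

namespace LatticeSystem

variable {V : Type*} [AddCommGroup V] [TopologicalSpace V] [MeasurableSpace V]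
  (L : LatticeSystem V) [IsTopologicalAddGroup V] [BorelSpace V] [SecondCountableTopology V]
  {A : Type*} [NonUnitalCStarAlgebra A] (α : ContinuousAction V A) (T : L.Dilation)

lemma Δ_M_pow {a : A} (ha : a ∈ L.regular α) (n j : ℕ) :
    L.Δ α j (L.M α (fun m => (L.q : ℂ) ^ (m * n)) a) = (L.q : ℂ) ^ (j * n) • L.Δ α j a :=
  L.Δ_M α (L.summable_of_mem α ha fun m => (L.norm_q_pow _).le) j

/-- The `n`-th power of the weight operator on the regular elements. -/
def J (n : ℕ) : L.regular α →ₗ[ℂ] A where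
  toFun a := L.M α (fun m => (L.q : ℂ) ^ (m * n)) a
  map_add' a b := L.eq_of_Δ_eq α fun m => by
    rw [L.Δ_M_pow α (a + b).2, map_add, L.Δ_M_pow α a.2, L.Δ_M_pow α b.2, Submodule.coe_add,
      map_add, smul_add]
  map_smul' z a := L.eq_of_Δ_eq α fun m => by
    rw [L.Δ_M_pow α (z • a).2, RingHom.id_apply, map_smul, L.Δ_M_pow α a.2, Submodule.coe_smul,
      map_smul, smul_comm]

lemma Δ_J (n j : ℕ) (a : L.regular α) :
    L.Δ α j (L.J α n a) = (L.q : ℂ) ^ (j * n) • L.Δ α j a := L.Δ_M_pow α a.2 n j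

lemma J_eq_iff {n : ℕ} {a : L.regular α} {b : A} :
    L.J α n a = b ↔ ∀ j, L.Δ α j b = (L.q : ℂ) ^ (j * n) • L.Δ α j a :=
  ⟨fun h j => by rw [← h, L.Δ_J], fun h => L.eq_of_Δ_eq α fun j => by rw [h, L.Δ_J]⟩

lemma J_zero (a : L.regular α) : L.J α 0 a = a := (L.J_eq_iff α).2 fun j => by simp

/-- The partial sums of the powers of the weight operator. -/
def JP (n t : ℕ) : A →L[ℂ] A := ∑ j ∈ Finset.range (t + 1), (L.q : ℂ) ^ (j * n) • L.Δ α j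

lemma JP_apply (n t : ℕ) (a : A) :
    L.JP α n t a = ∑ j ∈ Finset.range (t + 1), (L.q : ℂ) ^ (j * n) • L.Δ α j a := by
  simp [JP]

lemma JP_zero (t : ℕ) (a : A) : L.JP α 0 t a = L.P α t a := by
  rw [JP_apply, ← L.sum_Δ]; simp

lemma Δ_JP (n t j : ℕ) (a : A) :
    L.Δ α j (L.JP α n t a) = (L.q : ℂ) ^ (j * n) • L.Δ α j (L.JP α 0 t a) := by
  simp only [JP_apply, map_sum, map_smul, Finset.smul_sum, mul_zero, pow_zero, one_smul]
  refine Finset.sum_congr rfl fun i _ => ?_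
  by_cases h : j = i
  · rw [h]
  · rw [L.Δ_Δ_of_ne α h, smul_zero, smul_zero]

/-- For `j ≤ t` one has `q ^ (j n) ≤ q ^ (-j) * q ^ (t (n + 1))`; the spare factor `q ^ (-j)` makes
the sum bounded uniformly in `t`. -/
lemma norm_JP_le (n t : ℕ) (a : A) :
    ‖L.JP α n t a‖ ≤ 2 * (∑' j : ℕ, (L.q⁻¹) ^ j) * L.q ^ (t * (n + 1)) * ‖a‖ := by
  have h1 : ∀ j ∈ Finset.range (t + 1), ‖(L.q : ℂ) ^ (j * n) • L.Δ α j a‖ ≤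
      (L.q⁻¹) ^ j * (L.q ^ (t * (n + 1)) * (2 * ‖a‖)) := by
    intro j hj
    rw [norm_smul, L.norm_q_pow, ← mul_assoc]
    refine mul_le_mul ?_ (L.norm_Δ_le α j a) (norm_nonneg _)
      (mul_nonneg (pow_nonneg (inv_nonneg.2 L.q_pos.le) _) (pow_nonneg L.q_pos.le _))
    rw [inv_pow, ← div_eq_inv_mul, le_div_iff₀ (pow_pos L.q_pos j), ← pow_add]
    refine pow_le_pow_right₀ L.one_lt_q.le ?_
    have : j ≤ t := Nat.lt_succ_iff.1 (Finset.mem_range.1 hj)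
    calc j * n + j = j * (n + 1) := by ring
      _ ≤ t * (n + 1) := Nat.mul_le_mul_right _ this
  rw [JP_apply]
  refine (norm_sum_le_of_le _ h1).trans ?_
  rw [← Finset.sum_mul]
  have h2 : ∑ j ∈ Finset.range (t + 1), (L.q⁻¹) ^ j ≤ ∑' j : ℕ, (L.q⁻¹) ^ j :=
    L.summable_q.sum_le_tsum _ fun j _ => pow_nonneg (inv_nonneg.2 L.q_pos.le) _
  calc (∑ j ∈ Finset.range (t + 1), (L.q⁻¹) ^ j) * (L.q ^ (t * (n + 1)) * (2 * ‖a‖))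
      ≤ (∑' j : ℕ, (L.q⁻¹) ^ j) * (L.q ^ (t * (n + 1)) * (2 * ‖a‖)) :=
        mul_le_mul_of_nonneg_right h2 (mul_nonneg (pow_nonneg L.q_pos.le _) (by positivity))
    _ = _ := by ring

/-- The order of the weight operators that control the `n`-th seminorm of a product. -/
def ord (n : ℕ) : ℕ := n + 2 + 2 * L.s

/-- The dyadic pieces of the bilinear map that represents the deformed product. -/
def piece (n : ℕ) (p : ℕ × ℕ) : A →L[ℂ] A →L[ℂ] A :=
  ((L.q : ℂ) ^ (L.ord n * (p.1 + p.2)))⁻¹ •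
    (((ContinuousLinearMap.compL ℂ A A A (L.JP α n (p.1 + p.2))).comp
      (L.fstarL α T (p.1 + p.2))).bilinearComp (L.Δ α p.1) (L.Δ α p.2))

lemma piece_apply (n : ℕ) (p : ℕ × ℕ) (x y : A) : L.piece α T n p x y =
    ((L.q : ℂ) ^ (L.ord n * (p.1 + p.2)))⁻¹ •
      L.JP α n (p.1 + p.2) (L.fstar α T (p.1 + p.2) (L.Δ α p.1 x) (L.Δ α p.2 y)) := rfl

lemma card_reps_eq (m : ℕ) :
    ((L.reps m).card : ℝ) = L.c ^ 2 * L.μ.real (L.B 0) ^ 2 * (L.q ^ (L.s * m)) ^ 2 := by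
  rw [L.card_reps, L.growth m]; ring

/-- Geometric decay in both block indices, with a constant independent of them; this is what makes
the double series of blocks converge in operator norm. -/
lemma norm_piece_apply_le (n : ℕ) (p : ℕ × ℕ) (x y : A) : ‖L.piece α T n p x y‖ ≤
    8 * (∑' j : ℕ, (L.q⁻¹) ^ j) * (L.c ^ 2 * L.μ.real (L.B 0) ^ 2) *
      ((L.q⁻¹) ^ p.1 * (L.q⁻¹) ^ p.2) * ‖x‖ * ‖y‖ := by
  rw [piece_apply, norm_smul, norm_inv, L.norm_q_pow, ← pow_add]
  obtain ⟨t, ht⟩ : ∃ t, t = p.1 + p.2 := ⟨_, rfl⟩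
  obtain ⟨C, hC⟩ : ∃ C, C = ∑' j : ℕ, (L.q⁻¹) ^ j := ⟨_, rfl⟩
  have hC0 : 0 ≤ C := hC ▸ tsum_nonneg fun j => pow_nonneg (inv_nonneg.2 L.q_pos.le) _
  have hq : 0 < L.q := L.q_pos
  have h1 := L.norm_JP_le α n t (L.fstar α T t (L.Δ α p.1 x) (L.Δ α p.2 y))
  have h2 := L.norm_fstar_le α T t (L.Δ α p.1 x) (L.Δ α p.2 y)
  rw [L.card_reps_eq] at h2
  have h3 : ‖L.Δ α p.1 x‖ * ‖L.Δ α p.2 y‖ ≤ (2 * ‖x‖) * (2 * ‖y‖) :=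
    mul_le_mul (L.norm_Δ_le α _ x) (L.norm_Δ_le α _ y) (norm_nonneg _) (by positivity)
  -- The exponent `ord n = n + 2 + 2s` is spent as follows: `n + 1` on the norm of `JP n t`, `2s` on
  -- the number of cosets, and `1` on the remaining geometric series.
  have h4 : L.q ^ (L.ord n * t) = L.q ^ (t * (n + 1)) * (L.q ^ (L.s * t)) ^ 2 * L.q ^ t := by
    rw [ord]; ring
  rw [← ht, ← hC]
  rw [← hC] at h1
  have hv : 0 ≤ L.c ^ 2 * L.μ.real (L.B 0) ^ 2 := by positivity
  generalize L.c ^ 2 * L.μ.real (L.B 0) ^ 2 = v at h2 hv ⊢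
  calc (L.q ^ (L.ord n * t))⁻¹ * ‖L.JP α n t (L.fstar α T t (L.Δ α p.1 x) (L.Δ α p.2 y))‖
      ≤ (L.q ^ (L.ord n * t))⁻¹ * (2 * C * L.q ^ (t * (n + 1)) *
        (v * (L.q ^ (L.s * t)) ^ 2 * ((2 * ‖x‖) * (2 * ‖y‖)))) := by
        refine mul_le_mul_of_nonneg_left (h1.trans ?_) (by positivity)
        refine mul_le_mul_of_nonneg_left (h2.trans ?_) (by positivity)
        exact mul_le_mul_of_nonneg_left h3 (by positivity)
    _ = 8 * C * v * (L.q⁻¹) ^ t * ‖x‖ * ‖y‖ := by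
        rw [h4, inv_pow]
        field_simp
        ring

lemma summable_q_mul_q : Summable fun p : ℕ × ℕ => (L.q⁻¹) ^ p.1 * (L.q⁻¹) ^ p.2 := by
  have h0 : ∀ j : ℕ, 0 ≤ (L.q⁻¹) ^ j := fun j => pow_nonneg (inv_nonneg.2 L.q_pos.le) _
  exact Summable.mul_of_nonneg (f := fun j => (L.q⁻¹) ^ j) (g := fun j => (L.q⁻¹) ^ j)
    L.summable_q L.summable_q h0 h0

lemma summable_piece (n : ℕ) (x y : A) : Summable fun p => L.piece α T n p x y :=
  Summable.of_norm_bounded (((L.summable_q_mul_q.mul_left _).mul_right ‖x‖).mul_right ‖y‖)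
    fun p => L.norm_piece_apply_le α T n p x y

/-- The bounded bilinear map `Φ` with `J ^ n (a ⋆ b) = Φ (J ^ N a) (J ^ N b)`. -/
def Φ (n : ℕ) : A →L[ℂ] A →L[ℂ] A :=
  LinearMap.mkContinuous₂
    (LinearMap.mk₂ ℂ (fun x y => ∑' p, L.piece α T n p x y)
      (fun x x' y => by
        rw [← (L.summable_piece α T n x y).tsum_add (L.summable_piece α T n x' y)]
        simp only [map_add, add_apply])
      (fun z x y => by
        rw [← (L.summable_piece α T n x y).tsum_const_smul]
        simp only [map_smul, smul_apply])
      (fun x y y' => by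
        rw [← (L.summable_piece α T n x y).tsum_add (L.summable_piece α T n x y')]
        simp only [map_add])
      (fun z x y => by
        rw [← (L.summable_piece α T n x y).tsum_const_smul]
        simp only [map_smul]))
    (8 * (∑' j : ℕ, (L.q⁻¹) ^ j) * (L.c ^ 2 * L.μ.real (L.B 0) ^ 2) *
      ∑' p : ℕ × ℕ, (L.q⁻¹) ^ p.1 * (L.q⁻¹) ^ p.2)
    (fun x y => tsum_of_norm_bounded
      (((L.summable_q_mul_q.hasSum.mul_left _).mul_right ‖x‖).mul_right ‖y‖)
      fun p => L.norm_piece_apply_le α T n p x y)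

lemma hasSum_Φ (n : ℕ) (a b : L.regular α) :
    HasSum (fun p : ℕ × ℕ => L.JP α n (p.1 + p.2)
      (L.fstar α T (p.1 + p.2) (L.Δ α p.1 a) (L.Δ α p.2 b)))
      (L.Φ α T n (L.J α (L.ord n) a) (L.J α (L.ord n) b)) := by
  refine (L.summable_piece α T n (L.J α (L.ord n) a) (L.J α (L.ord n) b)).hasSum.congr_fun
    fun p => ?_
  rw [piece_apply, L.Δ_J, L.Δ_J, ← L.fstarL_apply, ← L.fstarL_apply]
  simp only [map_smul, smul_apply, smul_smul]
  have : (L.q : ℂ) ^ (L.ord n * (p.1 + p.2)) ≠ 0 := pow_ne_zero _ L.q_ne_zero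
  rw [← pow_add, show p.2 * L.ord n + p.1 * L.ord n = L.ord n * (p.1 + p.2) by ring,
    inv_mul_cancel₀ this, one_smul]

/-- Each term of the series for `Φ n` has blocks `q ^ (j n)` times those of the corresponding term
for `Φ 0`. So the value of `Φ n` witnesses regularity of the product at order `n`. -/
lemma Δ_Φ (n j : ℕ) (a b : L.regular α) :
    L.Δ α j (L.Φ α T n (L.J α (L.ord n) a) (L.J α (L.ord n) b)) =
      (L.q : ℂ) ^ (j * n) • L.Δ α j (L.Φ α T 0 (L.J α (L.ord 0) a) (L.J α (L.ord 0) b)) := by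
  have h1 := (L.hasSum_Φ α T n a b).mapL (L.Δ α j)
  have h2 := ((L.hasSum_Φ α T 0 a b).mapL (L.Δ α j)).const_smul ((L.q : ℂ) ^ (j * n))
  simp only [← L.Δ_JP] at h2
  exact h1.unique h2

/-- The deformed product of regular elements. -/
def prod : L.regular α →ₗ[ℂ] L.regular α →ₗ[ℂ] L.regular α :=
  LinearMap.mk₂ ℂ
    (fun a b => ⟨L.Φ α T 0 (L.J α (L.ord 0) a) (L.J α (L.ord 0) b),
      fun n => ⟨_, fun m => L.Δ_Φ α T n m a b⟩⟩)
    (fun a a' b => Subtype.ext (by simp))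
    (fun z a b => Subtype.ext (by simp))
    (fun a b b' => Subtype.ext (by simp))
    (fun z a b => Subtype.ext (by simp))

lemma coe_prod (a b : L.regular α) :
    (L.prod α T a b : A) = L.Φ α T 0 (L.J α (L.ord 0) a) (L.J α (L.ord 0) b) := rfl

lemma J_prod (n : ℕ) (a b : L.regular α) :
    L.J α n (L.prod α T a b) = L.Φ α T n (L.J α (L.ord n) a) (L.J α (L.ord n) b) :=
  (L.J_eq_iff α).2 fun j => L.Δ_Φ α T n j a b

variable {L α} in
lemma Fix.mem_regular {i : ℕ} {a : A} (ha : L.Fix α i a) : a ∈ L.regular α := fun n => by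
  refine ⟨L.JP α n i a, fun m => ?_⟩
  rw [L.Δ_JP, L.JP_zero, L.P_of_fixed α ha]

variable {L α} in
lemma Fix.Δ_eq_zero {i m : ℕ} (h : i < m) {a : A} (ha : L.Fix α i a) : L.Δ α m a = 0 := by
  rw [← L.P_of_fixed α ha, L.Δ_P_of_lt α h]

/-- Blocks beyond `i` vanish, so the double series is a finite sum. The terms are formed at level
`p.1 + p.2`, and independence of the level brings them all to level `i`. -/
lemma prod_of_fix {i : ℕ} {a b : L.regular α} (ha : L.Fix α i (a : A)) (hb : L.Fix α i (b : A)) :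
    (L.prod α T a b : A) = L.fstar α T i a b := by
  have h := L.hasSum_Φ α T 0 a b
  rw [coe_prod]
  refine h.unique ?_
  have e : L.fstar α T i a b = ∑ p ∈ Finset.range (i + 1) ×ˢ Finset.range (i + 1),
      L.fstar α T i (L.Δ α p.1 a) (L.Δ α p.2 b) := by
    rw [Finset.sum_product]
    nth_rewrite 1 [← L.P_of_fixed α ha, ← L.P_of_fixed α hb, ← L.sum_Δ, ← L.sum_Δ]
    simp only [← L.fstarL_apply, map_sum, sum_apply]
    rw [Finset.sum_comm]
  rw [e]
  have hterm : ∀ p : ℕ × ℕ, L.JP α 0 (p.1 + p.2)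
      (L.fstar α T (p.1 + p.2) (L.Δ α p.1 a) (L.Δ α p.2 b)) =
      L.fstar α T (p.1 + p.2) (L.Δ α p.1 a) (L.Δ α p.2 b) := fun p => by
    rw [L.JP_zero]
    exact L.P_of_fixed α (L.fix_fstar α T (L.fix_Δ α (Nat.le_add_right _ _) _)
      (L.fix_Δ α (Nat.le_add_left _ _) _))
  have hz : ∀ p ∉ Finset.range (i + 1) ×ˢ Finset.range (i + 1), L.JP α 0 (p.1 + p.2)
      (L.fstar α T (p.1 + p.2) (L.Δ α p.1 a) (L.Δ α p.2 b)) = 0 := fun p hp => by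
    rw [hterm, ← L.fstarL_apply]
    rw [Finset.mem_product, not_and_or, Finset.mem_range, Finset.mem_range] at hp
    rcases hp with hp | hp
    · rw [ha.Δ_eq_zero (by omega), map_zero, zero_apply]
    · rw [hb.Δ_eq_zero (by omega), map_zero]
  have : HasSum (fun p : ℕ × ℕ => L.JP α 0 (p.1 + p.2)
      (L.fstar α T (p.1 + p.2) (L.Δ α p.1 a) (L.Δ α p.2 b))) _ := hasSum_sum_of_ne_finset_zero hz
  convert! this using 1
  refine Finset.sum_congr rfl fun p hp => ?_
  rw [hterm]
  rw [Finset.mem_product, Finset.mem_range, Finset.mem_range] at hp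
  have h1 : L.Fix α (max p.1 p.2) (L.Δ α p.1 (a : A)) := L.fix_Δ α (le_max_left _ _) _
  have h2 : L.Fix α (max p.1 p.2) (L.Δ α p.2 (b : A)) := L.fix_Δ α (le_max_right _ _) _
  rw [L.fstar_eq_of_le α T (show max p.1 p.2 ≤ p.1 + p.2 by omega) h1 h2,
    L.fstar_eq_of_le α T (show max p.1 p.2 ≤ i by omega) h1 h2]

/-- The averaging operator on the regular elements. -/
def PR (i : ℕ) (a : L.regular α) : L.regular α := ⟨L.P α i a, (L.fix_P α (le_refl i) _).mem_regular⟩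

lemma coe_PR (i : ℕ) (a : L.regular α) : (L.PR α i a : A) = L.P α i a := rfl

lemma J_PR (n i : ℕ) (a : L.regular α) : L.J α n (L.PR α i a) = L.P α i (L.J α n a) :=
  (L.J_eq_iff α).2 fun j => by
    rw [L.Δ_P_comm, L.Δ_J, map_smul, coe_PR, L.Δ_P_comm]

lemma tendsto_J_PR (n : ℕ) (a : L.regular α) :
    Tendsto (fun i => L.J α n (L.PR α i a)) atTop (𝓝 (L.J α n a)) := by
  simp only [L.J_PR]
  exact L.tendsto_P α _

lemma fix_PR (i : ℕ) (a : L.regular α) : L.Fix α i (L.PR α i a : A) := L.fix_P α le_rfl _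

/-- The averages converge in every seminorm and the product is continuous, so every identity proved
for the finite sums passes to the limit. -/
lemma tendsto_fstar_P (a b : L.regular α) :
    Tendsto (fun i => L.fstar α T i (L.P α i a) (L.P α i b)) atTop (𝓝 (L.prod α T a b : A)) := by
  have h : Tendsto (fun i => L.Φ α T 0 (L.J α (L.ord 0) (L.PR α i a))
      (L.J α (L.ord 0) (L.PR α i b))) atTop (𝓝 (L.prod α T a b : A)) :=
    tendsto_bilinear (L.Φ α T 0) (L.tendsto_J_PR α _ a) (L.tendsto_J_PR α _ b)
  refine h.congr fun i => ?_
  rw [← coe_prod, L.prod_of_fix α T (L.fix_PR α i a) (L.fix_PR α i b)]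
  rfl

lemma prod_PR_assoc (i : ℕ) (a b c : L.regular α) :
    L.prod α T (L.prod α T (L.PR α i a) (L.PR α i b)) (L.PR α i c) =
      L.prod α T (L.PR α i a) (L.prod α T (L.PR α i b) (L.PR α i c)) := by
  have hf : ∀ x : L.regular α, L.Fix α i (L.PR α i x : A) := L.fix_PR α i
  have hp : ∀ x y : L.regular α, L.Fix α i (L.prod α T (L.PR α i x) (L.PR α i y) : A) :=
    fun x y => by
      rw [L.prod_of_fix α T (hf x) (hf y)]
      exact L.fix_fstar α T (hf x) (hf y)
  refine Subtype.ext ?_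
  rw [L.prod_of_fix α T (hf a) (hp b c), L.prod_of_fix α T (hf b) (hf c),
    L.prod_of_fix α T (hp a b) (hf c), L.prod_of_fix α T (hf a) (hf b),
    L.fstar_assoc α T (hf a) (hf b) (hf c)]

lemma isClosed_range_J : IsClosed (Set.range (LinearMap.pi (L.J α))) := by
  have : Set.range (LinearMap.pi (L.J α)) =
      ⋂ n, ⋂ j, {x : ℕ → A | L.Δ α j (x n) = (L.q : ℂ) ^ (j * n) • L.Δ α j (x 0)} := by
    ext x
    simp only [Set.mem_iInter]
    constructor
    · rintro ⟨a, rfl⟩ n j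
      change L.Δ α j (L.J α n a) = _ • L.Δ α j (L.J α 0 a)
      rw [L.J_zero, L.Δ_J]
    · intro h
      exact ⟨⟨x 0, fun n => ⟨x n, h n⟩⟩, funext fun n => (L.J_eq_iff α).2 (h n)⟩
  rw [this]
  exact isClosed_iInter fun n => isClosed_iInter fun j => isClosed_eq (by fun_prop) (by fun_prop)

lemma isFrechetAlgebra_regular :
    IsFrechetAlgebra (inducedUnif (L.J α)) (fun n => (normSeminorm ℂ A).comp (L.J α n))
      (L.prod α T) :=
  isFrechetAlgebra_inducedUnif (L.J α)
    (fun a b h => Subtype.ext (by rwa [L.J_zero, L.J_zero] at h)) (L.isClosed_range_J α)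
    (L.J_prod α T) (L.tendsto_J_PR α) (L.prod_PR_assoc α T)

end LatticeSystem

end

/-! ### The product as an absolutely convergent integral; automorphisms and involution. -/

section

namespace LatticeSystem

variable {V : Type*} [AddCommGroup V] [TopologicalSpace V] [MeasurableSpace V]
  (L : LatticeSystem V) [IsTopologicalAddGroup V] [BorelSpace V] [SecondCountableTopology V]
  {A : Type*} [NonUnitalCStarAlgebra A] (α : ContinuousAction V A) (T : L.Dilation)

/-- The amplitude `w ^ {-(s+1)}`. -/
def amp (X : V) : ℂ := (((L.w X ^ (L.s + 1))⁻¹ : ℝ) : ℂ)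

lemma amp_of_mem {m : ℕ} {X : V} (hX : X ∈ L.shell m) :
    L.amp X = ((L.q : ℂ) ^ (m * (L.s + 1)))⁻¹ := by
  rw [amp, L.w_eq hX, ← pow_mul]; push_cast; rfl

lemma amp_add (X W : V) (hW : W ∈ L.B 0) : L.amp (X + W) = L.amp X := by
  rw [amp, amp, L.w_add X hW]

lemma norm_amp_of_mem {m : ℕ} {X : V} (hX : X ∈ L.shell m) :
    ‖L.amp X‖ = (L.q ^ (m * (L.s + 1)))⁻¹ := by
  rw [L.amp_of_mem hX, norm_inv, L.norm_q_pow]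

lemma measurableSet_shell (m : ℕ) : MeasurableSet (L.shell m) := by
  have : L.shell m = L.oneS m ⁻¹' {1} := by
    ext X
    by_cases h : X ∈ L.shell m
    · simp [h, L.oneS_of_mem h]
    · simp [h, L.oneS_of_notMem h]
  rw [this]
  have hc : Continuous (L.oneS m) := by
    cases m with
    | zero => exact (L.level_oneB le_rfl).continuous L
    | succ m =>
      exact ((L.level_oneB le_rfl).continuous L).sub ((L.level_oneB le_rfl).continuous L)
  exact hc.measurable (measurableSet_singleton 1)

/-- The `m`-th shell has volume at most a constant times `q ^ (s m)` and the amplitude there is `q ^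
(-m (s + 1))`, which leaves a geometric series. This is why the exponent is `s + 1`. -/
lemma amp_amp : L.Amp L.amp := by
  refine ⟨?_, L.amp_add⟩
  have hc : Continuous L.amp :=
    (L.locConst_of_inv (m := 0) fun X W hW => L.amp_add X W (L.D_le_B_zero hW)).continuous
  have hU : (⋃ m, L.shell m) = Set.univ :=
    Set.eq_univ_of_forall fun X => Set.mem_iUnion.2 (L.exists_mem_shell X)
  have hfin : ∀ m, L.μ (L.shell m) ≠ ∞ := fun m =>
    ((measure_mono fun X hX => L.shell_subset_B le_rfl hX).trans_lt
      (L.B_compact m).measure_lt_top).ne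
  rw [← integrableOn_univ, ← hU]
  refine integrableOn_iUnion_of_summable_integral_norm (fun m => ?_) ?_
  · refine Measure.integrableOn_of_bounded (M := (L.q ^ (m * (L.s + 1)))⁻¹) (hfin m)
      hc.aestronglyMeasurable ?_
    exact (ae_restrict_iff' (L.measurableSet_shell m)).2
      (.of_forall fun X hX => (L.norm_amp_of_mem hX).le)
  · refine Summable.of_nonneg_of_le (fun m => integral_nonneg fun X => norm_nonneg _) (fun m => ?_)
      (L.summable_q.mul_left (L.μ.real (L.B 0)))
    rw [setIntegral_congr_fun (L.measurableSet_shell m) fun X hX => L.norm_amp_of_mem hX,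
      setIntegral_const, smul_eq_mul]
    have h1 : L.μ.real (L.shell m) ≤ L.q ^ (L.s * m) * L.μ.real (L.B 0) := by
      rw [← L.growth]
      exact measureReal_mono (fun X hX => L.shell_subset_B le_rfl hX)
        (L.B_compact m).measure_lt_top.ne
    have hq := L.q_pos
    calc L.μ.real (L.shell m) * (L.q ^ (m * (L.s + 1)))⁻¹
        ≤ (L.q ^ (L.s * m) * L.μ.real (L.B 0)) * (L.q ^ (m * (L.s + 1)))⁻¹ :=
          mul_le_mul_of_nonneg_right h1 (by positivity)
      _ = L.μ.real (L.B 0) * L.q⁻¹ ^ m := by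
          rw [show L.q ^ (m * (L.s + 1)) = L.q ^ (L.s * m) * L.q ^ m by ring, inv_pow]
          field_simp

lemma osc_sum {g h : V → ℂ} (hg : Integrable g L.μ) (hh : Integrable h L.μ) {ι : Type*}
    (s : Finset ι) (a b : ι → A) : L.osc α T g h (∑ i ∈ s, a i) (∑ k ∈ s, b k) =
      ∑ i ∈ s, ∑ k ∈ s, L.osc α T g h (a i) (b k) := by
  have hi := fun i k => L.integrable_osc α T hg hh (a i) (b k)
  simp only [osc]
  rw [Finset.sum_congr rfl fun i _ => (integral_finsetSum s fun k _ => hi i k).symm,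
    ← integral_finsetSum s fun i _ => integrable_finsetSum s fun k _ => hi i k]
  refine integral_congr_ae (.of_forall fun p => ?_)
  simp only [map_sum, Finset.sum_mul, Finset.mul_sum, Finset.smul_sum]
  rw [Finset.sum_comm]

lemma osc_smul (g h : V → ℂ) (z z' : ℂ) (a b : A) :
    L.osc α T g h (z • a) (z' • b) = (z * z') • L.osc α T g h a b := by
  simp only [osc]
  rw [← integral_smul]
  refine integral_congr_ae (.of_forall fun p => ?_)
  simp only [map_smul, smul_mul_assoc, mul_smul_comm, smul_smul]
  congr 1
  ring

lemma osc_const_mul (g h : V → ℂ) (z z' : ℂ) (a b : A) :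
    L.osc α T (fun X => z * g X) (fun X => z' * h X) a b = (z * z') • L.osc α T g h a b := by
  simp only [osc]
  rw [← integral_smul]
  refine integral_congr_ae (.of_forall fun p => ?_)
  simp only [smul_smul]
  congr 1
  ring

lemma tendsto_osc {g h : V → ℂ} (hg : Integrable g L.μ) (hh : Integrable h L.μ) (x y : A) :
    Tendsto (fun i => L.osc α T g h (L.P α i x) (L.P α i y)) atTop (𝓝 (L.osc α T g h x y)) := by
  refine tendsto_integral_of_dominated_convergence (fun p => ‖g p.1 * h p.2‖ * (‖x‖ * ‖y‖))
    (fun i => L.aestronglyMeasurable_osc α T hg hh _ _) ((hg.mul_prod hh).norm.mul_const _)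
    (fun i => .of_forall fun p => ?_) (.of_forall fun p => ?_)
  · refine (L.norm_osc_integrand_le α T g h _ _ p).trans ?_
    exact mul_le_mul_of_nonneg_left (mul_le_mul (L.norm_P_le α i x) (L.norm_P_le α i y)
      (norm_nonneg _) (norm_nonneg _)) (norm_nonneg _)
  · refine Tendsto.const_smul (Tendsto.mul ?_ ?_) _
    · exact ((α.autL (T.θ p.1)).continuous.tendsto x).comp (L.tendsto_P α x)
    · exact ((α.autL p.2).continuous.tendsto y).comp (L.tendsto_P α y)

/-- The oscillatory integral with the amplitudes `w ^ {-(s+1)}` gives the deformed product. -/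
lemma osc_eq_prod (a b : L.regular α) {x : A}
    (hx : ∀ m, L.Δ α m x = (L.q : ℂ) ^ (T.j m * (L.s + 1)) • L.Δ α m a) :
    ((L.c : ℂ) ^ 2) • L.osc α T L.amp L.amp x (L.J α (L.s + 1) b) = L.prod α T a b := by
  have hA := L.amp_amp
  refine tendsto_nhds_unique ((L.tendsto_osc α T hA.1 hA.1 x _).const_smul _)
    ((L.tendsto_fstar_P α T a b).congr fun i => ?_)
  rw [L.fstar_eq_osc α T (L.fix_P α le_rfl _) (L.fix_P α le_rfl _)]
  congr 1
  simp only [← L.sum_Δ]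
  rw [L.osc_sum α T (L.amp_oneB i).1 (L.amp_oneB i).1, L.osc_sum α T hA.1 hA.1]
  refine Finset.sum_congr rfl fun m hm => Finset.sum_congr rfl fun k hk => ?_
  have hm' : m ≤ i := Nat.lt_succ_iff.1 (Finset.mem_range.1 hm)
  have hk' : k ≤ i := Nat.lt_succ_iff.1 (Finset.mem_range.1 hk)
  have hO := L.amp_oneB i
  -- On this pair of blocks the amplitude may be replaced by its constant value times `oneB i`: `q ^
  -- (-k (s + 1))` in `X` and `q ^ (-j m (s + 1))` in `Y`. The two constants cancel the scalars from
  -- the blocks of `J (s + 1) b` and of `x`.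
  rw [hx, L.Δ_J, L.osc_smul, L.osc_congr_of_shell α T hA (hO.const_mul _) hA (hO.const_mul _)
    (fun X hX => by rw [L.amp_of_mem hX, L.oneB_of_mem (L.shell_subset_B hk' hX), mul_one])
    (fun X hX => by
      rw [L.amp_of_mem hX, L.oneB_of_mem (L.shell_subset_B ((T.j_le m).trans hm') hX), mul_one]),
    L.osc_const_mul, smul_smul]
  have h1 : (L.q : ℂ) ^ (T.j m * (L.s + 1)) ≠ 0 := pow_ne_zero _ L.q_ne_zero
  have h2 : (L.q : ℂ) ^ (k * (L.s + 1)) ≠ 0 := pow_ne_zero _ L.q_ne_zero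
  rw [mul_comm ((L.q : ℂ) ^ (k * (L.s + 1)))⁻¹, ← mul_inv, mul_inv_cancel₀ (mul_ne_zero h1 h2),
    one_smul]

lemma aut_mem_regular (X : V) {a : A} (ha : a ∈ L.regular α) : α.aut X a ∈ L.regular α :=
  fun n => by
    obtain ⟨b, hb⟩ := ha n
    exact ⟨α.aut X b, fun m => by rw [← L.aut_Δ, hb, map_smul, L.aut_Δ]⟩

lemma star_mem_regular {a : A} (ha : a ∈ L.regular α) : star a ∈ L.regular α := fun n => by
  obtain ⟨b, hb⟩ := ha n
  refine ⟨star b, fun m => ?_⟩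
  rw [← L.star_Δ, hb, star_smul, L.star_Δ, star_pow]
  simp

/-- The automorphism of the space of regular elements attached to `X`. -/
def autR (X : V) : L.regular α ≃ₗ[ℂ] L.regular α where
  toFun a := ⟨α.aut X a, L.aut_mem_regular α X a.2⟩
  map_add' a b := Subtype.ext (by simp)
  map_smul' z a := Subtype.ext (by simp)
  invFun a := ⟨α.aut (-X) a, L.aut_mem_regular α (-X) a.2⟩
  left_inv a := Subtype.ext (α.aut_neg_aut X a)
  right_inv a := Subtype.ext (by
    have := α.aut_neg_aut (-X) a
    rwa [neg_neg] at this)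

lemma coe_autR (X : V) (a : L.regular α) : (L.autR α X a : A) = α.aut X a := rfl

lemma J_autR (n : ℕ) (X : V) (a : L.regular α) :
    L.J α n (L.autR α X a) = α.aut X (L.J α n a) :=
  (L.J_eq_iff α).2 fun j => by rw [← L.aut_Δ, L.Δ_J, map_smul, L.aut_Δ]; rfl

lemma autR_prod (X : V) (a b : L.regular α) :
    L.autR α X (L.prod α T a b) = L.prod α T (L.autR α X a) (L.autR α X b) := by
  refine Subtype.ext (tendsto_nhds_unique
    (((α.autL X).continuous.tendsto _).comp (L.tendsto_fstar_P α T a b))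
    ((L.tendsto_fstar_P α T (L.autR α X a) (L.autR α X b)).congr fun i => ?_))
  rw [coe_autR, coe_autR, Function.comp_apply, α.autL_apply, L.aut_fstar, L.aut_P, L.aut_P]

/-- The involution of the space of regular elements. -/
def starR (a : L.regular α) : L.regular α := ⟨star (a : A), L.star_mem_regular α a.2⟩

lemma J_starR (n : ℕ) (a : L.regular α) : L.J α n (L.starR α a) = star (L.J α n a) :=
  (L.J_eq_iff α).2 fun j => by
    rw [← L.star_Δ, L.Δ_J, star_smul, L.star_Δ, star_pow]
    simp [starR]

lemma starR_prod (a b : L.regular α) :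
    L.starR α (L.prod α T a b) = L.prod α T (L.starR α b) (L.starR α a) := by
  refine Subtype.ext (tendsto_nhds_unique
    ((continuous_star.tendsto _).comp (L.tendsto_fstar_P α T a b))
    ((L.tendsto_fstar_P α T (L.starR α b) (L.starR α a)).congr fun i => ?_))
  change L.fstar α T i (L.P α i (star (b : A))) (L.P α i (star (a : A))) = star _
  rw [L.star_fstar α T (L.fix_P α le_rfl _) (L.fix_P α le_rfl _), L.star_P, L.star_P]

end LatticeSystem

end

/-! ### Absolute value, ideals and Haar measure of a local field. -/

section

section LocalField

open ValuativeRel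

variable {K : Type*} [Field K] [ValuativeRel K] [TopologicalSpace K]
  [IsNonarchimedeanLocalField K]

/-- The rank one valuation makes `K` a proper normed field. Second countability yields strong
measurability of continuous orbit maps although `A` need not be separable. -/
instance secondCountableTopology_localField : SecondCountableTopology K := by
  let := IsTopologicalAddGroup.rightUniformSpace K
  have := isUniformAddGroup_of_addCommGroup (G := K)
  let : (Valued.v (R := K)).RankOne :=
  { hom' := IsRankLeOne.nonempty.some.emb (R := K).comp MonoidWithZeroHom.ValueGroup₀.embedding
    strictMono' := IsRankLeOne.nonempty.some.strictMono.comp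
        MonoidWithZeroHom.ValueGroup₀.embedding_strictMono }
  open scoped Valued in
  have : ProperSpace K := .of_nontriviallyNormedField_of_weaklyLocallyCompactSpace K
  exact secondCountable_of_proper

instance t2Space_localField : T2Space K := by
  let := IsTopologicalAddGroup.rightUniformSpace K
  have := isUniformAddGroup_of_addCommGroup (G := K)
  infer_instance

/-- The fractional ideal `t 𝒪`. -/
def idealBall (t : K) : AddSubgroup K := (𝒪[K]).toAddSubgroup.map (AddMonoidHom.mulLeft t)

lemma mem_idealBall {t x : K} : x ∈ idealBall t ↔ ∃ y ∈ 𝒪[K], t * y = x := Iff.rfl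

lemma mul_mem_idealBall (t : K) {y : K} (hy : y ∈ 𝒪[K]) : t * y ∈ idealBall t :=
  ⟨y, hy, rfl⟩

lemma mem_idealBall_mul {s : K} (hs : s ≠ 0) {t x : K} :
    s * x ∈ idealBall (s * t) ↔ x ∈ idealBall t := by
  simp only [mem_idealBall, mul_assoc, mul_right_inj' hs]

lemma isCompact_idealBall (t : K) : IsCompact (idealBall t : Set K) :=
  (IsNonarchimedeanLocalField.isCompact_closedBall K 1).image (continuous_const_mul t)

lemma isOpen_integer : IsOpen (𝒪[K] : Set K) := by
  refine AddSubgroup.isOpen_of_mem_nhds (𝒪[K]).toAddSubgroup (g := 0) ?_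
  refine (IsValuativeTopology.hasBasis_nhds_zero' K).mem_iff.2 ⟨1, one_ne_zero, fun x hx => ?_⟩
  exact (show valuation K x < 1 from hx).le

lemma isOpen_idealBall {t : K} (ht : t ≠ 0) : IsOpen (idealBall t : Set K) :=
  (Homeomorph.mulLeft₀ t ht).isOpenMap _ isOpen_integer

lemma absK_of_ne {x : K} (hx : x ≠ 0) : absK x = (distribHaarChar K (Units.mk0 x hx) : ℝ) := by
  rw [absK, dif_neg hx]

@[simp] lemma absK_zero : absK (0 : K) = 0 := by rw [absK, dif_pos rfl]

lemma absK_pos {x : K} (hx : x ≠ 0) : 0 < absK x := by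
  rw [absK_of_ne hx]
  exact_mod_cast distribHaarChar_pos

lemma absK_nonneg (x : K) : 0 ≤ absK x := by
  rcases eq_or_ne x 0 with rfl | hx
  · simp
  · exact (absK_pos hx).le

@[simp] lemma absK_one : absK (1 : K) = 1 := by
  rw [absK_of_ne one_ne_zero]
  simp

lemma absK_mul (x y : K) : absK (x * y) = absK x * absK y := by
  rcases eq_or_ne x 0 with rfl | hx
  · simp
  rcases eq_or_ne y 0 with rfl | hy
  · simp
  rw [absK_of_ne hx, absK_of_ne hy, absK_of_ne (mul_ne_zero hx hy), Units.mk0_mul, map_mul]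
  simp

/-- `absK` as a homomorphism of monoids with zero. -/
def absHom : K →*₀ ℝ where
  toFun := absK
  map_zero' := absK_zero
  map_one' := absK_one
  map_mul' := absK_mul

lemma absK_zpow (x : K) (n : ℤ) : absK (x ^ n) = absK x ^ n := map_zpow₀ (absHom (K := K)) x n

lemma absK_pow (x : K) (n : ℕ) : absK (x ^ n) = absK x ^ n := map_pow (absHom (K := K)) x n

lemma absK_inv (x : K) : absK x⁻¹ = (absK x)⁻¹ := map_inv₀ (absHom (K := K)) x

section Measure

variable [MeasurableSpace K] [BorelSpace K] (ν : Measure K) [ν.IsAddHaarMeasure]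

lemma measure_idealBall {t : K} (ht : t ≠ 0) :
    ν (idealBall t) = ENNReal.ofReal (absK t) * ν (𝒪[K] : Set K) := by
  have key : Measure.addHaar (G := K) (idealBall t)
      = ENNReal.ofReal (absK t) * Measure.addHaar (G := K) (𝒪[K] : Set K) := by
    have h := distribHaarChar_mul (Measure.addHaar (G := K)) (Units.mk0 t ht) (𝒪[K] : Set K)
    rw [absK_of_ne ht]
    simp only [ENNReal.ofReal_coe_nnreal]
    rw [h]
    rfl
  rw [Measure.measure_isAddHaarMeasure_eq_smul_of_isOpen ν (Measure.addHaar (G := K))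
      (isOpen_idealBall ht),
    Measure.measure_isAddHaarMeasure_eq_smul_of_isOpen ν (Measure.addHaar (G := K)) isOpen_integer,
    key]
  simp only [ENNReal.smul_def, smul_eq_mul]
  ring

lemma measureReal_idealBall {t : K} (ht : t ≠ 0) :
    ν.real (idealBall t) = absK t * ν.real (𝒪[K] : Set K) := by
  rw [Measure.real, measure_idealBall ν ht, ENNReal.toReal_mul,
    ENNReal.toReal_ofReal (absK_nonneg t), Measure.real]

lemma measureReal_integer_pos : 0 < ν.real (𝒪[K] : Set K) := by
  refine ENNReal.toReal_pos ?_ ?_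
  · exact (isOpen_integer.measure_pos ν ⟨0, (𝒪[K]).zero_mem⟩).ne'
  · exact (IsNonarchimedeanLocalField.isCompact_closedBall K 1).measure_lt_top.ne

end Measure

lemma absK_unit (u : (𝒪[K])ˣ) : absK ((u : 𝒪[K]) : K) = 1 := by
  borelize K
  have hu : ((u : 𝒪[K]) : K) ≠ 0 := by
    exact_mod_cast u.ne_zero
  have h := measureReal_idealBall (Measure.addHaar (G := K)) hu
  have he : (idealBall ((u : 𝒪[K]) : K) : Set K) = 𝒪[K] := by
    ext x
    refine ⟨?_, fun hx => ⟨(((u⁻¹ : (𝒪[K])ˣ) : 𝒪[K]) : K) * x,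
      (𝒪[K]).mul_mem (Subtype.mem _) hx, ?_⟩⟩
    · rintro ⟨y, hy, rfl⟩
      exact (𝒪[K]).mul_mem (Subtype.mem _) hy
    · have : ((u : 𝒪[K]) : K) * (((u⁻¹ : (𝒪[K])ˣ) : 𝒪[K]) : K) = 1 := by
        exact_mod_cast congrArg (Subtype.val) u.mul_inv
      simp [← mul_assoc, this]
  rw [he] at h
  have hp := measureReal_integer_pos (Measure.addHaar (G := K))
  exact mul_right_cancel₀ hp.ne' (by rw [← h, one_mul])

variable {ϖ : 𝒪[K]} (hϖ : Irreducible ϖ)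
include hϖ

lemma uniformizer_ne_zero : (ϖ : K) ≠ 0 := by exact_mod_cast hϖ.ne_zero

lemma exists_zpow_mul_unit {x : K} (hx : x ≠ 0) :
    ∃ (k : ℤ) (u : (𝒪[K])ˣ), x = (ϖ : K) ^ k * ((u : 𝒪[K]) : K) := by
  have key : ∀ y : K, y ≠ 0 → y ∈ 𝒪[K] →
      ∃ (k : ℕ) (u : (𝒪[K])ˣ), y = (ϖ : K) ^ k * ((u : 𝒪[K]) : K) := by
    intro y hy hyO
    obtain ⟨k, u, h⟩ := IsDiscreteValuationRing.eq_unit_mul_pow_irreducible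
      (x := (⟨y, hyO⟩ : 𝒪[K])) (by simpa [Subtype.ext_iff] using hy) hϖ
    refine ⟨k, u, ?_⟩
    have := congrArg Subtype.val h
    rw [mul_comm]
    simpa using this
  rcases le_total (valuation K x) 1 with h | h
  · obtain ⟨k, u, hk⟩ := key x hx h
    exact ⟨k, u, by simpa using hk⟩
  · have hi : x⁻¹ ∈ 𝒪[K] := by
      change valuation K x⁻¹ ≤ 1
      rw [map_inv₀]
      exact inv_le_one_of_one_le₀ h
    obtain ⟨k, u, hk⟩ := key x⁻¹ (inv_ne_zero hx) hi
    refine ⟨-k, u⁻¹, ?_⟩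
    have h1 : ((u : 𝒪[K]) : K) * (((u⁻¹ : (𝒪[K])ˣ) : 𝒪[K]) : K) = 1 := by
      exact_mod_cast congrArg (Subtype.val) u.mul_inv
    have h2 : ((u : 𝒪[K]) : K) ≠ 0 := by exact_mod_cast u.ne_zero
    rw [← inv_inv x, hk, mul_inv, zpow_neg, zpow_natCast, eq_inv_of_mul_eq_one_right h1]

lemma uniformizer_mul_ne_one {y : K} (hy : y ∈ 𝒪[K]) : (ϖ : K) * y ≠ 1 := by
  intro h
  refine hϖ.not_isUnit (IsUnit.of_mul_eq_one ⟨y, hy⟩ ?_)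
  exact Subtype.ext h

/-- The sets `ϖ 𝒪` and `1 + ϖ 𝒪` are disjoint, lie in `𝒪` and have the same volume, so `2|ϖ| ≤ 1`.
-/
lemma absK_uniformizer_lt_one : absK (ϖ : K) < 1 := by
  borelize K
  set ν := Measure.addHaar (G := K)
  have hp := measureReal_integer_pos ν
  have h0 := uniformizer_ne_zero hϖ
  have hb := measureReal_idealBall ν h0
  have hc : ν.real ((fun x => 1 + x) '' (idealBall (ϖ : K) : Set K)) = ν.real (idealBall (ϖ : K)) := by
    rw [Measure.real, Measure.real]
    congr 1
    rw [Set.image_add_left, measure_preimage_add]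
  have hd : Disjoint (idealBall (ϖ : K) : Set K) ((fun x => 1 + x) '' (idealBall (ϖ : K) : Set K)) := by
    rw [Set.disjoint_left]
    rintro _ hx ⟨y, hy, rfl⟩
    obtain ⟨z, hz, h⟩ := (AddSubgroup.add_mem_cancel_right _ hy).1 hx
    exact uniformizer_mul_ne_one hϖ hz h
  have hs : (idealBall (ϖ : K) : Set K) ∪ ((fun x => 1 + x) '' (idealBall (ϖ : K) : Set K))
      ⊆ 𝒪[K] := by
    have h1 : ∀ x ∈ idealBall (ϖ : K), x ∈ 𝒪[K] := by
      rintro _ ⟨y, hy, rfl⟩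
      exact (𝒪[K]).mul_mem ϖ.2 hy
    rintro x (hx | ⟨y, hy, rfl⟩)
    · exact h1 x hx
    · exact (𝒪[K]).add_mem (𝒪[K]).one_mem (h1 y hy)
  have hcomp : IsCompact (𝒪[K] : Set K) := IsNonarchimedeanLocalField.isCompact_closedBall K 1
  have hle := measureReal_mono (μ := ν) hs hcomp.measure_lt_top.ne
  have hm : MeasurableSet ((fun x => 1 + x) '' (idealBall (ϖ : K) : Set K)) :=
    ((isCompact_idealBall (ϖ : K)).image (continuous_const_add 1)).measurableSet
  rw [measureReal_union hd hm (isCompact_idealBall (ϖ : K)).measure_lt_top.ne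
    ((isCompact_idealBall (ϖ : K)).image (continuous_const_add 1)).measure_lt_top.ne, hc, hb] at hle
  have := absK_pos h0
  nlinarith

lemma exists_absK_eq_zpow {x : K} (hx : x ≠ 0) : ∃ k : ℤ, absK x = (absK (ϖ : K))⁻¹ ^ k := by
  obtain ⟨k, u, rfl⟩ := exists_zpow_mul_unit hϖ hx
  exact ⟨-k, by rw [absK_mul, absK_unit, mul_one, absK_zpow, inv_zpow, zpow_neg, inv_inv]⟩

lemma zpow_le_absK_iff {k : ℤ} {m : ℤ} :
    absK (ϖ : K) ^ k ≤ absK (ϖ : K) ^ m ↔ m ≤ k :=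
  zpow_le_zpow_iff_right_of_lt_one₀ (absK_pos (uniformizer_ne_zero hϖ))
    (absK_uniformizer_lt_one hϖ)

lemma zpow_mem_integer {k : ℤ} (hk : 0 ≤ k) : (ϖ : K) ^ k ∈ 𝒪[K] := by
  lift k to ℕ using hk
  rw [zpow_natCast]
  exact pow_mem ϖ.2 k

lemma mem_integer_iff_absK {x : K} : x ∈ 𝒪[K] ↔ absK x ≤ 1 := by
  rcases eq_or_ne x 0 with rfl | hx
  · simp
  obtain ⟨k, u, rfl⟩ := exists_zpow_mul_unit hϖ hx
  have h1 : absK ((ϖ : K) ^ k * ((u : 𝒪[K]) : K)) = absK (ϖ : K) ^ k := by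
    rw [absK_mul, absK_unit, mul_one, absK_zpow]
  rw [h1, ← zpow_zero (absK (ϖ : K)), zpow_le_absK_iff hϖ]
  refine ⟨fun h => ?_, fun h => (𝒪[K]).mul_mem (zpow_mem_integer hϖ h) (Subtype.mem _)⟩
  by_contra! hk
  have h2 : (ϖ : K) ^ k ∈ 𝒪[K] := by
    have := (𝒪[K]).mul_mem h (((u⁻¹ : (𝒪[K])ˣ) : 𝒪[K])).2
    have h3 : ((u : 𝒪[K]) : K) * (((u⁻¹ : (𝒪[K])ˣ) : 𝒪[K]) : K) = 1 := by
      exact_mod_cast congrArg (Subtype.val) u.mul_inv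
    rwa [mul_assoc, h3, mul_one] at this
  -- A negative power of `ϖ` in `𝒪` would put `ϖ⁻¹` there.
  have h4 := (𝒪[K]).mul_mem (zpow_mem_integer hϖ (show 0 ≤ -k - 1 by omega)) h2
  refine uniformizer_mul_ne_one hϖ h4 ?_
  have h0 := uniformizer_ne_zero hϖ
  rw [← zpow_add₀ h0, ← zpow_one_add₀ h0, show 1 + (-k - 1 + k) = 0 by ring, zpow_zero]

lemma mem_idealBall_iff_absK {t x : K} (ht : t ≠ 0) : x ∈ idealBall t ↔ absK x ≤ absK t := by
  have h1 : x ∈ idealBall t ↔ t⁻¹ * x ∈ 𝒪[K] := by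
    refine ⟨?_, fun h => ⟨_, h, by simp [mul_inv_cancel_left₀ ht]⟩⟩
    rintro ⟨y, hy, rfl⟩
    simpa [inv_mul_cancel_left₀ ht] using hy
  rw [h1, mem_integer_iff_absK hϖ, absK_mul, absK_inv, inv_mul_le_one₀ (absK_pos ht)]

lemma exists_idealBall_subset {U : Set K} (hU : U ∈ 𝓝 (0 : K)) :
    ∃ m : ℕ, ∀ k : ℤ, m ≤ k → (idealBall ((ϖ : K) ^ k) : Set K) ⊆ U := by
  obtain ⟨γ, hγ, h⟩ := (IsValuativeTopology.hasBasis_nhds_zero' K).mem_iff.1 hU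
  obtain ⟨y, rfl⟩ := valuation_surjective γ
  have hy : y ≠ 0 := by rintro rfl; simp at hγ
  obtain ⟨n, u, rfl⟩ := exists_zpow_mul_unit hϖ hy
  refine ⟨(n + 1).toNat, fun k hk x hx => h ?_⟩
  have hk' : n + 1 ≤ k := by omega
  change valuation K x < valuation K _
  by_contra! hv
  have hx' := (mem_idealBall_iff_absK hϖ (zpow_ne_zero _ (uniformizer_ne_zero hϖ))).1 hx
  have hdiv : ((ϖ : K) ^ n * ((u : 𝒪[K]) : K)) / x ∈ 𝒪[K] := by
    change valuation K _ ≤ 1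
    rw [map_div₀]
    exact div_le_one_of_le₀ hv zero_le
  rw [mem_integer_iff_absK hϖ, div_eq_mul_inv, absK_mul, absK_mul, absK_inv, absK_unit, mul_one,
    absK_zpow] at hdiv
  have hx0 : x ≠ 0 := by
    rintro rfl
    simp only [map_zero] at hv
    exact hγ (le_antisymm hv zero_le)
  rw [← div_eq_mul_inv, div_le_one (absK_pos hx0)] at hdiv
  rw [absK_zpow] at hx'
  have := (zpow_le_absK_iff hϖ).1 (hdiv.trans hx')
  omega

end LocalField

end

/-! ### Conductors of characters and duality of lattices in the phase space. -/

section

/-- The circle has no small subgroups. -/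
lemma circle_eq_one_of_pow_close {z : Circle} (h : ∀ n : ℕ, ‖((z ^ n : Circle) : ℂ) - 1‖ ≤ 1 / 2) :
    z = 1 := by
  have key : ∀ k : ℕ, (3 / 2 : ℝ) ^ k * ‖(z : ℂ) - 1‖ ≤ ‖((z ^ (2 ^ k) : Circle) : ℂ) - 1‖ := by
    intro k
    induction k with
    | zero => simp
    | succ k ih =>
      set y : ℂ := ((z ^ (2 ^ k) : Circle) : ℂ)
      have h1 : ((z ^ (2 ^ (k + 1)) : Circle) : ℂ) - 1 = (y + 1) * (y - 1) := by
        rw [pow_succ, pow_mul]; simp only [Circle.coe_pow, y]; ring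
      have h2 : (3 / 2 : ℝ) ≤ ‖y + 1‖ := by
        have h3 : ‖(2 : ℂ)‖ ≤ ‖y + 1‖ + ‖y - 1‖ := by
          have := norm_sub_le (y + 1) (y - 1)
          rwa [show y + 1 - (y - 1) = 2 by ring] at this
        have := h (2 ^ k)
        simp only [Complex.norm_ofNat] at h3
        linarith
      rw [h1, norm_mul, pow_succ', mul_assoc]
      exact mul_le_mul h2 ih (by positivity) (norm_nonneg _)
  have h0 : ‖(z : ℂ) - 1‖ = 0 := by
    by_contra hne
    have hp : 0 < ‖(z : ℂ) - 1‖ := lt_of_le_of_ne (norm_nonneg _) (Ne.symm hne)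
    obtain ⟨k, hk⟩ := pow_unbounded_of_one_lt (‖(z : ℂ) - 1‖⁻¹) (show (1 : ℝ) < 3 / 2 by norm_num)
    have h1 := (key k).trans (h _)
    have h2 : 1 < (3 / 2 : ℝ) ^ k * ‖(z : ℂ) - 1‖ := (inv_lt_iff_one_lt_mul₀ hp).1 hk
    linarith
  have h1 := sub_eq_zero.1 (norm_eq_zero.1 h0)
  exact Circle.ext (by simpa using h1)

section Character

variable {K : Type*} [Field K] [ValuativeRel K] [TopologicalSpace K]
  [IsNonarchimedeanLocalField K] {ϖ : 𝒪[K]} (hϖ : Irreducible ϖ)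
  {Ψ : AddChar K Circle} (hΨ : Continuous Ψ) (hΨ1 : Ψ ≠ 1)

include hϖ hΨ in
-- A small ideal is a subgroup mapped near `1`, so all powers of its values stay near `1`, and the
-- circle has no small subgroups.
lemma exists_trivial_on_idealBall : ∃ n : ℤ, ∀ y : 𝒪[K], Ψ ((ϖ : K) ^ n * (y : K)) = 1 := by
  have hc : Continuous fun x : K => ‖((Ψ x : Circle) : ℂ) - 1‖ :=
    ((continuous_subtype_val.comp hΨ).sub continuous_const).norm
  have hU : {x : K | ‖((Ψ x : Circle) : ℂ) - 1‖ < 1 / 2} ∈ 𝓝 (0 : K) :=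
    (isOpen_lt hc continuous_const).mem_nhds (by simp)
  obtain ⟨m, hm⟩ := exists_idealBall_subset hϖ hU
  refine ⟨m, fun y => circle_eq_one_of_pow_close fun n => ?_⟩
  rw [← AddChar.map_nsmul_eq_pow]
  exact le_of_lt (hm m le_rfl ((idealBall _).nsmul_mem (mul_mem_idealBall _ y.2) n))

include hϖ in
lemma trivial_mono {n k : ℤ} (hnk : n ≤ k) (h : ∀ y : 𝒪[K], Ψ ((ϖ : K) ^ n * (y : K)) = 1)
    (y : 𝒪[K]) : Ψ ((ϖ : K) ^ k * (y : K)) = 1 := by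
  have := h (⟨(ϖ : K) ^ (k - n), zpow_mem_integer hϖ (by omega)⟩ * y)
  have h0 := uniformizer_ne_zero hϖ
  rwa [Subring.coe_mul, ← mul_assoc, ← zpow_add₀ h0, add_sub_cancel] at this

include hϖ hΨ1 in
lemma bddBelow_trivial : BddBelow {n : ℤ | ∀ y : 𝒪[K], Ψ ((ϖ : K) ^ n * (y : K)) = 1} := by
  obtain ⟨x, hx⟩ := (AddChar.ne_one_iff).1 hΨ1
  have hx0 : x ≠ 0 := by rintro rfl; simp at hx
  obtain ⟨k, u, rfl⟩ := exists_zpow_mul_unit hϖ hx0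
  refine ⟨k, fun n hn => ?_⟩
  by_contra! h
  exact hx (trivial_mono hϖ h.le hn _)

include hϖ hΨ hΨ1 in
lemma trivial_conductorExp (y : 𝒪[K]) : Ψ ((ϖ : K) ^ conductorExp Ψ ϖ * (y : K)) = 1 :=
  Int.csInf_mem (exists_trivial_on_idealBall hϖ hΨ) (bddBelow_trivial hϖ hΨ1) y

include hϖ hΨ hΨ1 in
lemma trivial_iff_mem_idealBall {x : K} :
    (∀ y ∈ 𝒪[K], Ψ (x * y) = 1) ↔ x ∈ idealBall ((ϖ : K) ^ conductorExp Ψ ϖ) := by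
  constructor
  · intro h
    rcases eq_or_ne x 0 with rfl | hx
    · exact AddSubgroup.zero_mem _
    obtain ⟨k, u, rfl⟩ := exists_zpow_mul_unit hϖ hx
    have hk : conductorExp Ψ ϖ ≤ k := by
      refine csInf_le (bddBelow_trivial hϖ hΨ1) fun y => ?_
      have h1 : ((u : 𝒪[K]) : K) * (((u⁻¹ : (𝒪[K])ˣ) : 𝒪[K]) : K) = 1 := by
        exact_mod_cast congrArg (Subtype.val) u.mul_inv
      have := h ((((u⁻¹ : (𝒪[K])ˣ) : 𝒪[K]) : K) * y) ((𝒪[K]).mul_mem (Subtype.mem _) y.2)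
      rwa [mul_assoc, ← mul_assoc _ _ (y : K), h1, one_mul] at this
    have h0 := uniformizer_ne_zero hϖ
    refine ⟨(ϖ : K) ^ (k - conductorExp Ψ ϖ) * ((u : 𝒪[K]) : K),
      (𝒪[K]).mul_mem (zpow_mem_integer hϖ (by omega)) (Subtype.mem _), ?_⟩
    rw [AddMonoidHom.coe_mulLeft, ← mul_assoc, ← zpow_add₀ h0, add_sub_cancel]
  · rintro ⟨z, hz, rfl⟩ y hy
    change Ψ (_ * z * y) = 1
    rw [mul_assoc]
    exact trivial_conductorExp hϖ hΨ hΨ1 ⟨z * y, (𝒪[K]).mul_mem hz hy⟩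

end Character

section Lattice

variable {K : Type*} [Field K] [ValuativeRel K] [TopologicalSpace K]
  [IsNonarchimedeanLocalField K] {d : ℕ}

/-- The lattice `(t 𝒪)^d × (t c 𝒪)^d` of the phase space. -/
def lattice (d : ℕ) (c t : K) : AddSubgroup (Phase K d) :=
  (AddSubgroup.pi Set.univ fun _ => idealBall t).prod
    (AddSubgroup.pi Set.univ fun _ => idealBall (t * c))

lemma mem_lattice {c t : K} {X : Phase K d} : X ∈ lattice d c t ↔
    (∀ i, X.1 i ∈ idealBall t) ∧ ∀ i, X.2 i ∈ idealBall (t * c) := by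
  simp [lattice, AddSubgroup.mem_prod, AddSubgroup.mem_pi]

lemma coe_lattice (c t : K) : (lattice d c t : Set (Phase K d)) =
    (Set.univ.pi fun _ => (idealBall t : Set K)) ×ˢ
      (Set.univ.pi fun _ => (idealBall (t * c) : Set K)) := by
  ext X
  simp [mem_lattice, Set.mem_prod]

lemma isOpen_lattice {c t : K} (hc : c ≠ 0) (ht : t ≠ 0) :
    IsOpen (lattice d c t : Set (Phase K d)) := by
  rw [coe_lattice]
  exact (isOpen_set_pi Set.finite_univ fun _ _ => isOpen_idealBall ht).prod
    (isOpen_set_pi Set.finite_univ fun _ _ => isOpen_idealBall (mul_ne_zero ht hc))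

lemma isCompact_lattice (c t : K) : IsCompact (lattice d c t : Set (Phase K d)) := by
  rw [coe_lattice]
  exact (isCompact_univ_pi fun _ => isCompact_idealBall _).prod
    (isCompact_univ_pi fun _ => isCompact_idealBall _)

lemma smul_mem_lattice {c t : K} (s : K) (hs : s ≠ 0) {X : Phase K d} :
    s • X ∈ lattice d c (s * t) ↔ X ∈ lattice d c t := by
  simp only [mem_lattice, Prod.smul_fst, Prod.smul_snd, Pi.smul_apply, smul_eq_mul,
    mem_idealBall_mul hs, mul_assoc]

lemma lattice_mono {ϖ : 𝒪[K]} (hϖ : Irreducible ϖ) {c s t : K} (hc : c ≠ 0) (hs : s ≠ 0)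
    (ht : t ≠ 0) (h : absK s ≤ absK t) : lattice d c s ≤ lattice d c t := by
  intro X hX
  rw [mem_lattice] at hX ⊢
  refine ⟨fun i => ?_, fun i => ?_⟩
  · rw [mem_idealBall_iff_absK hϖ ht]
    exact ((mem_idealBall_iff_absK hϖ hs).1 (hX.1 i)).trans h
  · rw [mem_idealBall_iff_absK hϖ (mul_ne_zero ht hc)]
    refine ((mem_idealBall_iff_absK hϖ (mul_ne_zero hs hc)).1 (hX.2 i)).trans ?_
    rw [absK_mul, absK_mul]
    exact mul_le_mul_of_nonneg_right h (absK_nonneg c)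

lemma symp_smul_left (s : K) (X Y : Phase K d) : symp (s • X) Y = s * symp X Y := by
  simp only [symp, Prod.smul_fst, Prod.smul_snd, Pi.smul_apply, smul_eq_mul, mul_sub,
    Finset.mul_sum]
  congr 1 <;> exact Finset.sum_congr rfl fun _ _ => by ring

lemma symp_smul_right (s : K) (X Y : Phase K d) : symp X (s • Y) = s * symp X Y := by
  simp only [symp, Prod.smul_fst, Prod.smul_snd, Pi.smul_apply, smul_eq_mul, mul_sub,
    Finset.mul_sum]
  congr 1 <;> exact Finset.sum_congr rfl fun _ _ => by ring

lemma symp_add_left (X Y Z : Phase K d) : symp (X + Y) Z = symp X Z + symp Y Z := by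
  simp only [symp, Prod.fst_add, Prod.snd_add, Pi.add_apply, mul_add, add_mul,
    Finset.sum_add_distrib]
  ring

lemma symp_swap (X Y : Phase K d) : symp Y X = -symp X Y := by
  simp only [symp, neg_sub]

lemma symp_self (X : Phase K d) : symp X X = 0 := by simp [symp]

lemma continuous_symp : Continuous fun p : Phase K d × Phase K d => symp p.1 p.2 := by
  unfold symp
  fun_prop

/-- The scales `s` and `t` are dual when `2 s t = 1`, because each term of `2[X, Y]` then lies in
the conductor. Conversely, testing with vectors supported in one coordinate recovers the coordinates
of `X` one at a time. -/
lemma mem_lattice_iff {ϖ : 𝒪[K]} (hϖ : Irreducible ϖ) {Ψ : AddChar K Circle} (hΨ : Continuous Ψ)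
    (hΨ1 : Ψ ≠ 1) {s t : K} (hst : 2 * s * t = 1) (X : Phase K d) :
    X ∈ lattice d ((ϖ : K) ^ conductorExp Ψ ϖ) s ↔
      ∀ Y ∈ lattice d ((ϖ : K) ^ conductorExp Ψ ϖ) t, Ψ (2 * symp X Y) = 1 := by
  classical
  set c := (ϖ : K) ^ conductorExp Ψ ϖ
  have hc : c ≠ 0 := zpow_ne_zero _ (uniformizer_ne_zero hϖ)
  have hs0 : s ≠ 0 := by rintro rfl; simp at hst
  have ht0 : t ≠ 0 := by rintro rfl; simp at hst
  have h20 : (2 : K) ≠ 0 := by intro h; simp [h] at hst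
  constructor
  · intro hX Y hY
    rw [mem_lattice] at hX hY
    have hmem : 2 * symp X Y ∈ idealBall c := by
      rw [symp, mul_sub, Finset.mul_sum, Finset.mul_sum]
      refine (idealBall c).sub_mem (AddSubgroup.sum_mem _ fun i _ => ?_)
        (AddSubgroup.sum_mem _ fun i _ => ?_)
      · obtain ⟨x, hx, h1⟩ := mem_idealBall.1 (hX.2 i)
        obtain ⟨y, hy, h2⟩ := mem_idealBall.1 (hY.1 i)
        refine mem_idealBall.2 ⟨x * y, (𝒪[K]).mul_mem hx hy, ?_⟩
        rw [← h1, ← h2]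
        linear_combination (-(c * x * y)) * hst
      · obtain ⟨x, hx, h1⟩ := mem_idealBall.1 (hX.1 i)
        obtain ⟨y, hy, h2⟩ := mem_idealBall.1 (hY.2 i)
        refine mem_idealBall.2 ⟨x * y, (𝒪[K]).mul_mem hx hy, ?_⟩
        rw [← h1, ← h2]
        linear_combination (-(c * x * y)) * hst
    simpa using (trivial_iff_mem_idealBall hϖ hΨ hΨ1).2 hmem 1 (𝒪[K]).one_mem
  · intro h
    have hts : s = (2 * t)⁻¹ := eq_inv_of_mul_eq_one_left (by linear_combination hst)
    have h2t : 2 * t ≠ 0 := mul_ne_zero h20 ht0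
    refine mem_lattice.2 ⟨fun i => ?_, fun i => ?_⟩
    · have h1 : 2 * t * c * X.1 i ∈ idealBall c := by
        refine (trivial_iff_mem_idealBall hϖ hΨ hΨ1).1 fun y hy => ?_
        -- The sign offsets the minus sign in front of `⟨x, η⟩`.
        have := h (0, Pi.single i (t * c * -y)) (mem_lattice.2 ⟨fun j => by
          simp, fun j => ?_⟩)
        · simp only [symp, Pi.zero_apply, zero_mul, Finset.sum_const_zero, zero_sub,
            Pi.single_apply, mul_ite, mul_zero, Finset.sum_ite_eq', Finset.mem_univ, if_true] at this
          rw [← this]; congr 1; ring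
        · by_cases hj : j = i
          · subst hj
            simpa using (mul_mem_idealBall (t * c) hy)
          · simp [hj]
      rw [← mem_idealBall_mul (mul_ne_zero h2t hc)]
      convert! h1 using 2
      rw [hts, mul_right_comm, mul_inv_cancel₀ h2t, one_mul]
    · have h1 : 2 * t * X.2 i ∈ idealBall c := by
        refine (trivial_iff_mem_idealBall hϖ hΨ hΨ1).1 fun y hy => ?_
        have := h (Pi.single i (t * y), 0) (mem_lattice.2 ⟨fun j => ?_, fun j => by
          simp⟩)
        · simp only [symp, Pi.zero_apply, mul_zero, Finset.sum_const_zero, sub_zero,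
            Pi.single_apply, ite_mul, zero_mul, Finset.sum_ite_eq', Finset.mem_univ, if_true] at this
          rw [← this]; congr 1; ring
        · by_cases hj : j = i
          · subst hj
            simp [mul_mem_idealBall t hy]
          · simp [hj]
      rw [← mem_idealBall_mul h2t]
      convert! h1 using 2
      rw [hts, ← mul_assoc, mul_inv_cancel₀ h2t, one_mul]

section Measure

variable [MeasurableSpace K] [BorelSpace K] (ν : Measure K) [ν.IsAddHaarMeasure]

instance isAddHaarMeasure_phaseMeasure : (phaseMeasure ν d).IsAddHaarMeasure := by
  unfold phaseMeasure
  have h1 : (Measure.pi fun _ : Fin d => ν).IsAddHaarMeasure := inferInstance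
  have h2 : SFinite (Measure.pi fun _ : Fin d => ν) := inferInstance
  exact Measure.prod.instIsAddHaarMeasure _ _

/-- The normalization of the measure is used here: it gives each pair of dual coordinates the volume
`|t| ^ 2`. -/
lemma measureReal_lattice {c t : K} (hc : c ≠ 0) (ht : t ≠ 0)
    (hν : ν (𝒪[K] : Set K) * ν (idealBall c) = 1) :
    (phaseMeasure ν d).real (lattice d c t) = absK t ^ (2 * d) := by
  have h1 : ν.real (𝒪[K] : Set K) * ν.real (idealBall c) = 1 := by
    rw [Measure.real, Measure.real, ← ENNReal.toReal_mul, hν, ENNReal.toReal_one]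
  have h2 := measureReal_idealBall ν ht
  have h3 := measureReal_idealBall ν (mul_ne_zero ht hc)
  have h4 := measureReal_idealBall ν hc
  rw [absK_mul, mul_assoc, ← h4] at h3
  rw [coe_lattice, phaseMeasure, measureReal_prod_prod, Measure.real, Measure.real, Measure.pi_pi,
    Measure.pi_pi]
  simp only [Finset.prod_const, Finset.card_univ, Fintype.card_fin, ENNReal.toReal_pow]
  rw [← Measure.real, ← Measure.real, h2, h3, ← mul_pow, pow_mul]
  congr 1
  linear_combination absK t ^ 2 * h1

end Measure

end Lattice

end

/-! ### The phase space as a lattice system, and its dilations. -/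

section

variable {K : Type*} [Field K] [ValuativeRel K] [TopologicalSpace K]
  [IsNonarchimedeanLocalField K] {d : ℕ} {ϖ : 𝒪[K]} {Ψ : AddChar K Circle}

/-- The scale of the `m`-th lattice on which `μ₀` is at most `|ϖ| ^ (-m)`. -/
def outerScale (ϖ : 𝒪[K]) (m : ℕ) : K := 2⁻¹ * (ϖ : K) ^ (-(m : ℤ))

lemma outerScale_ne_zero (hϖ : Irreducible ϖ) (h2 : (2 : K) ≠ 0) (m : ℕ) :
    outerScale ϖ m ≠ 0 :=
  mul_ne_zero (inv_ne_zero h2) (zpow_ne_zero _ (uniformizer_ne_zero hϖ))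

lemma absK_outerScale (ϖ : 𝒪[K]) (m : ℕ) :
    absK (outerScale ϖ m) = (absK (2 : K))⁻¹ * (absK (ϖ : K))⁻¹ ^ m := by
  rw [outerScale, absK_mul, absK_inv, absK_zpow, zpow_neg, zpow_natCast, inv_pow]

/-- The largest lattice on which `μ₀ ≤ |ϖ| ^ (-m)`. -/
abbrev outerLattice (d : ℕ) (Ψ : AddChar K Circle) (ϖ : 𝒪[K]) (m : ℕ) : AddSubgroup (Phase K d) :=
  lattice d ((ϖ : K) ^ conductorExp Ψ ϖ) (outerScale ϖ m)

/-- The dual of `outerLattice`. -/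
abbrev innerLattice (d : ℕ) (Ψ : AddChar K Circle) (ϖ : 𝒪[K]) (m : ℕ) : AddSubgroup (Phase K d) :=
  lattice d ((ϖ : K) ^ conductorExp Ψ ϖ) ((ϖ : K) ^ m)

lemma mem_outerLattice (hϖ : Irreducible ϖ) (h2 : (2 : K) ≠ 0) {m : ℕ} {X : Phase K d} :
    X ∈ outerLattice d Ψ ϖ m ↔ (∀ i, absK (2 * X.1 i) ≤ (absK (ϖ : K))⁻¹ ^ m) ∧
      ∀ i, absK (2 * X.2 i * (ϖ : K) ^ (-conductorExp Ψ ϖ)) ≤ (absK (ϖ : K))⁻¹ ^ m := by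
  have h0 := uniformizer_ne_zero hϖ
  have hs := outerScale_ne_zero hϖ h2 m
  have h2' := absK_pos h2
  have hc : 0 < absK ((ϖ : K) ^ conductorExp Ψ ϖ) := absK_pos (zpow_ne_zero _ h0)
  rw [mem_lattice]
  refine and_congr (forall_congr' fun i => ?_) (forall_congr' fun i => ?_)
  · rw [mem_idealBall_iff_absK hϖ hs, absK_outerScale, absK_mul, le_inv_mul_iff₀ h2']
  · rw [mem_idealBall_iff_absK hϖ (mul_ne_zero hs (zpow_ne_zero _ h0)), absK_mul (outerScale ϖ m),
      absK_outerScale, zpow_neg, absK_mul, absK_mul, absK_inv, ← div_eq_mul_inv, div_le_iff₀ hc,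
      mul_assoc (absK (2 : K))⁻¹, le_inv_mul_iff₀ h2']

lemma one_lt_inv_absK (hϖ : Irreducible ϖ) : 1 < (absK (ϖ : K))⁻¹ :=
  (one_lt_inv₀ (absK_pos (uniformizer_ne_zero hϖ))).2 (absK_uniformizer_lt_one hϖ)

lemma muZero_le_iff {X : Phase K d} {r : ℝ} (hr : 1 ≤ r) : muZero Ψ ϖ X ≤ r ↔
    (∀ i, absK (2 * X.1 i) ≤ r) ∧ ∀ i, absK (2 * X.2 i * (ϖ : K) ^ (-conductorExp Ψ ϖ)) ≤ r := by
  have h0 : 0 ≤ r := zero_le_one.trans hr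
  have key : ∀ f : Fin d → ℝ, (⨆ i, f i) ≤ r ↔ ∀ i, f i ≤ r := fun f =>
    ⟨fun h i => (le_ciSup (Set.finite_range f).bddAbove i).trans h, fun h => Real.iSup_le h h0⟩
  rw [muZero, max_le_iff, max_le_iff, key, key]
  simp [hr]

/-- The absolute value is discrete: its nonzero values are integral powers of `|ϖ|⁻¹`. Hence `μ₀`
jumps exactly by this factor from one shell to the next. -/
lemma absK_succ_le (hϖ : Irreducible ϖ) {y : K} {m : ℕ} (h : (absK (ϖ : K))⁻¹ ^ m < absK y) :
    (absK (ϖ : K))⁻¹ ^ (m + 1) ≤ absK y := by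
  have hq := one_lt_inv_absK hϖ
  have hy : y ≠ 0 := by
    rintro rfl
    rw [absK_zero] at h
    exact absurd h (not_lt.2 (by positivity))
  obtain ⟨k, hk⟩ := exists_absK_eq_zpow hϖ hy
  rw [hk, ← zpow_natCast, zpow_lt_zpow_iff_right₀ hq] at h
  rw [hk, ← zpow_natCast, zpow_le_zpow_iff_right₀ hq]
  push_cast
  omega

lemma muZero_shell (hϖ : Irreducible ϖ) (h2 : (2 : K) ≠ 0) {m : ℕ} {X : Phase K d}
    (hX : X ∈ outerLattice d Ψ ϖ m) (hj : ∀ j < m, X ∉ outerLattice d Ψ ϖ j) :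
    muZero Ψ ϖ X = (absK (ϖ : K))⁻¹ ^ m := by
  have hq := one_lt_inv_absK hϖ
  refine le_antisymm ((muZero_le_iff (one_le_pow₀ hq.le)).2 ((mem_outerLattice hϖ h2).1 hX)) ?_
  rcases m with _ | k
  · rw [pow_zero]
    exact le_max_left _ _
  have h := hj k k.lt_succ_self
  obtain ⟨h1, h3⟩ := (muZero_le_iff (Ψ := Ψ) (ϖ := ϖ) (X := X) (r := muZero Ψ ϖ X)
    (le_max_left _ _)).1 le_rfl
  rw [mem_outerLattice hϖ h2, not_and_or] at h
  push Not at h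
  obtain ⟨i, hi⟩ | ⟨i, hi⟩ := h
  · exact (absK_succ_le hϖ hi).trans (h1 i)
  · exact (absK_succ_le hϖ hi).trans (h3 i)

lemma exists_outerLattice (hϖ : Irreducible ϖ) (h2 : (2 : K) ≠ 0) (X : Phase K d) :
    ∃ m, X ∈ outerLattice d Ψ ϖ m := by
  obtain ⟨m, hm⟩ := pow_unbounded_of_one_lt (muZero Ψ ϖ X) (one_lt_inv_absK hϖ)
  exact ⟨m, (mem_outerLattice hϖ h2).2
    ((muZero_le_iff (one_le_pow₀ (one_lt_inv_absK hϖ).le)).1 hm.le)⟩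

lemma exists_innerLattice_subset (hϖ : Irreducible ϖ) {U : Set (Phase K d)} (hU : U ∈ 𝓝 0) :
    ∃ m, (innerLattice d Ψ ϖ m : Set (Phase K d)) ⊆ U := by
  rw [show (0 : Phase K d) = (0, 0) from rfl, mem_nhds_prod_iff] at hU
  obtain ⟨u, hu, v, hv, huv⟩ := hU
  rw [show (0 : Fin d → K) = fun _ => 0 from rfl, nhds_pi] at hu hv
  obtain ⟨I, hI, s, hs, hsu⟩ := Filter.mem_pi.1 hu
  obtain ⟨I', hI', s', hs', hsv⟩ := Filter.mem_pi.1 hv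
  obtain ⟨m, hm⟩ := exists_idealBall_subset hϖ
    ((Filter.iInter_mem.2 hs : (⋂ i, s i) ∈ 𝓝 (0 : K)))
  obtain ⟨m', hm'⟩ := exists_idealBall_subset hϖ
    ((Filter.iInter_mem.2 hs' : (⋂ i, s' i) ∈ 𝓝 (0 : K)))
  have h0 := uniformizer_ne_zero hϖ
  refine ⟨max m (m' + (conductorExp Ψ ϖ).natAbs), fun X hX => huv ⟨hsu fun i _ => ?_,
    hsv fun i _ => ?_⟩⟩
  all_goals
    rw [SetLike.mem_coe, mem_lattice, ← zpow_natCast, ← zpow_add₀ h0] at hX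
  · exact Set.mem_iInter.1 (hm _ (by have := le_max_left m (m' + (conductorExp Ψ ϖ).natAbs); omega) (hX.1 i)) i
  · refine Set.mem_iInter.1 (hm' _ ?_ (hX.2 i)) i
    have := le_max_right m (m' + (conductorExp Ψ ϖ).natAbs)
    omega

variable [MeasurableSpace K] [BorelSpace K]

/-- The lattices of the phase space attached to a character. -/
def phaseSystem (h2 : (2 : K) ≠ 0) (hΨ : Continuous Ψ) (hΨ1 : Ψ ≠ 1) (hϖ : Irreducible ϖ)
    (ν : Measure K) [ν.IsAddHaarMeasure]
    (hν : ν (𝒪[K] : Set K) * ν (idealBall ((ϖ : K) ^ conductorExp Ψ ϖ)) = 1) (d : ℕ) :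
    LatticeSystem (Phase K d) where
  μ := phaseMeasure ν d
  haar := inferInstance
  β X Y := Ψ (2 * symp X Y)
  β_add_left X Y Z := by rw [symp_add_left, mul_add, AddChar.map_add_eq_mul]
  β_swap X Y := by rw [symp_swap, mul_neg, AddChar.map_neg_eq_inv]
  β_cont := hΨ.comp (continuous_symp.const_mul 2)
  c := absK (2 : K) ^ d
  B := outerLattice d Ψ ϖ
  D := innerLattice d Ψ ϖ
  D_open m := isOpen_lattice (zpow_ne_zero _ (uniformizer_ne_zero hϖ))
    (pow_ne_zero _ (uniformizer_ne_zero hϖ))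
  B_compact m := isCompact_lattice _ _
  mem_D m X := mem_lattice_iff hϖ hΨ hΨ1 (by
    have := uniformizer_ne_zero hϖ
    rw [outerScale, zpow_neg, zpow_natCast]; field_simp) X
  mem_B m X := mem_lattice_iff hϖ hΨ hΨ1 (by
    have := uniformizer_ne_zero hϖ
    rw [outerScale, zpow_neg, zpow_natCast]; field_simp) X
  B_mono m n h := by
    refine lattice_mono hϖ (zpow_ne_zero _ (uniformizer_ne_zero hϖ)) (outerScale_ne_zero hϖ h2 m)
      (outerScale_ne_zero hϖ h2 n) ?_
    rw [absK_outerScale, absK_outerScale]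
    exact mul_le_mul_of_nonneg_left (pow_le_pow_right₀ (one_lt_inv_absK hϖ).le h)
      (inv_nonneg.2 (absK_nonneg _))
  D_le_B_zero := by
    refine lattice_mono hϖ (zpow_ne_zero _ (uniformizer_ne_zero hϖ))
      (pow_ne_zero _ (uniformizer_ne_zero hϖ)) (outerScale_ne_zero hϖ h2 0) ?_
    have h : (2 : K) ∈ 𝒪[K] := by
      rw [← one_add_one_eq_two]
      exact (𝒪[K]).add_mem (𝒪[K]).one_mem (𝒪[K]).one_mem
    rw [absK_outerScale, pow_zero, pow_zero, mul_one, absK_one]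
    exact (one_le_inv₀ (absK_pos h2)).2 ((mem_integer_iff_absK hϖ).1 h)
  exhaust := exists_outerLattice hϖ h2
  basis U hU := exists_innerLattice_subset hϖ hU
  -- With `c = |2| ^ d` the product is `(|2| * |2|⁻¹ * |ϖ| ^ (-m) * |ϖ| ^ m) ^ (2d)`.
  vol m := by
    rw [measureReal_lattice ν (zpow_ne_zero _ (uniformizer_ne_zero hϖ))
      (outerScale_ne_zero hϖ h2 m) hν, measureReal_lattice ν
      (zpow_ne_zero _ (uniformizer_ne_zero hϖ)) (pow_ne_zero _ (uniformizer_ne_zero hϖ)) hν,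
      absK_outerScale, absK_pow]
    have h3 := (absK_pos h2).ne'
    have h4 := (absK_pos (uniformizer_ne_zero hϖ)).ne'
    rw [← pow_mul, mul_comm d 2, ← mul_pow, ← mul_pow]
    convert! one_pow _
    rw [inv_pow]
    field_simp
  q := (absK (ϖ : K))⁻¹
  one_lt_q := one_lt_inv_absK hϖ
  w := muZero Ψ ϖ
  w_shell m X := muZero_shell hϖ h2
  s := 2 * d
  growth m := by
    rw [measureReal_lattice ν (zpow_ne_zero _ (uniformizer_ne_zero hϖ))
      (outerScale_ne_zero hϖ h2 m) hν, measureReal_lattice ν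
      (zpow_ne_zero _ (uniformizer_ne_zero hϖ)) (outerScale_ne_zero hϖ h2 0) hν,
      absK_outerScale, absK_outerScale, mul_pow, ← pow_mul, pow_zero, mul_one,
      mul_comm m, mul_comm]

section Dilation

variable (h2 : (2 : K) ≠ 0) (hΨ : Continuous Ψ) (hΨ1 : Ψ ≠ 1) (hϖ : Irreducible ϖ)
  (ν : Measure K) [ν.IsAddHaarMeasure]
  (hν : ν (𝒪[K] : Set K) * ν (idealBall ((ϖ : K) ^ conductorExp Ψ ϖ)) = 1)

include hϖ in
lemma smul_mem_lattice_of_mem {c t : K} (hc : c ≠ 0) (ht : t ≠ 0) {θ : K} (hθ : θ ∈ 𝒪[K])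
    {X : Phase K d} (hX : X ∈ lattice d c t) : θ • X ∈ lattice d c t := by
  rcases eq_or_ne θ 0 with rfl | h0
  · simp
  refine lattice_mono hϖ hc (mul_ne_zero h0 ht) ht ?_ ((smul_mem_lattice θ h0).2 hX)
  rw [absK_mul]
  exact mul_le_of_le_one_left (absK_nonneg t) ((mem_integer_iff_absK hϖ).1 hθ)

include hϖ in
lemma exists_absK_eq_inv_pow {θ : K} (hθ : θ ∈ 𝒪[K]) (h0 : θ ≠ 0) :
    ∃ v : ℕ, absK θ * (absK (ϖ : K))⁻¹ ^ v = 1 := by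
  have hq := one_lt_inv_absK hϖ
  obtain ⟨k, hk⟩ := exists_absK_eq_zpow hϖ h0
  have h1 := (mem_integer_iff_absK hϖ).1 hθ
  rw [hk, ← zpow_zero (absK (ϖ : K))⁻¹, zpow_le_zpow_iff_right₀ hq] at h1
  refine ⟨(-k).toNat, ?_⟩
  rw [hk, ← zpow_natCast, ← zpow_add₀ (by positivity), Int.toNat_of_nonneg (by omega)]
  simp

include hϖ in
lemma lattice_congr {c s t : K} (hc : c ≠ 0) (hs : s ≠ 0) (ht : t ≠ 0) (h : absK s = absK t) :
    lattice d c s = lattice d c t :=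
  le_antisymm (lattice_mono hϖ hc hs ht h.le) (lattice_mono hϖ hc ht hs h.ge)

include hϖ h2 in
lemma smul_mem_outerLattice {θ : K} (h0 : θ ≠ 0) {v : ℕ}
    (hv : absK θ * (absK (ϖ : K))⁻¹ ^ v = 1) (m : ℕ) {X : Phase K d} :
    θ • X ∈ outerLattice d Ψ ϖ m ↔ X ∈ outerLattice d Ψ ϖ (m + v) := by
  have hs := outerScale_ne_zero hϖ h2
  rw [outerLattice, ← smul_mem_lattice θ h0 (t := outerScale ϖ (m + v)),
    lattice_congr hϖ (zpow_ne_zero _ (uniformizer_ne_zero hϖ)) (hs m)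
    (mul_ne_zero h0 (hs (m + v)))]
  rw [absK_mul, absK_outerScale, absK_outerScale, pow_add]
  linear_combination (-(absK (2 : K))⁻¹ * (absK (ϖ : K))⁻¹ ^ m) * hv

include hϖ in
lemma smul_mem_innerLattice {θ : K} (h0 : θ ≠ 0) {v : ℕ}
    (hv : absK θ * (absK (ϖ : K))⁻¹ ^ v = 1) (m : ℕ) {X : Phase K d} :
    θ • X ∈ innerLattice d Ψ ϖ (m + v) ↔ X ∈ innerLattice d Ψ ϖ m := by
  have hs := uniformizer_ne_zero hϖ
  rw [innerLattice, ← smul_mem_lattice θ h0 (t := (ϖ : K) ^ m),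
    lattice_congr hϖ (zpow_ne_zero _ hs) (pow_ne_zero _ hs) (mul_ne_zero h0 (pow_ne_zero _ hs))]
  have hp := (absK_pos hs).ne'
  rw [absK_mul, absK_pow, absK_pow, pow_add]
  have h1 : absK θ = absK (ϖ : K) ^ v := by
    rw [inv_pow] at hv
    exact (mul_inv_eq_one₀ (pow_ne_zero _ hp)).1 hv
  rw [h1, mul_comm]

/-- The dilation of the phase space by an integer, in terms of the index `j` of the image of a
shell. -/
lemma exists_dilation (θ : 𝒪[K]) :
    ∃ T : (phaseSystem h2 hΨ hΨ1 hϖ ν hν d).Dilation, ∀ X, T.θ X = (θ : K) • X := by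
  set L := phaseSystem h2 hΨ hΨ1 hϖ ν hν d
  have hc := zpow_ne_zero (conductorExp Ψ ϖ) (uniformizer_ne_zero hϖ)
  have hθc : Continuous fun X : Phase K d => (θ : K) • X := continuous_const_smul _
  have hβ : ∀ X Y : Phase K d, L.β ((θ : K) • X) Y = L.β X ((θ : K) • Y) := fun X Y => by
    change Ψ _ = Ψ _
    rw [symp_smul_left, symp_smul_right]
  have hβs : ∀ X : Phase K d, L.β ((θ : K) • X) X = 1 := fun X => by
    change Ψ _ = 1
    rw [symp_smul_left, symp_self]
    simp
  have hD : ∀ m, ∀ X ∈ L.D m, (θ : K) • X ∈ L.D m := fun m X hX =>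
    smul_mem_lattice_of_mem hϖ hc (pow_ne_zero _ (uniformizer_ne_zero hϖ)) θ.2 hX
  have hB : ∀ m, ∀ X ∈ L.B m, (θ : K) • X ∈ L.B m := fun m X hX =>
    smul_mem_lattice_of_mem hϖ hc (outerScale_ne_zero hϖ h2 m) θ.2 hX
  rcases eq_or_ne (θ : K) 0 with h0 | h0
  -- For `θ = 0` every image lies in the innermost shell, so `j = 0` and the surjectivity condition
  -- is vacuous.
  · refine ⟨⟨DistribSMul.toAddMonoidHom _ (θ : K), hθc, hβ, hβs, hD, hB, fun _ => 0,
      fun m => m.zero_le, fun m X _ => ?_, fun m X _ => ?_, fun m k h => by simp at h⟩,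
      fun X => rfl⟩
    · refine L.w_shell 0 _ ?_ (by simp)
      change (θ : K) • X ∈ L.B 0
      rw [h0, zero_smul]
      exact AddSubgroup.zero_mem _
    · change (θ : K) • X ∈ L.D m
      rw [h0, zero_smul]
      exact AddSubgroup.zero_mem _
  · obtain ⟨v, hv⟩ := exists_absK_eq_inv_pow hϖ θ.2 h0
    have hBv : ∀ m X, (θ : K) • X ∈ L.B m ↔ X ∈ L.B (m + v) := fun m X =>
      smul_mem_outerLattice h2 hϖ h0 hv m
    have hDv : ∀ m X, (θ : K) • X ∈ L.D (m + v) ↔ X ∈ L.D m := fun m X =>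
      smul_mem_innerLattice hϖ h0 hv m
    -- With `|θ| = q ^ (-v)`, multiplication by `θ` lowers the index by `v`; the truncation at `0`
    -- is right because `B 0` is a single shell.
    refine ⟨⟨DistribSMul.toAddMonoidHom _ (θ : K), hθc, hβ, hβs, hD, hB, fun m => m - v,
      fun m => Nat.sub_le m v, fun m X hX => ?_, fun m X hX => ?_, fun m k h X hX => ?_⟩,
      fun X => rfl⟩
    · refine L.w_shell (m - v) _ ((hBv _ _).2 (L.B_mono (by omega) hX.1)) fun j hj h => ?_
      exact hX.2 (j + v) (by omega) ((hBv _ _).1 h)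
    · exact L.D_anti (by omega : m ≤ m - v + v) ((hDv _ _).2 hX)
    -- Since `j m = k + 1` is positive, no truncation has occurred.
    · have hm : m - 1 = k + v := by omega
      have he : (θ : K) • ((θ : K)⁻¹ • X) = X := smul_inv_smul₀ h0 X
      refine ⟨(θ : K)⁻¹ • X, (hDv _ _).1 ?_, he⟩
      rw [he, ← hm]
      exact hX

end Dilation

end

/-! ### Translation between the stated objects and the abstract ones. -/

section

section Concrete

open LatticeSystem

variable {K : Type*} [Field K] [ValuativeRel K] [TopologicalSpace K]
  [IsNonarchimedeanLocalField K] [MeasurableSpace K] [BorelSpace K] {d : ℕ} {ϖ : 𝒪[K]}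
  {Ψ : AddChar K Circle} (h2 : (2 : K) ≠ 0) (hΨ : Continuous Ψ) (hΨ1 : Ψ ≠ 1)
  (hϖ : Irreducible ϖ) (ν : Measure K) [ν.IsAddHaarMeasure]
  (hν : ν (𝒪[K] : Set K) * ν (idealBall ((ϖ : K) ^ conductorExp Ψ ϖ)) = 1)
  {A : Type*} [NonUnitalCStarAlgebra A] (α : ContinuousAction (Phase K d) A)

lemma sympFourier_eq (f : Phase K d → ℂ) :
    sympFourier Ψ ν f = (phaseSystem h2 hΨ hΨ1 hϖ ν hν d).fourier f := by
  funext X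
  simp only [sympFourier, LatticeSystem.fourier, phaseSystem, Complex.ofReal_pow]

lemma representsJ_iff (θ : K) (n : ℕ) (F G : Phase K d → A) :
    RepresentsJ Ψ ϖ ν θ n F G ↔ (phaseSystem h2 hΨ hΨ1 hϖ ν hν d).Rep
      (fun Y => ((muZero Ψ ϖ (θ • Y) : ℝ) : ℂ) ^ n) F G := by
  simp only [RepresentsJ, LatticeSystem.Rep, IsTestFunction, testJ,
    sympFourier_eq h2 hΨ hΨ1 hϖ ν hν]
  rfl

variable {θ : 𝒪[K]} {T : (phaseSystem h2 hΨ hΨ1 hϖ ν hν d).Dilation}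

lemma radial_muZero (hT : ∀ X, T.θ X = (θ : K) • X) (n : ℕ) :
    (phaseSystem h2 hΨ hΨ1 hϖ ν hν d).Radial
      (fun Y => ((muZero Ψ ϖ ((θ : K) • Y) : ℝ) : ℂ) ^ n)
      fun m => ((phaseSystem h2 hΨ hΨ1 hϖ ν hν d).q : ℂ) ^ (T.j m * n) := by
  intro m X hX
  have h := T.w_map m X hX
  rw [hT] at h
  change muZero Ψ ϖ ((θ : K) • X) = _ at h
  simp only [h, Complex.ofReal_pow, pow_mul]

lemma radial_muZero_one (n : ℕ) :
    (phaseSystem h2 hΨ hΨ1 hϖ ν hν d).Radial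
      (fun Y => ((muZero Ψ ϖ ((1 : K) • Y) : ℝ) : ℂ) ^ n)
      fun m => ((phaseSystem h2 hΨ hΨ1 hϖ ν hν d).q : ℂ) ^ (m * n) := by
  intro m X hX
  have h := (phaseSystem h2 hΨ hΨ1 hϖ ν hν d).w_eq hX
  change muZero Ψ ϖ X = _ at h
  simp only [one_smul, h, Complex.ofReal_pow, pow_mul]

lemma norm_q_pow_j_le (n m : ℕ) :
    ‖((phaseSystem h2 hΨ hΨ1 hϖ ν hν d).q : ℂ) ^ (T.j m * n)‖
      ≤ (phaseSystem h2 hΨ hΨ1 hϖ ν hν d).q ^ (m * n) := by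
  rw [norm_q_pow]
  exact pow_le_pow_right₀ (phaseSystem h2 hΨ hΨ1 hϖ ν hν d).one_lt_q.le
    (Nat.mul_le_mul_right n (T.j_le m))

lemma coe_regular_eq_regularSet :
    ((phaseSystem h2 hΨ hΨ1 hϖ ν hν d).regular α : Set A) = regularSet Ψ ϖ ν α := by
  ext a
  rw [SetLike.mem_coe, mem_regular_iff _ α (radial_muZero_one h2 hΨ hΨ1 hϖ ν hν)]
  simp only [regularSet, representsJ_iff h2 hΨ hΨ1 hϖ ν hν]
  rfl

variable {α}

lemma existsUnique_representsJ (hT : ∀ X, T.θ X = (θ : K) • X) {a : A}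
    (ha : a ∈ (phaseSystem h2 hΨ hΨ1 hϖ ν hν d).regular α) (n : ℕ) :
    ∃! G : Phase K d →ᵇ A, RepresentsJ Ψ ϖ ν (θ : K) n (α.orbit a) G := by
  simp only [representsJ_iff h2 hΨ hΨ1 hϖ ν hν]
  exact existsUnique_rep _ α (radial_muZero h2 hΨ hΨ1 hϖ ν hν hT n)
    (norm_q_pow_j_le h2 hΨ hΨ1 hϖ ν hν n) ha

lemma existsUnique_representsJ_one {a : A}
    (ha : a ∈ (phaseSystem h2 hΨ hΨ1 hϖ ν hν d).regular α) (n : ℕ) :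
    ∃! G : Phase K d →ᵇ A, RepresentsJ Ψ ϖ ν 1 n (α.orbit a) G := by
  simp only [representsJ_iff h2 hΨ hΨ1 hϖ ν hν]
  exact existsUnique_rep _ α (radial_muZero_one h2 hΨ hΨ1 hϖ ν hν n)
    (fun m => (norm_q_pow _ _).le) ha

lemma boundedJ_eq_of_existsUnique {θ : K} {n : ℕ} {F : Phase K d → A} {G : Phase K d →ᵇ A}
    (h : ∃! G : Phase K d →ᵇ A, RepresentsJ Ψ ϖ ν θ n F G) (hG : RepresentsJ Ψ ϖ ν θ n F G) :
    boundedJ Ψ ϖ ν θ n F = G := by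
  rw [boundedJ, dif_pos h.exists]
  exact h.unique h.exists.choose_spec hG

lemma boundedJ_orbit (hT : ∀ X, T.θ X = (θ : K) • X) {a : A}
    (ha : a ∈ (phaseSystem h2 hΨ hΨ1 hϖ ν hν d).regular α) (n : ℕ) :
    boundedJ Ψ ϖ ν (θ : K) n (α.orbit a) = orbitBCF α
      ((phaseSystem h2 hΨ hΨ1 hϖ ν hν d).M α
        (fun m => ((phaseSystem h2 hΨ hΨ1 hϖ ν hν d).q : ℂ) ^ (T.j m * n)) a) :=
  boundedJ_eq_of_existsUnique ν (existsUnique_representsJ h2 hΨ hΨ1 hϖ ν hν hT ha n)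
    ((representsJ_iff h2 hΨ hΨ1 hϖ ν hν _ _ _ _).2
      (rep_M_of_mem _ α (radial_muZero h2 hΨ hΨ1 hϖ ν hν hT n)
        (norm_q_pow_j_le h2 hΨ hΨ1 hϖ ν hν n) ha))

lemma boundedJ_orbit_one (a : (phaseSystem h2 hΨ hΨ1 hϖ ν hν d).regular α) (n : ℕ) :
    boundedJ Ψ ϖ ν 1 n (α.orbit (a : A)) =
      orbitBCF α ((phaseSystem h2 hΨ hΨ1 hϖ ν hν d).J α n a) :=
  boundedJ_eq_of_existsUnique ν (existsUnique_representsJ_one h2 hΨ hΨ1 hϖ ν hν a.2 n)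
    ((representsJ_iff h2 hΨ hΨ1 hϖ ν hν _ _ _ _).2
      (rep_M_of_mem _ α (radial_muZero_one h2 hΨ hΨ1 hϖ ν hν n)
        (fun m => (norm_q_pow _ _).le) a.2))

lemma starIntegrand_eq (hT : ∀ X, T.θ X = (θ : K) • X)
    (a b : (phaseSystem h2 hΨ hΨ1 hϖ ν hν d).regular α) :
    starIntegrand Ψ ϖ ν (θ : K) α (a : A) (b : A) = fun p =>
      ((phaseSystem h2 hΨ hΨ1 hϖ ν hν d).amp p.1 * (phaseSystem h2 hΨ hΨ1 hϖ ν hν d).amp p.2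
        * ((phaseSystem h2 hΨ hΨ1 hϖ ν hν d).β p.2 p.1 : ℂ)) •
      (α.aut (T.θ p.1) ((phaseSystem h2 hΨ hΨ1 hϖ ν hν d).M α
          (fun m => ((phaseSystem h2 hΨ hΨ1 hϖ ν hν d).q : ℂ) ^ (T.j m * (2 * d + 1))) a)
        * α.aut p.2 ((phaseSystem h2 hΨ hΨ1 hϖ ν hν d).J α (2 * d + 1) b)) := by
  funext p
  rw [starIntegrand, boundedJ_orbit h2 hΨ hΨ1 hϖ ν hν hT a.2,
    boundedJ_orbit_one h2 hΨ hΨ1 hϖ ν hν b, orbitBCF_apply, orbitBCF_apply, hT]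
  congr 1
  -- The conjugate of `Ψ(2[X, Y])` is `β Y X`, by antisymmetry.
  rw [← conj_β, Complex.ofReal_mul, mul_comm]
  rfl

end Concrete

end

end

end PadicMoyal

theorem mainTheorem1
    {K : Type*} [Field K] [ValuativeRel K] [TopologicalSpace K] [IsNonarchimedeanLocalField K]
    [MeasurableSpace K] [BorelSpace K] (hchar : ringChar K ≠ 2)
    (Ψ : AddChar K Circle) (hΨ : Continuous Ψ) (hΨ1 : Ψ ≠ 1)
    (ϖ : 𝒪[K]) (hϖ : Irreducible ϖ)
    (ν : Measure K) [ν.IsAddHaarMeasure]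
    (hν : ν (𝒪[K] : Set K) * ν (conductor Ψ ϖ) = 1)
    (d : ℕ) (θ : 𝒪[K])
    {A : Type*} [NonUnitalCStarAlgebra A] (α : ContinuousAction (Phase K d) A) :
    -- the regular elements form a linear subspace `R`
    ∃ R : Submodule ℂ A, (R : Set A) = regularSet Ψ ϖ ν α ∧
      -- the functions that enter the seminorms and the product are well defined
      (∀ a ∈ R, ∀ n : ℕ,
        (∃! G : Phase K d →ᵇ A, RepresentsJ Ψ ϖ ν 1 n (α.orbit a) G) ∧
        (∃! G : Phase K d →ᵇ A, RepresentsJ Ψ ϖ ν (θ : K) n (α.orbit a) G)) ∧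
      (∀ a ∈ R, ∀ b ∈ R, Integrable (starIntegrand Ψ ϖ ν (θ : K) α a b)
        ((phaseMeasure ν d).prod (phaseMeasure ν d))) ∧
      ∃ (p : SeminormFamily ℂ R ℕ) (m : R →ₗ[ℂ] R →ₗ[ℂ] R) (U : UniformSpace R),
        -- the seminorms are `a ↦ sup_X ‖(J ^ n α̃(a))(X)‖`, the product is the deformed one
        (∀ n (a : R), p n a = ‖boundedJ Ψ ϖ ν 1 n (α.orbit (a : A))‖) ∧
        (∀ a b : R, (m a b : A) = starProd Ψ ϖ ν (θ : K) α (a : A) (b : A)) ∧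
        IsFrechetAlgebra U p m ∧
        -- the action is by automorphisms, isometric for each seminorm
        (∀ X : Phase K d, ∃ e : R ≃ₗ[ℂ] R, (∀ a : R, (e a : A) = α.aut X (a : A)) ∧
          (∀ a b : R, e (m a b) = m (e a) (e b)) ∧ ∀ n (a : R), p n (e a) = p n a) ∧
        -- the involution of `A` is an involution of the deformed algebra
        (∃ s : R → R, (∀ a : R, (s a : A) = star (a : A)) ∧
          (∀ a b : R, s (m a b) = m (s b) (s a)) ∧ ∀ n (a : R), p n (s a) = p n a) := by
  have h2 : (2 : K) ≠ 0 := Ring.two_ne_zero hchar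
  have hν' : ν (𝒪[K] : Set K) * ν (idealBall ((ϖ : K) ^ conductorExp Ψ ϖ)) = 1 := by
    rw [← hν]
    congr 2
    ext x
    simp [PadicMoyal.conductor, mem_idealBall, eq_comm]
  set L := phaseSystem h2 hΨ hΨ1 hϖ ν hν' d
  obtain ⟨T, hT⟩ : ∃ T : L.Dilation, ∀ X, T.θ X = (θ : K) • X :=
    exists_dilation h2 hΨ hΨ1 hϖ ν hν' θ
  have hint : ∀ a b : L.regular α, Integrable (starIntegrand Ψ ϖ ν (θ : K) α (a : A) (b : A))
      ((phaseMeasure ν d).prod (phaseMeasure ν d)) := fun a b => by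
    rw [starIntegrand_eq h2 hΨ hΨ1 hϖ ν hν' hT]
    exact L.integrable_osc α T L.amp_amp.1 L.amp_amp.1 _ _
  have hstar : ∀ a b : L.regular α,
      (L.prod α T a b : A) = starProd Ψ ϖ ν (θ : K) α (a : A) (b : A) := fun a b => by
    -- Here `s + 1 = 2d + 1`, and the element `x` is the one whose orbit map is `J_θ ^ (2d+1)
    -- α̃(a)`.
    rw [starProd, starIntegrand_eq h2 hΨ hΨ1 hϖ ν hν' hT, ← L.osc_eq_prod α T a b
      (L.Δ_M α (L.summable_of_mem α a.2 (norm_q_pow_j_le h2 hΨ hΨ1 hϖ ν hν' (2 * d + 1))))]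
    have hc : ((absK (2 : K) ^ (2 * d) : ℝ) : ℂ) = (L.c : ℂ) ^ 2 := by
      rw [mul_comm 2 d, pow_mul, Complex.ofReal_pow]
      rfl
    rw [hc]
    rfl
  refine ⟨L.regular α, coe_regular_eq_regularSet h2 hΨ hΨ1 hϖ ν hν' α,
    fun a ha n => ⟨existsUnique_representsJ_one h2 hΨ hΨ1 hϖ ν hν' ha n,
      existsUnique_representsJ h2 hΨ hΨ1 hϖ ν hν' hT ha n⟩,
    fun a ha b hb => hint ⟨a, ha⟩ ⟨b, hb⟩,
    fun n => (normSeminorm ℂ A).comp (L.J α n), L.prod α T, inducedUnif (L.J α),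
    fun n a => ?_, hstar, L.isFrechetAlgebra_regular α T,
    fun X => ⟨L.autR α X, L.coe_autR α X, L.autR_prod α T X, fun n a => ?_⟩,
    L.starR α, fun a => rfl, L.starR_prod α T, fun n a => ?_⟩
  · rw [boundedJ_orbit_one h2 hΨ hΨ1 hϖ ν hν' a n, LatticeSystem.norm_orbitBCF]
    rfl
  · change ‖L.J α n (L.autR α X a)‖ = ‖L.J α n a‖
    rw [L.J_autR, α.norm_aut]
  · change ‖L.J α n (L.starR α a)‖ = ‖L.J α n a‖
    rw [L.J_starR, norm_star]
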